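/- Let $\mathcal H,\mathcal X_B$ be real Hilbert spaces. An evolution operator on a time interval $I$ is a family $U(t,s)\in\mathcal L(\mathcal H)$, $s\le t$ in $I$, with $U(t,t)=I$, $U(t,r)U(r,s)=U(t,s)$, and with $U(\cdot,s)$ and $U(t,\cdot)$ strongly continuous. Let $Y(t,s)$ be an evolution operator on $[0,\infty)$, generated by $A_c(t)$. If $D(t)\in\mathcal L(\mathcal H)$, "the evolution operator generated by $A_c(t)+D(t)$" means an evolution operator $Z$ with $Z(t,s)x=Y(t,s)x+\int_s^tY(t,r)D(r)Z(r,s)x\,dr$ for all $x$ and $s\le t$. Let $B_c(t)\in\mathcal L(\mathcal X_B,\mathcal H)$, $W_c(t)\in\mathcal L(\mathcal H)$, $R_c(t)\in\mathcal L(\mathcal X_B)$ be norm-continuous and uniformly bounded on $[0,\infty)$, with $W_c(t)$ self-adjoint nonnegative and $R_c(t)$ self-adjoint with $\langle v,R_c(t)v\rangle\ge\delta\|v\|^2$ for some $\delta>0$ independent of $t$ and $v$. Let $P_0\in\mathcal L(\mathcal H)$ be self-adjoint and nonnegative. For $s\ge0$, $x\in\mathcal H$ and a strongly measurable control $u:[s,\infty)\to\mathcal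 X_B$ let $$z(t)=Y(t,s)x+\int_s^tY(t,r)B_c(r)u(r)\,dr,\qquad J_\infty(u;x,s)=\int_s^\infty\big(\langle z,W_cz\rangle+\langle u,R_cu\rangle\big)dr\in[0,\infty],$$ and assume that for all $s\ge 0$ and $x$ some control has $J_\infty(u;x,s)<\infty$. Assume that $(A_c,W_c^{1/2})$ is uniformly detectable: there is a norm-continuous, uniformly bounded $L(t)\in\mathcal L(\mathcal H)$ such that the evolution operator $Y_L$ generated by $A_c(t)+L(t)W_c^{1/2}(t)$ satisfies $\|Y_L(t,s)\|\le Me^{-\alpha(t-s)}$ for all $0\le s\le t$, for some $M\ge0$, $\alpha>0$. For each $t_f>0$ let $P_{t_f}$ be the bounded, strongly measurable solution on $[0,t_f]$, with $Y_{t_f}$ the evolution operator on $[0,t_f]$ generated by $A_c-B_cR_c^{-1}B_c^*P_{t_f}$, of the Riccati equation $$P_{t_f}(s)x=Y_{t_f}^*(t_f,s)P_0Y_{t_f}(t_f,s)x+\int_s^{t_f}Y_{t_f}^*(r,s)\big(W_c+P_{t_f}B_cR_c^{-1}B_c^*P_{t_f}\big)(r)\,Y_{t_f}(r,s)x\,dr\qquad(0\le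 s\le t_f,\ x\in\mathcal H).$$ Let $P_\infty(s)$, $s\ge0$, be the nonnegative self-adjoint operator with $\langle P_\infty(s)x,x\rangle=\inf_uJ_\infty(u;x,s)$ for all $x$, and let $Y_\infty$ be the evolution operator on $[0,\infty)$ generated by $A_c-B_cR_c^{-1}B_c^*P_\infty$. Then $P_\infty$ and $Y_\infty$ exist, and for each $z_0\in\mathcal H$ $$\lim_{t_f\to\infty}Y_{t_f}(t,s)z_0=Y_\infty(t,s)z_0,$$ uniformly in $t\in[s,t_f]$ and locally uniformly in $s$: for all $S\ge0$, $$\lim_{t_f\to\infty}\ \sup\{\|Y_{t_f}(t,s)z_0-Y_\infty(t,s)z_0\| : 0\le s\le S,\ s\le t\le t_f\}=0 .$$ -/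

import Mathlib

open MeasureTheory Set
open scoped ENNReal InnerProductSpace

noncomputable section

variable {H X XB : Type*}
  [NormedAddCommGroup H] [InnerProductSpace ℝ H] [CompleteSpace H]
  [NormedAddCommGroup X] [InnerProductSpace ℝ X] [CompleteSpace X]
  [NormedAddCommGroup XB] [InnerProductSpace ℝ XB] [CompleteSpace XB]

/-- `U t s`, for `s ≤ t` in the time interval `I`, is an evolution operator: it is the identity
on the diagonal, satisfies the composition law, and is strongly continuous in each variable.
Values of `U` outside `{(t, s) | s ≤ t, s ∈ I, t ∈ I}` play no role. -/
structure IsEvolutionOperator (I : Set ℝ) (U : ℝ → ℝ → H →L[ℝ] H) : Prop where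
  diag : ∀ t ∈ I, U t t = ContinuousLinearMap.id ℝ H
  comp : ∀ s ∈ I, ∀ r ∈ I, ∀ t ∈ I, s ≤ r → r ≤ t → (U t r).comp (U r s) = U t s
  continuousOn_left : ∀ s ∈ I, ∀ x : H, ContinuousOn (fun t => U t s x) (I ∩ Ici s)
  continuousOn_right : ∀ t ∈ I, ∀ x : H, ContinuousOn (fun s => U t s x) (I ∩ Iic t)

/-- If `Y` is the evolution operator generated by `A(t)`, this says that `Z` is the evolution
operator on `I` generated by `A(t) + D(t)`, i.e. `Z` is an evolution operator and
`Z(t,s) x = Y(t,s) x + ∫ₛᵗ Y(t,r) D(r) Z(r,s) x dr` (with an integrable integrand). -/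
structure IsPerturbedEvolution (I : Set ℝ) (Y : ℝ → ℝ → H →L[ℝ] H) (D : ℝ → H →L[ℝ] H)
    (Z : ℝ → ℝ → H →L[ℝ] H) : Prop where
  evolution : IsEvolutionOperator I Z
  integrable : ∀ s ∈ I, ∀ t ∈ I, s ≤ t → ∀ x : H,
    IntervalIntegrable (fun r => Y t r (D r (Z r s x))) volume s t
  eq : ∀ s ∈ I, ∀ t ∈ I, s ≤ t → ∀ x : H,
    Z t s x = Y t s x + ∫ r in s..t, Y t r (D r (Z r s x))

/-- Exponential stability of an evolution operator on `[0, ∞)`. -/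
def IsExponentiallyStable (U : ℝ → ℝ → H →L[ℝ] H) : Prop :=
  ∃ M α : ℝ, 0 ≤ M ∧ 0 < α ∧
    ∀ s t : ℝ, 0 ≤ s → s ≤ t → ‖U t s‖ ≤ M * Real.exp (-α * (t - s))

/-- An operator-valued function of time that is norm-continuous and uniformly bounded
on `[0, ∞)`. -/
def IsBoundedContinuousInTime {E F : Type*} [NormedAddCommGroup E] [NormedSpace ℝ E]
    [NormedAddCommGroup F] [NormedSpace ℝ F] (T : ℝ → E →L[ℝ] F) : Prop :=
  ContinuousOn T (Ici 0) ∧ ∃ c : ℝ, ∀ t : ℝ, 0 ≤ t → ‖T t‖ ≤ c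

/-- Uniform detectability of `(A(t), C(t))`, where `A(t)` generates `Y`: for some bounded
continuous output injection `L(t)`, the evolution operator generated by `A(t) + L(t) C(t)` is
exponentially stable. -/
def IsUniformlyDetectable (Y : ℝ → ℝ → H →L[ℝ] H) (C : ℝ → H →L[ℝ] X) : Prop :=
  ∃ L : ℝ → X →L[ℝ] H, IsBoundedContinuousInTime L ∧
    ∃ YL : ℝ → ℝ → H →L[ℝ] H,
      IsPerturbedEvolution (Ici 0) Y (fun r => (L r).comp (C r)) YL ∧ IsExponentiallyStable YL

/-- `R(t)` is self-adjoint and coercive, uniformly in `t ≥ 0`. -/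
def IsUniformlyCoercive (R : ℝ → XB →L[ℝ] XB) : Prop :=
  (∀ t : ℝ, 0 ≤ t → IsSelfAdjoint (R t)) ∧
    ∃ δ : ℝ, 0 < δ ∧ ∀ t : ℝ, 0 ≤ t → ∀ v : XB, δ * ‖v‖ ^ 2 ≤ ⟪v, R t v⟫_ℝ

/-- The feedback gain `K(t) = R(t)⁻¹ B(t)* P(t)`. -/
def feedbackGain (B : ℝ → XB →L[ℝ] H) (R : ℝ → XB →L[ℝ] XB) (P : ℝ → H →L[ℝ] H) (t : ℝ) :
    H →L[ℝ] XB :=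
  ((Ring.inverse (R t)).comp (ContinuousLinearMap.adjoint (B t))).comp (P t)

/-- `Z` is the closed-loop evolution operator on `I`, generated by `A(t) - B(t) K(t)` with
`K(t) = R(t)⁻¹ B(t)* P(t)`. -/
def IsClosedLoop (I : Set ℝ) (Y : ℝ → ℝ → H →L[ℝ] H) (B : ℝ → XB →L[ℝ] H)
    (R : ℝ → XB →L[ℝ] XB) (P : ℝ → H →L[ℝ] H) (Z : ℝ → ℝ → H →L[ℝ] H) : Prop :=
  IsPerturbedEvolution I Y (fun r => -((B r).comp (feedbackGain B R P r))) Z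

/-- The integrand `Z(r,s)* (W(r) + P(r) B(r) R(r)⁻¹ B(r)* P(r)) Z(r,s) x` of the Riccati
integral equation. -/
def riccatiIntegrand (B : ℝ → XB →L[ℝ] H) (W : ℝ → H →L[ℝ] H) (R : ℝ → XB →L[ℝ] XB)
    (P : ℝ → H →L[ℝ] H) (Z : ℝ → ℝ → H →L[ℝ] H) (s : ℝ) (x : H) (r : ℝ) : H :=
  ContinuousLinearMap.adjoint (Z r s)
    (W r (Z r s x) + P r (B r (feedbackGain B R P r (Z r s x))))

/-- `P` is a bounded strongly measurable solution on `[0, tf]` of the Riccati integral equation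
with terminal weight `P₀`, and `Z` is the corresponding closed-loop evolution operator. -/
structure IsFiniteHorizonRiccati (Y : ℝ → ℝ → H →L[ℝ] H) (B : ℝ → XB →L[ℝ] H)
    (W : ℝ → H →L[ℝ] H) (R : ℝ → XB →L[ℝ] XB) (P₀ : H →L[ℝ] H) (tf : ℝ)
    (P : ℝ → H →L[ℝ] H) (Z : ℝ → ℝ → H →L[ℝ] H) : Prop where
  measurable : ∀ x : H, AEStronglyMeasurable (fun t => P t x) (volume.restrict (Icc 0 tf))
  bounded : ∃ c : ℝ, ∀ t ∈ Icc 0 tf, ‖P t‖ ≤ c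
  closedLoop : IsClosedLoop (Icc 0 tf) Y B R P Z
  integrable : ∀ s ∈ Icc 0 tf, ∀ x : H,
    IntervalIntegrable (riccatiIntegrand B W R P Z s x) volume s tf
  riccati : ∀ s ∈ Icc 0 tf, ∀ x : H,
    P s x = ContinuousLinearMap.adjoint (Z tf s) (P₀ (Z tf s x))
      + ∫ r in s..tf, riccatiIntegrand B W R P Z s x r

/-- The mild solution at time `t` of `z' = A z + B u`, `z(s) = x`. -/
def mildState (Y : ℝ → ℝ → H →L[ℝ] H) (B : ℝ → XB →L[ℝ] H) (s : ℝ) (x : H) (u : ℝ → XB)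
    (t : ℝ) : H :=
  Y t s x + ∫ r in s..t, Y t r (B r (u r))

/-- The infinite-horizon cost `∫ₛ^∞ (⟨z, W z⟩ + ⟨u, R u⟩) dr ∈ [0, ∞]` of the control `u`,
from the state `x` at time `s`. -/
def infiniteHorizonCost (Y : ℝ → ℝ → H →L[ℝ] H) (B : ℝ → XB →L[ℝ] H) (W : ℝ → H →L[ℝ] H)
    (R : ℝ → XB →L[ℝ] XB) (s : ℝ) (x : H) (u : ℝ → XB) : ℝ≥0∞ :=
  ∫⁻ r in Ioi s, ENNReal.ofReal
    (⟪mildState Y B s x u r, W r (mildState Y B s x u r)⟫_ℝ + ⟪u r, R r (u r)⟫_ℝ)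

/-- The optimal infinite-horizon cost: the infimum of the cost over all strongly measurable
controls. -/
def optimalCost (Y : ℝ → ℝ → H →L[ℝ] H) (B : ℝ → XB →L[ℝ] H) (W : ℝ → H →L[ℝ] H)
    (R : ℝ → XB →L[ℝ] XB) (s : ℝ) (x : H) : ℝ≥0∞ :=
  ⨅ (u : ℝ → XB) (_ : AEStronglyMeasurable u (volume.restrict (Ioi s))),
    infiniteHorizonCost Y B W R s x u

/-- `P(s)`, `s ≥ 0`, is the nonnegative self-adjoint operator whose quadratic form is the
optimal infinite-horizon cost from time `s`, and `Z` is the corresponding closed-loop evolution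
operator on `[0, ∞)`. -/
structure IsInfiniteHorizonOptimal (Y : ℝ → ℝ → H →L[ℝ] H) (B : ℝ → XB →L[ℝ] H)
    (W : ℝ → H →L[ℝ] H) (R : ℝ → XB →L[ℝ] XB)
    (P : ℝ → H →L[ℝ] H) (Z : ℝ → ℝ → H →L[ℝ] H) : Prop where
  positive : ∀ s : ℝ, 0 ≤ s → (P s).IsPositive
  optimal : ∀ s : ℝ, 0 ≤ s → ∀ x : H,
    ENNReal.ofReal ⟪P s x, x⟫_ℝ = optimalCost Y B W R s x
  closedLoop : IsClosedLoop (Ici 0) Y B R P Z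

end

/-! The proof is variational: states, controls and Riccati operators are all estimated through the
cost.

Detectability converts cost into state bounds. Relative to the stable evolution `YL`, a state `z`
with control `u` is driven by `Bu - L W^{1/2} z`, whose square is dominated by the running cost.
Hence `‖z(t)‖² ≤ κ e^{-α(t-s)} ‖x‖² + κ J` (`IsRegulator.norm_sq_mildState_le`), and states of
finite cost tend to zero (`IsDetectableRegulator.tendsto_mildState_zero`).

By uniform convexity, near-minimisers of the cost on growing horizons form a Cauchy sequence in L².
Their limit `u` is an optimal control on `[s, ∞)`, and its cost `v` is the limit of the
finite-horizon values without terminal weight (`IsRegulator.exists_optimal_control`).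

Now use `u` as a competitor on `[s, T]` with terminal weight `P₀`. Completion of squares
(`IsRegulator.total_cost_eq`) says that its total cost exceeds `⟪P_T(s)x, x⟫` by the cost of the
difference between `u` and the feedback control, started from the zero state, plus a nonnegative
terminal term. The total cost is at most `v + ‖P₀‖ ‖z(T)‖²`, which tends to `v`, while `⟪P_T(s)x,
x⟫` is at least the finite-horizon value, which also tends to `v`. So the excess tends to zero, and
the detectability estimate from the zero state bounds `‖z(t) - Y_T(t,s)x‖` by it for all `t ∈ [s,
T]` at once (`IsOptimalControl.norm_sq_sub_le`). This is where the uniformity in `t` comes from; the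
same sandwich gives convergence of the forms of `P_T(s)`.

Two things remain. The limit is `Y_∞`: the feedback controls converge almost everywhere along a
subsequence and `P_T(r)` converges weakly, so the optimal control obeys the feedback law of `P_∞`
(`IsOptimalControl.eq_feedback`), and the closed-loop equation has only one solution
(`IsPerturbedEvolution.unique`). The convergence is locally uniform in `s`: bounds independent of
`T` give all the `Y_T` a common modulus of continuity in `s`, inherited from `Y`
(`norm_sub_le_of_gap`), and `[0, S]` is compact. -/

section Preliminaries

open Filter Topology

variable {E F G : Type*}
  [NormedAddCommGroup E] [InnerProductSpace ℝ E]
  [NormedAddCommGroup F] [InnerProductSpace ℝ F]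
  [NormedAddCommGroup G] [InnerProductSpace ℝ G]

/-! ### A Grönwall inequality for functions that need not be measurable -/

/-- Feeding the majorant `K e^{(2C+1)(b-s)}` into the hypothesis returns the same majorant with `K`
replaced by `A + K/2`, because `C/(2C+1) ≤ 1/2`; iterating from the bound `c` drives `K` to `2A`.
The `+1` keeps the rate positive when `C = 0`. Integrating only continuous majorants makes the
result usable for operator norms of families that are merely strongly measurable. -/
theorem le_exp_of_forall_majorant {f : ℝ → ℝ} {a b A C c : ℝ} (hA : 0 ≤ A) (hC : 0 ≤ C)
    (hc : 0 ≤ c) (hfc : ∀ r ∈ Icc a b, f r ≤ c)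
    (h : ∀ g : ℝ → ℝ, Continuous g → (∀ r ∈ Icc a b, f r ≤ g r) →
      ∀ s ∈ Icc a b, f s ≤ A + C * ∫ r in s..b, g r) :
    ∀ s ∈ Icc a b, f s ≤ 2 * A * Real.exp ((2 * C + 1) * (b - s)) := by
  have key : ∀ n : ℕ, ∀ s ∈ Icc a b,
      f s ≤ (2 * A + c * (1 / 2) ^ n) * Real.exp ((2 * C + 1) * (b - s)) := by
    intro n
    induction n with
    | zero =>
      intro s hs
      have h1 : 1 ≤ Real.exp ((2 * C + 1) * (b - s)) :=
        Real.one_le_exp (mul_nonneg (by linarith) (by linarith [hs.2]))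
      have h2 := hfc s hs
      nlinarith
    | succ n ih =>
      intro s hs
      set K : ℝ := 2 * A + c * (1 / 2) ^ n with hK
      have hK0 : 0 ≤ K := by positivity
      have hint : ∫ r in s..b, K * Real.exp ((2 * C + 1) * (b - r))
          = K / (2 * C + 1) * (Real.exp ((2 * C + 1) * (b - s)) - 1) := by
        have hd : ∀ r ∈ uIcc s b, HasDerivAt
            (fun r => -(K / (2 * C + 1)) * Real.exp ((2 * C + 1) * (b - r)))
            (K * Real.exp ((2 * C + 1) * (b - r))) r := by
          intro r _
          have h1 : HasDerivAt (fun r : ℝ => (2 * C + 1) * (b - r)) ((2 * C + 1) * (-1)) r :=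
            ((hasDerivAt_id r).const_sub b).const_mul _
          have hne : 2 * C + 1 ≠ 0 := by positivity
          refine (h1.exp.const_mul (-(K / (2 * C + 1)))).congr_deriv ?_
          field_simp
        rw [intervalIntegral.integral_eq_sub_of_hasDerivAt hd
          (Continuous.intervalIntegrable (by fun_prop) _ _)]
        simp
        ring
      have h1 := h (fun r => K * Real.exp ((2 * C + 1) * (b - r))) (by fun_prop) ih s hs
      rw [hint] at h1
      have hX : 1 ≤ Real.exp ((2 * C + 1) * (b - s)) :=
        Real.one_le_exp (mul_nonneg (by linarith) (by linarith [hs.2]))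
      have hq : C * (K / (2 * C + 1)) ≤ K / 2 := by
        rw [mul_div_assoc', div_le_div_iff₀ (by linarith) (by norm_num)]
        nlinarith
      have hq0 : 0 ≤ C * (K / (2 * C + 1)) := by positivity
      calc f s ≤ A + C * (K / (2 * C + 1)) * (Real.exp ((2 * C + 1) * (b - s)) - 1) := by
            linarith
        _ ≤ A * Real.exp ((2 * C + 1) * (b - s))
            + K / 2 * Real.exp ((2 * C + 1) * (b - s)) := by nlinarith
        _ = (2 * A + c * (1 / 2) ^ (n + 1)) * Real.exp ((2 * C + 1) * (b - s)) := by
            rw [hK, pow_succ]; ring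
  intro s hs
  have hlim : Tendsto (fun n : ℕ =>
      (2 * A + c * (1 / 2 : ℝ) ^ n) * Real.exp ((2 * C + 1) * (b - s))) atTop
      (𝓝 ((2 * A + c * 0) * Real.exp ((2 * C + 1) * (b - s)))) :=
    ((tendsto_const_nhds.add
      ((tendsto_pow_atTop_nhds_zero_of_lt_one (by norm_num) (by norm_num)).const_mul c)).mul_const _)
  simpa using ge_of_tendsto' hlim fun n => key n s hs

/-- The backward version under the reflection `r ↦ a + b - r`. -/
theorem le_exp_of_forall_majorant_forward {f : ℝ → ℝ} {a b A C c : ℝ} (hA : 0 ≤ A) (hC : 0 ≤ C)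
    (hc : 0 ≤ c) (hfc : ∀ r ∈ Icc a b, f r ≤ c)
    (h : ∀ g : ℝ → ℝ, Continuous g → (∀ r ∈ Icc a b, f r ≤ g r) →
      ∀ t ∈ Icc a b, f t ≤ A + C * ∫ r in a..t, g r) :
    ∀ t ∈ Icc a b, f t ≤ 2 * A * Real.exp ((2 * C + 1) * (t - a)) := by
  have hmem : ∀ r ∈ Icc a b, a + b - r ∈ Icc a b := fun r hr =>
    ⟨by linarith [hr.2], by linarith [hr.1]⟩
  have := le_exp_of_forall_majorant (f := fun r => f (a + b - r)) (a := a) (b := b) hA hC hc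
    (fun r hr => hfc _ (hmem r hr)) (fun g hg hfg s hs => by
      have h1 := h (fun r => g (a + b - r)) (by fun_prop)
        (fun r hr => by simpa using hfg _ (hmem r hr)) _ (hmem s hs)
      rw [intervalIntegral.integral_comp_sub_left (fun r => g r) (a + b)] at h1
      simpa using h1)
  intro t ht
  have h2 := this _ (hmem t ht)
  simp only [sub_sub_cancel] at h2
  convert h2 using 3
  ring

/-! ### Measurability and integration -/

/-- Approximate `g` by simple functions: on each fibre the vector is constant, so measurability of
`T` on fixed vectors suffices. No norm measurability of `T` and no separability is needed. -/
theorem aestronglyMeasurable_clm_apply {α : Type*} [MeasurableSpace α] {μ : Measure α}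
    {T : α → E →L[ℝ] F} {g : α → E} (hT : ∀ x, AEStronglyMeasurable (fun r => T r x) μ)
    (hg : AEStronglyMeasurable g μ) : AEStronglyMeasurable (fun r => T r (g r)) μ := by
  obtain ⟨g', hg', hgg'⟩ := hg
  have hcongr : (fun r => T r (g' r)) =ᵐ[μ] fun r => T r (g r) := by
    filter_upwards [hgg'] with r hr
    rw [hr]
  refine AEStronglyMeasurable.congr ?_ hcongr
  refine aestronglyMeasurable_of_tendsto_ae (u := atTop)
    (f := fun n r => T r (hg'.approx n r)) (fun n => ?_)
    (Eventually.of_forall fun r => ((T r).continuous.tendsto _).comp (hg'.tendsto_approx r))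
  have heq : (fun r => T r (hg'.approx n r))
      = fun r => ∑ y ∈ (hg'.approx n).range, ((hg'.approx n) ⁻¹' {y}).indicator
          (fun r => T r y) r := by
    funext r
    rw [Finset.sum_eq_single (hg'.approx n r)]
    · simp [indicator]
    · intro y _ hy
      simp only [indicator, mem_preimage, mem_singleton_iff, ite_eq_right_iff]
      exact fun h => absurd h.symm hy
    · intro hy
      exact absurd (SimpleFunc.mem_range_self _ r) hy
  rw [heq]
  exact Finset.aestronglyMeasurable_fun_sum _ fun y _ =>
    (hT y).indicator ((hg'.approx n).measurableSet_fiber y)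

/-- Fubini on the square for `f` extended by zero off the triangle `s < r < σ ≤ t`; a bound
depending on `r` alone is integrable there. -/
theorem intervalIntegral_triangle_swap {f : ℝ → ℝ → E} {s t : ℝ} (hst : s ≤ t) {k : ℝ → ℝ}
    (hk : IntervalIntegrable k volume s t)
    (hf : AEStronglyMeasurable (Function.uncurry f)
      ((volume.prod volume).restrict {p : ℝ × ℝ | s < p.1 ∧ p.1 < p.2 ∧ p.2 ≤ t}))
    (hb : ∀ r σ, s < r → r < σ → σ ≤ t → ‖f r σ‖ ≤ k r) :
    ∫ r in s..t, ∫ σ in r..t, f r σ = ∫ σ in s..t, ∫ r in s..σ, f r σ := by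
  set T : Set (ℝ × ℝ) := {p | s < p.1 ∧ p.1 < p.2 ∧ p.2 ≤ t} with hT
  have hTm : MeasurableSet T :=
    (measurableSet_lt measurable_const measurable_fst).inter
      ((measurableSet_lt measurable_fst measurable_snd).inter
        (measurableSet_le measurable_snd measurable_const))
  set φ : ℝ → ℝ → E := fun r σ => T.indicator (Function.uncurry f) (r, σ) with hφ
  have hφm : AEStronglyMeasurable (Function.uncurry φ) (volume.prod volume) :=
    (aestronglyMeasurable_indicator_iff hTm).2 hf
  have hφi : Integrable (Function.uncurry φ)
      ((volume.restrict (Ioc s t)).prod (volume.restrict (Ioc s t))) := by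
    have hk' : Integrable (fun p : ℝ × ℝ => ‖k p.1‖)
        ((volume.restrict (Ioc s t)).prod (volume.restrict (Ioc s t))) :=
      Integrable.comp_fst (hk.1.norm) (volume.restrict (Ioc s t))
    refine hk'.mono' ?_ (Eventually.of_forall fun p => ?_)
    · rw [Measure.prod_restrict]
      exact hφm.mono_measure Measure.restrict_le_self
    · by_cases hp : p ∈ T
      · have : Function.uncurry φ p = f p.1 p.2 := by
          simp only [hφ, Function.uncurry]
          rw [indicator_of_mem hp]
          rfl
        rw [this]
        exact (hb _ _ hp.1 hp.2.1 hp.2.2).trans (Real.le_norm_self _)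
      · have : Function.uncurry φ p = 0 := by
          simp only [hφ, Function.uncurry]
          rw [indicator_of_notMem hp]
        rw [this]; simp
  have h1 : ∫ r in s..t, ∫ σ in r..t, f r σ
      = ∫ r in Ioc s t, ∫ σ in Ioc s t, φ r σ := by
    rw [intervalIntegral.integral_of_le hst]
    refine setIntegral_congr_fun measurableSet_Ioc fun r hr => ?_
    rw [intervalIntegral.integral_of_le hr.2]
    have : (fun σ => φ r σ) = (Ioc r t).indicator (f r) := by
      funext σ
      by_cases h : σ ∈ Ioc r t
      · rw [indicator_of_mem h]
        exact indicator_of_mem (show (r, σ) ∈ T from ⟨hr.1, h.1, h.2⟩) _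
      · rw [indicator_of_notMem h]
        exact indicator_of_notMem (fun h' : (r, σ) ∈ T => h ⟨h'.2.1, h'.2.2⟩) _
    rw [this, setIntegral_indicator measurableSet_Ioc]
    congr 2
    ext σ
    simp only [mem_inter_iff, mem_Ioc]
    constructor
    · exact fun h => ⟨⟨hr.1.trans h.1, h.2⟩, h⟩
    · exact fun h => h.2
  have h2 : ∫ σ in s..t, ∫ r in s..σ, f r σ
      = ∫ σ in Ioc s t, ∫ r in Ioc s t, φ r σ := by
    rw [intervalIntegral.integral_of_le hst]
    refine setIntegral_congr_fun measurableSet_Ioc fun σ hσ => ?_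
    rw [intervalIntegral.integral_of_le hσ.1.le]
    have : (fun r => φ r σ) = (Ioo s σ).indicator (fun r => f r σ) := by
      funext r
      by_cases h : r ∈ Ioo s σ
      · rw [indicator_of_mem h]
        exact indicator_of_mem (show (r, σ) ∈ T from ⟨h.1, h.2, hσ.2⟩) _
      · rw [indicator_of_notMem h]
        exact indicator_of_notMem (fun h' : (r, σ) ∈ T => h ⟨h'.1, h'.2.1⟩) _
    rw [this, setIntegral_indicator measurableSet_Ioo, integral_Ioc_eq_integral_Ioo]
    congr 2
    ext r
    simp only [mem_inter_iff, mem_Ioc, mem_Ioo]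
    constructor
    · exact fun h => ⟨⟨h.1, h.2.le.trans hσ.2⟩, h⟩
    · exact fun h => h.2
  rw [h1, h2]
  exact integral_integral_swap hφi

theorem sq_integral_mul_le {α : Type*} [MeasurableSpace α] {μ : Measure α} {φ ψ : α → ℝ}
    (hφ : MemLp φ 2 μ) (hψ : MemLp ψ 2 μ) :
    (∫ x, φ x * ψ x ∂μ) ^ 2 ≤ (∫ x, φ x ^ 2 ∂μ) * ∫ x, ψ x ^ 2 ∂μ := by
  have h1 := hφ.integrable_sq
  have h2 := hψ.integrable_sq
  have h3 : Integrable (fun x => φ x * ψ x) μ := hφ.integrable_mul hψ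
  have key : ∀ θ : ℝ, 0 ≤ (∫ x, φ x ^ 2 ∂μ) * (θ * θ) + (-2 * ∫ x, φ x * ψ x ∂μ) * θ
      + ∫ x, ψ x ^ 2 ∂μ := by
    intro θ
    have h0 : 0 ≤ ∫ x, (θ * φ x - ψ x) ^ 2 ∂μ := integral_nonneg fun x => sq_nonneg _
    have : ∫ x, (θ * φ x - ψ x) ^ 2 ∂μ
        = (∫ x, φ x ^ 2 ∂μ) * (θ * θ) + (-2 * ∫ x, φ x * ψ x ∂μ) * θ + ∫ x, ψ x ^ 2 ∂μ := by
      have e : (fun x => (θ * φ x - ψ x) ^ 2)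
          = fun x => (θ * θ) * φ x ^ 2 + (-2 * θ) * (φ x * ψ x) + ψ x ^ 2 := by
        funext x; ring
      have i1 := h1.const_mul (θ * θ)
      have i3 := h3.const_mul (-2 * θ)
      have i13 : Integrable (fun x => (θ * θ) * φ x ^ 2 + (-2 * θ) * (φ x * ψ x)) μ := i1.add i3
      rw [e, integral_add i13 h2, integral_add i1 i3, integral_const_mul, integral_const_mul]
      ring
    rwa [this] at h0
  have := discrim_le_zero key
  simp only [discrim] at this
  nlinarith

/-! ### Positive operators -/

/-- Positivity at `x - y` gives `2⟪Ax, y⟫ ≤ ⟪Ax, x⟫ + ⟪Ay, y⟫`, so the form controls the whole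
operator. It turns bounds on optimal costs into bounds on Riccati operators. -/
theorem norm_le_of_inner_self_le {A : E →L[ℝ] E} (hA : A.IsPositive) {c : ℝ} (hc : 0 ≤ c)
    (h : ∀ x, ⟪A x, x⟫_ℝ ≤ c * ‖x‖ ^ 2) : ‖A‖ ≤ c := by
  refine A.opNorm_le_bound hc fun x => ?_
  have key : ∀ y, 2 * ⟪A x, y⟫_ℝ ≤ ⟪A x, x⟫_ℝ + ⟪A y, y⟫_ℝ := by
    intro y
    have h0 := hA.inner_nonneg_left (x - y)
    have hs : ⟪A y, x⟫_ℝ = ⟪A x, y⟫_ℝ := by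
      rw [hA.inner_left_eq_inner_right, real_inner_comm]
    simp only [map_sub, inner_sub_left, inner_sub_right, hs] at h0
    linarith
  rcases eq_or_ne (A x) 0 with h0 | h0
  · rw [h0, norm_zero]; positivity
  have hp : 0 < ‖A x‖ := norm_pos_iff.2 h0
  -- The test vector is `A x` rescaled to the length of `x`, which balances the two quadratic terms.
  have h1 := key ((‖x‖ / ‖A x‖) • A x)
  have h2 := h ((‖x‖ / ‖A x‖) • A x)
  rw [norm_smul, Real.norm_of_nonneg (by positivity), div_mul_cancel₀ _ hp.ne'] at h2
  rw [inner_smul_right, real_inner_self_eq_norm_sq] at h1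
  have h3 := h x
  have h4 : ‖x‖ / ‖A x‖ * ‖A x‖ ^ 2 = ‖x‖ * ‖A x‖ := by field_simp
  rw [h4] at h1
  have hx : 0 < ‖x‖ := by
    rw [norm_pos_iff]; rintro rfl; simp at h0
  nlinarith

theorem inner_tendsto_of_inner_self_tendsto {ι : Type*} {l : Filter ι} {A : ι → E →L[ℝ] E}
    (hA : ∀ᶠ i in l, (A i).IsPositive) {v : E → ℝ}
    (hv : ∀ x, Tendsto (fun i => ⟪A i x, x⟫_ℝ) l (𝓝 (v x))) (x y : E) :
    Tendsto (fun i => ⟪A i x, y⟫_ℝ) l (𝓝 ((v (x + y) - v x - v y) / 2)) := by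
  refine Tendsto.congr' ?_ ((((hv (x + y)).sub (hv x)).sub (hv y)).div_const 2)
  filter_upwards [hA] with i hi
  have hs : ⟪A i y, x⟫_ℝ = ⟪A i x, y⟫_ℝ := by
    rw [hi.inner_left_eq_inner_right, real_inner_comm]
  simp only [map_add, inner_add_left, inner_add_right, hs]
  ring

variable [CompleteSpace E]

/-- The polarised limit `β` is bilinear as a limit of bilinear forms and bounded by `c`; Riesz
representation then yields the operator. -/
theorem exists_isPositive_of_inner_self_tendsto {A : ℕ → E →L[ℝ] E}
    (hA : ∀ᶠ n in atTop, (A n).IsPositive) {v : E → ℝ} {c : ℝ}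
    (hv : ∀ x, Tendsto (fun n => ⟪A n x, x⟫_ℝ) atTop (𝓝 (v x)))
    (hc : ∀ᶠ n in atTop, ‖A n‖ ≤ c) :
    ∃ Q : E →L[ℝ] E, Q.IsPositive ∧ ∀ x, ⟪Q x, x⟫_ℝ = v x := by
  have hw := inner_tendsto_of_inner_self_tendsto hA hv
  set β : E → E → ℝ := fun x y => (v (x + y) - v x - v y) / 2 with hβ
  have add_l : ∀ x x' y, β (x + x') y = β x y + β x' y := fun x x' y =>
    tendsto_nhds_unique (hw (x + x') y)
      (((hw x y).add (hw x' y)).congr fun n => by rw [map_add, inner_add_left])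
  have smul_l : ∀ (a : ℝ) x y, β (a • x) y = a • β x y := fun a x y =>
    tendsto_nhds_unique (hw (a • x) y)
      (((hw x y).const_smul a).congr fun n => by
        rw [map_smul, real_inner_smul_left, smul_eq_mul])
  have add_r : ∀ x y y', β x (y + y') = β x y + β x y' := fun x y y' =>
    tendsto_nhds_unique (hw x (y + y'))
      (((hw x y).add (hw x y')).congr fun n => by rw [inner_add_right])
  have smul_r : ∀ (a : ℝ) x y, β x (a • y) = a • β x y := fun a x y =>
    tendsto_nhds_unique (hw x (a • y))
      (((hw x y).const_smul a).congr fun n => by rw [real_inner_smul_right, smul_eq_mul])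
  have hbound : ∀ x y, ‖β x y‖ ≤ c * ‖x‖ * ‖y‖ := by
    intro x y
    refine le_of_tendsto (hw x y).norm ?_
    filter_upwards [hc] with n hn
    calc ‖⟪A n x, y⟫_ℝ‖ ≤ ‖A n x‖ * ‖y‖ := norm_inner_le_norm _ _
      _ ≤ c * ‖x‖ * ‖y‖ := by
        gcongr
        exact (A n).le_of_opNorm_le hn x
  let b : E →L[ℝ] E →L[ℝ] ℝ :=
    LinearMap.mkContinuous₂ (LinearMap.mk₂ ℝ β add_l smul_l add_r smul_r) c hbound
  have hb : ∀ x y, ⟪InnerProductSpace.continuousLinearMapOfBilin b x, y⟫_ℝ = β x y := fun x y =>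
    InnerProductSpace.continuousLinearMapOfBilin_apply b x y
  have hself : ∀ x, β x x = v x := fun x => tendsto_nhds_unique (hw x x) (hv x)
  refine ⟨InnerProductSpace.continuousLinearMapOfBilin b, ⟨fun x y => ?_, fun x => ?_⟩, fun x => ?_⟩
  · change ⟪InnerProductSpace.continuousLinearMapOfBilin b x, y⟫_ℝ
      = ⟪x, InnerProductSpace.continuousLinearMapOfBilin b y⟫_ℝ
    rw [real_inner_comm _ x, hb, hb]
    simp only [hβ, add_comm x y]
    ring
  · change 0 ≤ ⟪InnerProductSpace.continuousLinearMapOfBilin b x, x⟫_ℝ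
    rw [hb, hself]
    refine ge_of_tendsto (hv x) ?_
    filter_upwards [hA] with n hn using hn.inner_nonneg_left x
  · rw [hb, hself]

/-- Polarisation makes the scalars `⟪A n x, y⟫` bounded for each pair; uniform boundedness in `y`
and then in `x` does the rest. -/
theorem bounded_of_inner_self_bounded {A : ℕ → E →L[ℝ] E} (hA : ∀ n, (A n).IsPositive)
    (h : ∀ x, ∃ c, ∀ n, ⟪A n x, x⟫_ℝ ≤ c) : ∃ c, ∀ n, ‖A n‖ ≤ c := by
  refine banach_steinhaus fun x => ?_
  have h1 : ∃ c, ∀ n, ‖innerSL ℝ (A n x)‖ ≤ c := by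
    refine banach_steinhaus fun y => ?_
    obtain ⟨cx, hcx⟩ := h (x + y)
    obtain ⟨cy, hcy⟩ := h (x - y)
    refine ⟨|cx| + |cy|, fun n => ?_⟩
    have h1 := hcx n
    have h2 := hcy n
    have h3 := (hA n).inner_nonneg_left (x + y)
    have h4 := (hA n).inner_nonneg_left (x - y)
    have hs : ⟪A n y, x⟫_ℝ = ⟪A n x, y⟫_ℝ := by
      rw [(hA n).inner_left_eq_inner_right, real_inner_comm]
    have h5 : 4 * ⟪A n x, y⟫_ℝ = ⟪A n (x + y), x + y⟫_ℝ - ⟪A n (x - y), x - y⟫_ℝ := by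
      simp only [map_add, map_sub, inner_add_left, inner_add_right, inner_sub_left,
        inner_sub_right, hs]
      ring
    rw [innerSL_apply_apply, Real.norm_eq_abs, abs_le]
    have := le_abs_self cx
    have := le_abs_self cy
    constructor <;> linarith
  obtain ⟨c, hc⟩ := h1
  exact ⟨c, fun n => by simpa using hc n⟩

/-! ### Uniformly coercive self-adjoint operators -/

theorem isUnit_of_coercive {T : E →L[ℝ] E} {δ : ℝ} (hδ : 0 < δ)
    (h : ∀ v, δ * ‖v‖ ^ 2 ≤ ⟪v, T v⟫_ℝ) : IsUnit T := by
  refine ContinuousLinearMap.isUnit_of_forall_le_norm_inner_map T (c := ⟨δ, hδ.le⟩) hδ fun x => ?_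
  calc ‖x‖ ^ 2 * δ ≤ ⟪x, T x⟫_ℝ := by rw [mul_comm]; exact h x
    _ ≤ ‖⟪T x, x⟫_ℝ‖ := by rw [real_inner_comm]; exact Real.le_norm_self _

theorem apply_ringInverse_of_coercive {T : E →L[ℝ] E} {δ : ℝ} (hδ : 0 < δ)
    (h : ∀ v, δ * ‖v‖ ^ 2 ≤ ⟪v, T v⟫_ℝ) (v : E) : T (Ring.inverse T v) = v := by
  have := Ring.mul_inverse_cancel T (isUnit_of_coercive hδ h)
  simpa using congrArg (fun S : E →L[ℝ] E => S v) this

theorem norm_ringInverse_le_of_coercive {T : E →L[ℝ] E} {δ : ℝ} (hδ : 0 < δ)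
    (h : ∀ v, δ * ‖v‖ ^ 2 ≤ ⟪v, T v⟫_ℝ) : ‖Ring.inverse T‖ ≤ δ⁻¹ := by
  refine (Ring.inverse T).opNorm_le_bound (by positivity) fun v => ?_
  have h1 := h (Ring.inverse T v)
  rw [apply_ringInverse_of_coercive hδ h] at h1
  have h2 : δ * ‖Ring.inverse T v‖ ^ 2 ≤ ‖Ring.inverse T v‖ * ‖v‖ :=
    h1.trans (real_inner_le_norm _ _)
  rcases (norm_nonneg (Ring.inverse T v)).eq_or_lt with h0 | h0
  · rw [← h0]; positivity
  · rw [inv_mul_eq_div, le_div_iff₀ hδ]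
    nlinarith

theorem inner_ringInverse_comm_of_coercive {T : E →L[ℝ] E} {δ : ℝ} (hδ : 0 < δ)
    (h : ∀ v, δ * ‖v‖ ^ 2 ≤ ⟪v, T v⟫_ℝ) (hT : IsSelfAdjoint T) (v w : E) :
    ⟪Ring.inverse T v, w⟫_ℝ = ⟪v, Ring.inverse T w⟫_ℝ := by
  have h1 := hT.isSymmetric (Ring.inverse T v) (Ring.inverse T w)
  change ⟪T (Ring.inverse T v), Ring.inverse T w⟫_ℝ
    = ⟪Ring.inverse T v, T (Ring.inverse T w)⟫_ℝ at h1
  rw [apply_ringInverse_of_coercive hδ h, apply_ringInverse_of_coercive hδ h] at h1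
  exact h1.symm

end Preliminaries

/-! ### Evolution operators: measurability, a priori bounds, variation of constants -/

section EvolutionOperators

open Filter Topology

variable {H : Type*} [NormedAddCommGroup H] [InnerProductSpace ℝ H]

/-! ### Evolution operators and their perturbations -/

theorem IsEvolutionOperator.mono {I J : Set ℝ} {U : ℝ → ℝ → H →L[ℝ] H}
    (hU : IsEvolutionOperator I U) (hJ : J ⊆ I) : IsEvolutionOperator J U where
  diag t ht := hU.diag t (hJ ht)
  comp s hs r hr t ht := hU.comp s (hJ hs) r (hJ hr) t (hJ ht)
  continuousOn_left s hs x :=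
    (hU.continuousOn_left s (hJ hs) x).mono (inter_subset_inter_left _ hJ)
  continuousOn_right t ht x :=
    (hU.continuousOn_right t (hJ ht) x).mono (inter_subset_inter_left _ hJ)

theorem IsPerturbedEvolution.mono {I J : Set ℝ} {Y Z : ℝ → ℝ → H →L[ℝ] H} {D : ℝ → H →L[ℝ] H}
    (hZ : IsPerturbedEvolution I Y D Z) (hJ : J ⊆ I) : IsPerturbedEvolution J Y D Z where
  evolution := hZ.evolution.mono hJ
  integrable s hs t ht := hZ.integrable s (hJ hs) t (hJ ht)
  eq s hs t ht := hZ.eq s (hJ hs) t (hJ ht)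

/-- `‖U t s‖ ≤ C` on the triangle `0 ≤ s ≤ t ≤ T`. -/
def IsTriangleBound (U : ℝ → ℝ → H →L[ℝ] H) (T C : ℝ) : Prop :=
  ∀ s t : ℝ, 0 ≤ s → s ≤ t → t ≤ T → ‖U t s‖ ≤ C

section Triangle

variable {U : ℝ → ℝ → H →L[ℝ] H} {T C s t : ℝ}

theorem IsTriangleBound.nonneg (hC : IsTriangleBound U T C) (hs : 0 ≤ s) (hst : s ≤ t)
    (ht : t ≤ T) : 0 ≤ C :=
  (norm_nonneg _).trans (hC s t hs hst ht)

theorem IsTriangleBound.le (hC : IsTriangleBound U T C) (hs : 0 ≤ s) (hst : s ≤ t)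
    (ht : t ≤ T) (x : H) : ‖U t s x‖ ≤ C * ‖x‖ :=
  (U t s).le_of_opNorm_le (hC s t hs hst ht) x

theorem IsEvolutionOperator.continuousOn_Icc_left (hU : IsEvolutionOperator (Icc 0 T) U)
    (hs : 0 ≤ s) (hsT : s ≤ T) (x : H) : ContinuousOn (fun t => U t s x) (Icc s T) :=
  (hU.continuousOn_left s ⟨hs, hsT⟩ x).mono fun _ hr => ⟨⟨hs.trans hr.1, hr.2⟩, hr.1⟩

theorem IsEvolutionOperator.continuousOn_Icc_right (hU : IsEvolutionOperator (Icc 0 T) U)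
    (hs : 0 ≤ s) (hst : s ≤ t) (ht : t ≤ T) (x : H) :
    ContinuousOn (fun r => U t r x) (Icc s t) :=
  (hU.continuousOn_right t ⟨hs.trans hst, ht⟩ x).mono fun _ hr =>
    ⟨⟨hs.trans hr.1, hr.2.trans ht⟩, hr.2⟩

theorem IsEvolutionOperator.aestronglyMeasurable_apply (hU : IsEvolutionOperator (Icc 0 T) U)
    (hs : 0 ≤ s) (hst : s ≤ t) (ht : t ≤ T) {f : ℝ → H}
    (hf : AEStronglyMeasurable f (volume.restrict (Ioc s t))) :
    AEStronglyMeasurable (fun r => U t r (f r)) (volume.restrict (Ioc s t)) :=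
  aestronglyMeasurable_clm_apply (fun x =>
    ((hU.continuousOn_Icc_right hs hst ht x).mono Ioc_subset_Icc_self).aestronglyMeasurable
      measurableSet_Ioc) hf

theorem IsEvolutionOperator.intervalIntegrable_apply (hU : IsEvolutionOperator (Icc 0 T) U)
    (hC : IsTriangleBound U T C) (hs : 0 ≤ s) (hst : s ≤ t) (ht : t ≤ T) {f : ℝ → H}
    (hf : IntervalIntegrable f volume s t) :
    IntervalIntegrable (fun r => U t r (f r)) volume s t := by
  rw [intervalIntegrable_iff_integrableOn_Ioc_of_le hst] at hf ⊢
  refine (hf.norm.const_mul C).mono' (hU.aestronglyMeasurable_apply hs hst ht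
    hf.aestronglyMeasurable) ?_
  filter_upwards [ae_restrict_mem measurableSet_Ioc] with r hr
  exact hC.le (hs.trans hr.1.le) hr.2 ht _

/-- Joint measurability, as Fubini requires, has to come from separate continuity alone. Extended
suitably off the triangle, `U σ r x` is continuous in each variable separately, and such functions
are jointly measurable. -/
theorem IsEvolutionOperator.aestronglyMeasurable_triangle (hU : IsEvolutionOperator (Icc 0 T) U)
    (hs : 0 ≤ s) (hst : s ≤ t) (ht : t ≤ T) (x : H) :
    AEStronglyMeasurable (fun p : ℝ × ℝ => U p.2 p.1 x)
      ((volume.prod volume).restrict {p : ℝ × ℝ | s < p.1 ∧ p.1 < p.2 ∧ p.2 ≤ t}) := by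
  have hT0 : (0 : ℝ) ≤ T := hs.trans (hst.trans ht)
  set c : ℝ → ℝ := fun r => max 0 (min r T) with hc
  have hcc : Continuous c := by fun_prop
  have hcm : ∀ r, c r ∈ Icc 0 T := fun r => ⟨le_max_left _ _, max_le hT0 (min_le_right _ _)⟩
  have hcid : ∀ r ∈ Icc 0 T, c r = r := fun r hr => by
    simp only [hc]; rw [min_eq_left hr.2, max_eq_right hr.1]
  -- `c` clamps times to `[0, T]`. Below the diagonal `V` equals `x`, by `U r r = id`, and so stays
  -- continuous across it in both variables.
  set V : ℝ → ℝ → H := fun r σ => U (max (c σ) (c r)) (c r) x with hV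
  have hV1 : ∀ r, Continuous (V r) := fun r => by
    refine (hU.continuousOn_left (c r) (hcm r) x).comp_continuous
      (f := fun σ => max (c σ) (c r)) (by fun_prop) fun σ => ⟨⟨?_, ?_⟩, mem_Ici.2 (le_max_right _ _)⟩
    · exact (hcm r).1.trans (le_max_right _ _)
    · exact max_le (hcm σ).2 (hcm r).2
  have hV2 : ∀ σ, Continuous fun r => V r σ := fun σ => by
    have e : (fun r => V r σ) = fun r => U (c σ) (min (c r) (c σ)) x := by
      funext r
      rcases le_total (c r) (c σ) with h | h
      · simp only [hV]; rw [max_eq_left h, min_eq_left h]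
      · simp only [hV]
        rw [max_eq_right h, min_eq_right h, hU.diag _ (hcm r), hU.diag _ (hcm σ)]
    rw [e]
    refine (hU.continuousOn_right (c σ) (hcm σ) x).comp_continuous
      (f := fun r => min (c r) (c σ)) (by fun_prop) fun r => ⟨⟨?_, ?_⟩, mem_Iic.2 (min_le_right _ _)⟩
    · exact le_min (hcm r).1 (hcm σ).1
    · exact (min_le_right _ _).trans (hcm σ).2
  have hVm : StronglyMeasurable (Function.uncurry V) :=
    stronglyMeasurable_uncurry_of_continuous_of_stronglyMeasurable hV2
      fun r => (hV1 r).stronglyMeasurable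
  refine hVm.aestronglyMeasurable.congr ?_
  have hTm : MeasurableSet {p : ℝ × ℝ | s < p.1 ∧ p.1 < p.2 ∧ p.2 ≤ t} :=
    (measurableSet_lt measurable_const measurable_fst).inter
      ((measurableSet_lt measurable_fst measurable_snd).inter
        (measurableSet_le measurable_snd measurable_const))
  filter_upwards [ae_restrict_mem hTm] with p hp
  have h1 : c p.1 = p.1 := hcid _ ⟨hs.trans hp.1.le, hp.2.1.le.trans (hp.2.2.trans ht)⟩
  have h2 : c p.2 = p.2 := hcid _ ⟨hs.trans (hp.1.trans hp.2.1).le, hp.2.2.trans ht⟩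
  simp only [Function.uncurry, hV, h1, h2, max_eq_left hp.2.1.le]

theorem aestronglyMeasurable_fst_triangle {G : Type*} [TopologicalSpace G] {f : ℝ → G} {s t : ℝ}
    (hf : AEStronglyMeasurable f (volume.restrict (Ioc s t))) :
    AEStronglyMeasurable (fun p : ℝ × ℝ => f p.1)
      ((volume.prod volume).restrict {p : ℝ × ℝ | s < p.1 ∧ p.1 < p.2 ∧ p.2 ≤ t}) := by
  have h1 : AEStronglyMeasurable (fun p : ℝ × ℝ => f p.1)
      ((volume.restrict (Ioc s t)).prod (volume : Measure ℝ)) := hf.comp_fst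
  have e : (volume.restrict (Ioc s t)).prod (volume : Measure ℝ)
      = (volume.prod volume).restrict (Ioc s t ×ˢ univ) := by
    rw [← Measure.prod_restrict, Measure.restrict_univ]
  rw [e] at h1
  have hsub : {p : ℝ × ℝ | s < p.1 ∧ p.1 < p.2 ∧ p.2 ≤ t} ⊆ Ioc s t ×ˢ univ := by
    rintro p ⟨h1, h2, h3⟩
    exact ⟨⟨h1, h2.le.trans h3⟩, mem_univ _⟩
  exact h1.mono_measure (Measure.restrict_mono hsub le_rfl)

theorem aestronglyMeasurable_snd_triangle {G : Type*} [TopologicalSpace G] {f : ℝ → G} {s t : ℝ}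
    (hf : AEStronglyMeasurable f (volume.restrict (Ioc s t))) :
    AEStronglyMeasurable (fun p : ℝ × ℝ => f p.2)
      ((volume.prod volume).restrict {p : ℝ × ℝ | s < p.1 ∧ p.1 < p.2 ∧ p.2 ≤ t}) := by
  have h1 : AEStronglyMeasurable (fun p : ℝ × ℝ => f p.2)
      ((volume : Measure ℝ).prod (volume.restrict (Ioc s t))) := hf.comp_snd
  have e : (volume : Measure ℝ).prod (volume.restrict (Ioc s t))
      = (volume.prod volume).restrict (univ ×ˢ Ioc s t) := by
    rw [← Measure.prod_restrict, Measure.restrict_univ]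
  rw [e] at h1
  have hsub : {p : ℝ × ℝ | s < p.1 ∧ p.1 < p.2 ∧ p.2 ≤ t} ⊆ univ ×ˢ Ioc s t := by
    rintro p ⟨h1, h2, h3⟩
    exact ⟨mem_univ _, ⟨h1.trans h2, h3⟩⟩
  exact h1.mono_measure (Measure.restrict_mono hsub le_rfl)

/-- Dominated convergence, after fixing the domain of integration and moving the upper limit into an
indicator. -/
theorem IsEvolutionOperator.continuousOn_integral (hU : IsEvolutionOperator (Icc 0 T) U)
    (hC : IsTriangleBound U T C) (hs : 0 ≤ s) (hsT : s ≤ T) {f : ℝ → H}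
    (hf : IntervalIntegrable f volume s T) :
    ContinuousOn (fun t => ∫ r in s..t, U t r (f r)) (Icc s T) := by
  rw [intervalIntegrable_iff_integrableOn_Ioc_of_le hsT] at hf
  have heq : ∀ t ∈ Icc s T, ∫ r in s..t, U t r (f r)
      = ∫ r in Ioc s T, (Ioc s t).indicator (fun r => U t r (f r)) r := by
    intro t ht
    rw [intervalIntegral.integral_of_le ht.1, setIntegral_indicator measurableSet_Ioc,
      inter_eq_self_of_subset_right (Ioc_subset_Ioc_right ht.2)]
  refine ContinuousOn.congr ?_ heq
  intro t₀ ht₀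
  refine continuousWithinAt_of_dominated (bound := fun r => C * ‖f r‖) ?_ ?_
    (hf.norm.const_mul C) ?_
  · filter_upwards [self_mem_nhdsWithin] with t ht
    refine (aestronglyMeasurable_indicator_iff measurableSet_Ioc).2 ?_
    rw [Measure.restrict_restrict measurableSet_Ioc,
      inter_eq_self_of_subset_left (Ioc_subset_Ioc_right ht.2)]
    exact hU.aestronglyMeasurable_apply hs ht.1 ht.2 (hf.aestronglyMeasurable.mono_measure
      (Measure.restrict_mono (Ioc_subset_Ioc_right ht.2) le_rfl))
  · filter_upwards [self_mem_nhdsWithin] with t ht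
    refine Eventually.of_forall fun r => ?_
    by_cases hr : r ∈ Ioc s t
    · rw [indicator_of_mem hr]
      exact hC.le (hs.trans hr.1.le) hr.2 ht.2 _
    · rw [indicator_of_notMem hr, norm_zero]
      exact mul_nonneg (hC.nonneg hs hsT le_rfl) (norm_nonneg _)
  -- The indicator can jump at `t = t₀` only for `r = t₀`, a null set.
  · have hne : ∀ᵐ r ∂(volume.restrict (Ioc s T)), r ≠ t₀ :=
      ae_restrict_of_ae (by simp [ae_iff])
    filter_upwards [hne, ae_restrict_mem measurableSet_Ioc] with r hr hrm
    rcases lt_or_gt_of_ne hr with h | h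
    · have hmem : Icc 0 T ∩ Ici r ∈ 𝓝[Icc s T] t₀ := by
        filter_upwards [self_mem_nhdsWithin, mem_nhdsWithin_of_mem_nhds (Ioi_mem_nhds h)]
          with t ht ht'
        exact ⟨⟨hs.trans ht.1, ht.2⟩, mem_Ici.2 (le_of_lt ht')⟩
      have hcont : ContinuousWithinAt (fun t => U t r (f r)) (Icc s T) t₀ :=
        ((hU.continuousOn_left r ⟨hs.trans hrm.1.le, hrm.2⟩ (f r)) t₀
          ⟨⟨hs.trans ht₀.1, ht₀.2⟩, h.le⟩).mono_of_mem_nhdsWithin hmem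
      refine hcont.congr_of_eventuallyEq ?_ ?_
      · filter_upwards [mem_nhdsWithin_of_mem_nhds (Ioi_mem_nhds h)] with t ht
        rw [indicator_of_mem (show r ∈ Ioc s t from ⟨hrm.1, le_of_lt ht⟩)]
      · rw [indicator_of_mem (show r ∈ Ioc s t₀ from ⟨hrm.1, h.le⟩)]
    · refine (continuousWithinAt_const (b := (0 : H))).congr_of_eventuallyEq ?_ ?_
      · filter_upwards [mem_nhdsWithin_of_mem_nhds (Iio_mem_nhds h)] with t ht
        rw [indicator_of_notMem fun h' : r ∈ Ioc s t => absurd h'.2 (not_le.2 ht)]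
      · rw [indicator_of_notMem fun h' : r ∈ Ioc s t₀ => absurd h'.2 (not_le.2 h)]

theorem IsEvolutionOperator.apply_integral [CompleteSpace H]
    (hU : IsEvolutionOperator (Icc 0 T) U)
    (hC : IsTriangleBound U T C) {τ : ℝ} (hs : 0 ≤ s) (hsτ : s ≤ τ) (hτt : τ ≤ t) (ht : t ≤ T)
    {f : ℝ → H} (hf : IntervalIntegrable f volume s τ) :
    U t τ (∫ r in s..τ, U τ r (f r)) = ∫ r in s..τ, U t r (f r) := by
  rw [← ContinuousLinearMap.intervalIntegral_comp_comm _
    (hU.intervalIntegrable_apply hC hs hsτ (hτt.trans ht) hf)]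
  refine intervalIntegral.integral_congr fun r hr => ?_
  rw [uIcc_of_le hsτ] at hr
  rw [← hU.comp r ⟨hs.trans hr.1, (hr.2.trans hτt).trans ht⟩ τ
    ⟨hs.trans hsτ, hτt.trans ht⟩ t ⟨hs.trans (hsτ.trans hτt), ht⟩ hr.2 hτt]
  rfl

end Triangle

section Perturbation

variable {Y Z : ℝ → ℝ → H →L[ℝ] H} {D : ℝ → H →L[ℝ] H} {T C C' d s t : ℝ}

theorem norm_integral_apply_le {U : ℝ → ℝ → H →L[ℝ] H} (hC : IsTriangleBound U T C) (hs : 0 ≤ s)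
    (hst : s ≤ t) (ht : t ≤ T) (hd : ∀ r ∈ Icc 0 T, ‖D r‖ ≤ d) {y : ℝ → H} {g : ℝ → ℝ}
    (hg : Continuous g) (hyg : ∀ r ∈ Icc s T, ‖y r‖ ≤ g r) :
    ‖∫ r in s..t, U t r (D r (y r))‖ ≤ C * d * ∫ r in s..t, g r := by
  rw [← intervalIntegral.integral_const_mul]
  refine intervalIntegral.norm_integral_le_of_norm_le hst (ae_of_all _ fun r hr => ?_)
    ((hg.const_smul (C * d)).intervalIntegrable _ _)
  have hC0 := hC.nonneg hs hst ht
  calc ‖U t r (D r (y r))‖ ≤ C * ‖D r (y r)‖ := hC.le (hs.trans hr.1.le) hr.2 ht _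
    _ ≤ C * (d * g r) := by
        gcongr
        exact (D r).le_of_opNorm_le_of_le (hd r ⟨hs.trans hr.1.le, hr.2.trans ht⟩)
          (hyg r ⟨hr.1.le, hr.2.trans ht⟩)
    _ = C * d * g r := by ring

/-- Grönwall with zero initial term. All uniqueness statements about perturbed evolutions reduce to
it. -/
theorem eq_zero_of_volterra (hC : IsTriangleBound Y T C) (hs : 0 ≤ s) (hsT : s ≤ T)
    (hd0 : 0 ≤ d) (hd : ∀ r ∈ Icc 0 T, ‖D r‖ ≤ d) {y : ℝ → H} (hy : ContinuousOn y (Icc s T))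
    (h : ∀ t ∈ Icc s T, y t = ∫ r in s..t, Y t r (D r (y r))) : ∀ t ∈ Icc s T, y t = 0 := by
  obtain ⟨c, hc⟩ := isCompact_Icc.exists_bound_of_continuousOn hy
  have := le_exp_of_forall_majorant_forward (f := fun t => ‖y t‖) (a := s) (b := T) (A := 0)
    (C := C * d) (c := max c 0) le_rfl (mul_nonneg (hC.nonneg hs hsT le_rfl) hd0)
    (le_max_right _ _) (fun r hr => (hc r hr).trans (le_max_left _ _))
    (fun g hg hfg t ht => by
      simp only [zero_add]
      rw [h t ht]
      exact norm_integral_apply_le hC hs ht.1 ht.2 hd hg hfg)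
  intro t ht
  have h1 := this t ht
  simp only [mul_zero, zero_mul] at h1
  exact norm_le_zero_iff.1 h1

theorem IsPerturbedEvolution.exists_bound (hZ : IsPerturbedEvolution (Icc 0 T) Y D Z)
    (hC : IsTriangleBound Y T C) (hd0 : 0 ≤ d) (hd : ∀ r ∈ Icc 0 T, ‖D r‖ ≤ d) :
    ∃ C', IsTriangleBound Z T C' := by
  refine ⟨2 * C * Real.exp ((2 * (C * d) + 1) * T), fun s t hs hst ht => ?_⟩
  have hC0 := hC.nonneg hs hst ht
  refine (Z t s).opNorm_le_bound (by positivity) fun x => ?_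
  obtain ⟨c, hc⟩ := isCompact_Icc.exists_bound_of_continuousOn
    (hZ.evolution.continuousOn_Icc_left hs (hst.trans ht) x)
  have := le_exp_of_forall_majorant_forward (f := fun t => ‖Z t s x‖) (a := s) (b := T)
    (A := C * ‖x‖) (C := C * d) (c := max c 0) (by positivity) (by positivity)
    (le_max_right _ _) (fun r hr => (hc r hr).trans (le_max_left _ _))
    (fun g hg hfg t ht => by
      have e := hZ.eq s ⟨hs, hst.trans ‹_›⟩ t ⟨hs.trans ht.1, ht.2⟩ ht.1 x
      simp only [e]
      exact (norm_add_le _ _).trans (add_le_add (hC.le hs ht.1 ht.2 x)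
        (norm_integral_apply_le hC hs ht.1 ht.2 hd hg hfg))) t ⟨hst, ht⟩
  refine this.trans ?_
  have : (2 * (C * d) + 1) * (t - s) ≤ (2 * (C * d) + 1) * T := by
    have : 0 ≤ C * d := by positivity
    gcongr
    linarith
  calc 2 * (C * ‖x‖) * Real.exp ((2 * (C * d) + 1) * (t - s))
      ≤ 2 * (C * ‖x‖) * Real.exp ((2 * (C * d) + 1) * T) := by gcongr
    _ = 2 * C * Real.exp ((2 * (C * d) + 1) * T) * ‖x‖ := by ring

/-- If a bounded perturbation of an evolution operator is uniformly bounded, then the evolution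
operator itself is exponentially bounded, jointly in both time variables. -/
theorem IsPerturbedEvolution.triangleBound_of_bounded [CompleteSpace H]
    (hY : IsEvolutionOperator (Ici 0) Y)
    (hZ : IsPerturbedEvolution (Ici 0) Y D Z) {M : ℝ} (hM0 : 0 ≤ M)
    (hM : ∀ s t, 0 ≤ s → s ≤ t → ‖Z t s‖ ≤ M) (hd0 : 0 ≤ d) (hd : ∀ r, 0 ≤ r → ‖D r‖ ≤ d)
    (T : ℝ) : IsTriangleBound Y T (2 * M * Real.exp ((2 * (d * M) + 1) * T)) := by
  intro s t hs hst ht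
  have ht0 := hs.trans hst
  -- For fixed `t` this is only a qualitative bound, needed to start the Grönwall iteration; the
  -- final constant does not depend on it.
  have hbd : ∃ c, ∀ r : Icc (0 : ℝ) t, ‖Y t r‖ ≤ c := by
    refine banach_steinhaus fun x => ?_
    obtain ⟨c, hc⟩ := isCompact_Icc.exists_bound_of_continuousOn
      ((hY.continuousOn_right t ht0 x).mono
        (fun r hr => ⟨hr.1, hr.2⟩ : Icc 0 t ⊆ Ici 0 ∩ Iic t))
    exact ⟨c, fun r => hc r r.2⟩
  obtain ⟨c, hc⟩ := hbd
  have := le_exp_of_forall_majorant (f := fun s => ‖Y t s‖) (a := 0) (b := t)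
    (A := M) (C := d * M) (c := max c 0) hM0 (by positivity)
    (le_max_right _ _) (fun r hr => (hc ⟨r, hr⟩).trans (le_max_left _ _))
    (fun g hg hfg s hs => by
      have hI0 : 0 ≤ ∫ r in s..t, g r := intervalIntegral.integral_nonneg hs.2 fun r hr =>
        (norm_nonneg _).trans (hfg r ⟨hs.1.trans hr.1, hr.2⟩)
      refine (Y t s).opNorm_le_bound (by positivity) fun x => ?_
      have e := hZ.eq s hs.1 t (hs.1.trans hs.2) hs.2 x
      -- The perturbation equation read backwards: a Volterra equation for `Y t ·` in the initial
      -- time, with kernel bounded through `Z`.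
      have e' : Y t s x = Z t s x - ∫ r in s..t, Y t r (D r (Z r s x)) := by rw [e]; abel
      rw [e']
      refine (norm_sub_le _ _).trans ?_
      rw [add_mul]
      refine add_le_add ((Z t s).le_of_opNorm_le (hM s t hs.1 hs.2) x) ?_
      have : d * M * (∫ r in s..t, g r) * ‖x‖ = ∫ r in s..t, (d * M * ‖x‖) * g r := by
        rw [intervalIntegral.integral_const_mul]; ring
      rw [this]
      refine intervalIntegral.norm_integral_le_of_norm_le hs.2 (ae_of_all _ fun r hr => ?_)
        ((hg.const_smul (d * M * ‖x‖)).intervalIntegrable _ _)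
      have hr0 : 0 ≤ r := hs.1.trans hr.1.le
      have hg0 : 0 ≤ g r := (norm_nonneg _).trans (hfg r ⟨hr0, hr.2⟩)
      calc ‖Y t r (D r (Z r s x))‖ ≤ g r * ‖D r (Z r s x)‖ :=
            (Y t r).le_of_opNorm_le (hfg r ⟨hr0, hr.2⟩) _
        _ ≤ g r * (d * (M * ‖x‖)) := by
            gcongr
            exact (D r).le_of_opNorm_le_of_le (hd r hr0)
              ((Z r s).le_of_opNorm_le (hM s r hs.1 hr.1.le) x)
        _ = d * M * ‖x‖ * g r := by ring) s ⟨hs, hst⟩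
  refine this.trans ?_
  have : 0 ≤ d * M := by positivity
  gcongr
  linarith

/-- Convolution with a perturbed evolution operator. -/
theorem IsPerturbedEvolution.integral_apply [CompleteSpace H]
    (hY : IsEvolutionOperator (Icc 0 T) Y)
    (hC : IsTriangleBound Y T C) (hZ : IsPerturbedEvolution (Icc 0 T) Y D Z)
    (hC' : IsTriangleBound Z T C') (hd : ∀ r ∈ Icc 0 T, ‖D r‖ ≤ d)
    (hDm : ∀ x, AEStronglyMeasurable (fun r => D r x) (volume.restrict (Icc 0 T)))
    (hs : 0 ≤ s) (hst : s ≤ t) (ht : t ≤ T) {g : ℝ → H} (hg : IntervalIntegrable g volume s t) :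
    ∫ r in s..t, Z t r (g r) = (∫ r in s..t, Y t r (g r))
      + ∫ σ in s..t, Y t σ (D σ (∫ r in s..σ, Z σ r (g r))) := by
  have hC0 := hC.nonneg hs hst ht
  have hC'0 := hC'.nonneg hs hst ht
  have iZ := hZ.evolution.intervalIntegrable_apply hC' hs hst ht hg
  have iY := hY.intervalIntegrable_apply hC hs hst ht hg
  -- The defining equation of `Z` started at time `r` on the vector `g r`; integrating over `r` and
  -- exchanging the order of integration gives the claim.
  have e1 : ∀ r ∈ Icc s t, ∫ σ in r..t, Y t σ (D σ (Z σ r (g r)))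
      = Z t r (g r) - Y t r (g r) := by
    intro r hr
    rw [hZ.eq r ⟨hs.trans hr.1, hr.2.trans ht⟩ t ⟨hs.trans hst, ht⟩ hr.2]
    abel
  have e2 : ∫ r in s..t, ∫ σ in r..t, Y t σ (D σ (Z σ r (g r)))
      = (∫ r in s..t, Z t r (g r)) - ∫ r in s..t, Y t r (g r) := by
    rw [← intervalIntegral.integral_sub iZ iY]
    refine intervalIntegral.integral_congr fun r hr => ?_
    rw [uIcc_of_le hst] at hr
    exact e1 r hr
  have hgm : AEStronglyMeasurable g (volume.restrict (Ioc s t)) := hg.1.aestronglyMeasurable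
  have hsub : Ioc s t ⊆ Icc 0 T := fun r hr => ⟨hs.trans hr.1.le, hr.2.trans ht⟩
  have hmeas : AEStronglyMeasurable (Function.uncurry fun r σ => Y t σ (D σ (Z σ r (g r))))
      ((volume.prod volume).restrict {p : ℝ × ℝ | s < p.1 ∧ p.1 < p.2 ∧ p.2 ≤ t}) := by
    have m1 : AEStronglyMeasurable (fun p : ℝ × ℝ => Z p.2 p.1 (g p.1))
        ((volume.prod volume).restrict {p : ℝ × ℝ | s < p.1 ∧ p.1 < p.2 ∧ p.2 ≤ t}) :=
      aestronglyMeasurable_clm_apply (T := fun p : ℝ × ℝ => Z p.2 p.1)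
        (fun x => hZ.evolution.aestronglyMeasurable_triangle hs hst ht x)
        (aestronglyMeasurable_fst_triangle hgm)
    have m2 : AEStronglyMeasurable (fun p : ℝ × ℝ => D p.2 (Z p.2 p.1 (g p.1)))
        ((volume.prod volume).restrict {p : ℝ × ℝ | s < p.1 ∧ p.1 < p.2 ∧ p.2 ≤ t}) :=
      aestronglyMeasurable_clm_apply (T := fun p : ℝ × ℝ => D p.2)
        (fun x => aestronglyMeasurable_snd_triangle
          ((hDm x).mono_measure (Measure.restrict_mono hsub le_rfl))) m1
    exact aestronglyMeasurable_clm_apply (T := fun p : ℝ × ℝ => Y t p.2)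
        (fun x => aestronglyMeasurable_snd_triangle
          (hY.aestronglyMeasurable_apply hs hst ht aestronglyMeasurable_const)) m2
  have e3 := intervalIntegral_triangle_swap (f := fun r σ => Y t σ (D σ (Z σ r (g r)))) hst
    (k := fun r => C * (d * (C' * ‖g r‖)))
    (((hg.norm.const_mul C').const_mul d).const_mul C) hmeas
    (fun r σ hsr hrσ hσt => by
      have h1 : ‖Z σ r (g r)‖ ≤ C' * ‖g r‖ :=
        hC'.le (hs.trans hsr.le) hrσ.le (hσt.trans ht) _
      have h2 : ‖D σ (Z σ r (g r))‖ ≤ d * (C' * ‖g r‖) :=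
        (D σ).le_of_opNorm_le_of_le (hd σ ⟨hs.trans (hsr.trans hrσ).le, hσt.trans ht⟩) h1
      calc ‖Y t σ (D σ (Z σ r (g r)))‖ ≤ C * ‖D σ (Z σ r (g r))‖ :=
            hC.le (hs.trans (hsr.trans hrσ).le) hσt ht _
        _ ≤ C * (d * (C' * ‖g r‖)) := by gcongr)
  rw [e2] at e3
  have e4 : ∫ σ in s..t, ∫ r in s..σ, Y t σ (D σ (Z σ r (g r)))
      = ∫ σ in s..t, Y t σ (D σ (∫ r in s..σ, Z σ r (g r))) := by
    refine intervalIntegral.integral_congr fun σ hσ => ?_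
    rw [uIcc_of_le hst] at hσ
    have hg' : IntervalIntegrable g volume s σ := hg.mono_set (by
      rw [uIcc_of_le hst, uIcc_of_le hσ.1]; exact Icc_subset_Icc_right hσ.2)
    exact ((Y t σ).comp (D σ)).intervalIntegral_comp_comm
      (hZ.evolution.intervalIntegrable_apply hC' hs hσ.1 (hσ.2.trans ht) hg')
  rw [e4] at e3
  rw [← e3]
  abel

theorem intervalIntegrable_clm_apply {D : ℝ → H →L[ℝ] H} (hd : ∀ r ∈ Icc 0 T, ‖D r‖ ≤ d)
    (hDm : ∀ x, AEStronglyMeasurable (fun r => D r x) (volume.restrict (Icc 0 T)))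
    (hs : 0 ≤ s) (hst : s ≤ t) (ht : t ≤ T) {z : ℝ → H} (hz : ContinuousOn z (Icc s t)) :
    IntervalIntegrable (fun r => D r (z r)) volume s t := by
  rw [intervalIntegrable_iff_integrableOn_Ioc_of_le hst]
  have hzi : IntegrableOn z (Ioc s t) :=
    (hz.integrableOn_compact isCompact_Icc).mono_set Ioc_subset_Icc_self
  have hsub : Ioc s t ⊆ Icc 0 T := fun r hr => ⟨hs.trans hr.1.le, hr.2.trans ht⟩
  refine (hzi.norm.const_mul d).mono' (aestronglyMeasurable_clm_apply
    (fun x => (hDm x).mono_measure (Measure.restrict_mono hsub le_rfl))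
    hzi.aestronglyMeasurable) ?_
  filter_upwards [ae_restrict_mem measurableSet_Ioc] with r hr
  exact (D r).le_of_opNorm_le (hd r (hsub hr)) _

/-- Variation of constants with respect to a perturbed evolution operator. -/
theorem IsPerturbedEvolution.variation_of_constants [CompleteSpace H]
    (hY : IsEvolutionOperator (Icc 0 T) Y)
    (hC : IsTriangleBound Y T C) (hZ : IsPerturbedEvolution (Icc 0 T) Y D Z)
    (hC' : IsTriangleBound Z T C') (hd0 : 0 ≤ d) (hd : ∀ r ∈ Icc 0 T, ‖D r‖ ≤ d)
    (hDm : ∀ x, AEStronglyMeasurable (fun r => D r x) (volume.restrict (Icc 0 T)))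
    (hs : 0 ≤ s) (hsT : s ≤ T) {f : ℝ → H} (hf : IntervalIntegrable f volume s T) {x : H}
    {z : ℝ → H} (hz : ∀ t ∈ Icc s T, z t = Y t s x + ∫ r in s..t, Y t r (f r)) :
    ∀ t ∈ Icc s T, z t = Z t s x + ∫ r in s..t, Z t r (f r - D r (z r)) := by
  have hzc : ContinuousOn z (Icc s T) :=
    ((hY.continuousOn_Icc_left hs hsT x).add (hY.continuousOn_integral hC hs hsT hf)).congr hz
  have hDz := intervalIntegrable_clm_apply hd hDm hs hsT le_rfl hzc
  have hg : IntervalIntegrable (fun r => f r - D r (z r)) volume s T := hf.sub hDz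
  set ζ : ℝ → H := fun t => ∫ r in s..t, Z t r (f r - D r (z r)) with hζ
  have hζc : ContinuousOn ζ (Icc s T) := hZ.evolution.continuousOn_integral hC' hs hsT hg
  have hZc := hZ.evolution.continuousOn_Icc_left hs hsT x
  have hyc : ContinuousOn (fun t => Z t s x + ζ t - z t) (Icc s T) := (hZc.add hζc).sub hzc
  -- The candidate minus `z` satisfies the homogeneous Volterra equation, all driving terms
  -- cancelling.
  have key := eq_zero_of_volterra hC hs hsT hd0 hd hyc (fun t ht => by
    have hmono : ∀ {φ : ℝ → H}, IntervalIntegrable φ volume s T → IntervalIntegrable φ volume s t :=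
      fun h => h.mono_set (by
        rw [uIcc_of_le hsT, uIcc_of_le ht.1]; exact Icc_subset_Icc_right ht.2)
    have hI : ∀ {w : ℝ → H}, ContinuousOn w (Icc s T) →
        IntervalIntegrable (fun r => Y t r (D r (w r))) volume s t := fun hw =>
      hY.intervalIntegrable_apply hC hs ht.1 ht.2
        (intervalIntegrable_clm_apply hd hDm hs ht.1 ht.2
          (hw.mono (Icc_subset_Icc_right ht.2)))
    have e1 := hZ.integral_apply hY hC hC' hd hDm hs ht.1 ht.2 (hmono hg)
    have e2 := hZ.eq s ⟨hs, hsT⟩ t ⟨hs.trans ht.1, ht.2⟩ ht.1 x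
    have e3 : ∫ r in s..t, Y t r (f r - D r (z r))
        = (∫ r in s..t, Y t r (f r)) - ∫ r in s..t, Y t r (D r (z r)) := by
      rw [← intervalIntegral.integral_sub (hY.intervalIntegrable_apply hC hs ht.1 ht.2 (hmono hf))
        (hI hzc)]
      simp only [map_sub]
    have e4 : ∫ r in s..t, Y t r (D r (Z r s x + ζ r - z r))
        = (∫ r in s..t, Y t r (D r (Z r s x))) + (∫ r in s..t, Y t r (D r (ζ r)))
          - ∫ r in s..t, Y t r (D r (z r)) := by
      rw [← intervalIntegral.integral_add (hI hZc) (hI hζc),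
        ← intervalIntegral.integral_sub ((hI hZc).add (hI hζc)) (hI hzc)]
      simp only [map_sub, map_add]
    rw [e4, e2, show ζ t = _ from e1, e3, hz t ht]
    abel)
  intro t ht
  have := key t ht
  exact (sub_eq_zero.1 this).symm

end Perturbation

end EvolutionOperators

/-! ### Continuity of square roots, and the cost functional on finite horizons -/

section Regulator

open Filter Topology

/-! ### Square roots of positive operators -/

/-- If `x` is a unit vector with `Δx = μx`, where `Δ = S - Q`, then `⟪(S² - Q²)x, x⟫ = ⟪Δx, (S+Q)x⟫
= μ⟪x, (S+Q)x⟫`, and positivity of `S` and `Q` gives `|μ| ≤ ⟪x, (S+Q)x⟫`; hence `μ² ≤ ‖S² - Q²‖`. In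
general `‖Δ‖` need not be attained, so the argument is run on approximate eigenvectors with the
defect `‖Δx - μx‖² = ‖Δx‖² - μ²` as error. -/
theorem sq_norm_sub_le_norm_comp_self_sub {E : Type*} [NormedAddCommGroup E]
    [InnerProductSpace ℝ E] {S Q : E →L[ℝ] E} (hS : S.IsPositive) (hQ : Q.IsPositive) :
    ‖S - Q‖ ^ 2 ≤ ‖S.comp S - Q.comp Q‖ := by
  set Δ : E →L[ℝ] E := S - Q with hΔ
  set A : E →L[ℝ] E := S.comp S - Q.comp Q with hA
  set c : ℝ := ‖S‖ + ‖Q‖ with hc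
  have hsym : (Δ : E →ₗ[ℝ] E).IsSymmetric := hS.isSymmetric.sub hQ.isSymmetric
  have unit : ∀ x : E, ‖x‖ = 1 → |⟪Δ x, x⟫_ℝ| ^ 2
      ≤ ‖A‖ + c * √(‖Δ‖ ^ 2 - |⟪Δ x, x⟫_ℝ| ^ 2) := by
    intro x hx
    set μ : ℝ := ⟪Δ x, x⟫_ℝ with hμ
    set p : E := S x + Q x with hp
    have hSs : ⟪S (S x), x⟫_ℝ = ⟪S x, S x⟫_ℝ := hS.isSymmetric (S x) x
    have hQs : ⟪Q (Q x), x⟫_ℝ = ⟪Q x, Q x⟫_ℝ := hQ.isSymmetric (Q x) x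
    have e1 : ⟪A x, x⟫_ℝ = ⟪Δ x, p⟫_ℝ := by
      simp only [hA, hΔ, hp, sub_apply, ContinuousLinearMap.comp_apply,
        inner_sub_left, inner_add_right, hSs, hQs]
      rw [real_inner_comm (Q x) (S x)]
      ring
    have e2 : |μ| ≤ ⟪x, p⟫_ℝ := by
      have h1 := hS.inner_nonneg_right x
      have h2 := hQ.inner_nonneg_right x
      rw [hμ, hΔ, sub_apply, inner_sub_left, real_inner_comm,
        real_inner_comm x (Q x), hp, inner_add_right, abs_le]
      constructor <;> linarith
    have e3 : ‖Δ x - μ • x‖ ^ 2 = ‖Δ x‖ ^ 2 - μ ^ 2 := by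
      rw [norm_sub_sq_real, inner_smul_right, norm_smul, hx, ← hμ, mul_one, Real.norm_eq_abs,
        sq_abs]
      ring
    have e4 : ‖Δ x‖ ≤ ‖Δ‖ := by simpa [hx] using Δ.le_opNorm x
    have e5 : ‖Δ x - μ • x‖ ≤ √(‖Δ‖ ^ 2 - |μ| ^ 2) := by
      refine Real.le_sqrt_of_sq_le ?_
      rw [e3, sq_abs]
      gcongr
    have e6 : ‖p‖ ≤ c := by
      refine (norm_add_le _ _).trans (add_le_add ?_ ?_)
      · simpa [hx] using S.le_opNorm x
      · simpa [hx] using Q.le_opNorm x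
    have e7 : μ * ⟪x, p⟫_ℝ = ⟪A x, x⟫_ℝ - ⟪Δ x - μ • x, p⟫_ℝ := by
      rw [e1, inner_sub_left, real_inner_smul_left]; ring
    have e8 : |⟪A x, x⟫_ℝ| ≤ ‖A‖ := by
      refine (abs_real_inner_le_norm _ _).trans ?_
      simpa [hx] using A.le_opNorm x
    have e9 : |⟪Δ x - μ • x, p⟫_ℝ| ≤ c * √(‖Δ‖ ^ 2 - |μ| ^ 2) := by
      refine (abs_real_inner_le_norm _ _).trans ?_
      rw [mul_comm]
      have : 0 ≤ c := by positivity
      gcongr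
    calc |μ| ^ 2 ≤ |μ| * ⟪x, p⟫_ℝ := by
          rw [sq]; exact mul_le_mul_of_nonneg_left e2 (abs_nonneg _)
      _ = |μ * ⟪x, p⟫_ℝ| := by rw [abs_mul, abs_of_nonneg ((abs_nonneg _).trans e2)]
      _ ≤ |⟪A x, x⟫_ℝ| + |⟪Δ x - μ • x, p⟫_ℝ| := by rw [e7]; exact abs_sub _ _
      _ ≤ _ := add_le_add e8 e9
  have all : ∀ x : E, |Δ.rayleighQuotient x| ^ 2
      ≤ ‖A‖ + c * √(‖Δ‖ ^ 2 - |Δ.rayleighQuotient x| ^ 2) := by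
    intro x
    rcases eq_or_ne x 0 with rfl | hx
    · rw [ContinuousLinearMap.rayleighQuotient_apply_zero]
      simp only [abs_zero, ne_eq, OfNat.ofNat_ne_zero, not_false_eq_true, zero_pow]
      positivity
    · have hn : ‖(‖x‖⁻¹ : ℝ) • x‖ = 1 := by
        rw [norm_smul, norm_inv, norm_norm, inv_mul_cancel₀ (norm_ne_zero_iff.2 hx)]
      have := unit _ hn
      have e : ⟪Δ ((‖x‖⁻¹ : ℝ) • x), (‖x‖⁻¹ : ℝ) • x⟫_ℝ = Δ.rayleighQuotient x := by
        simp only [ContinuousLinearMap.rayleighQuotient, ContinuousLinearMap.reApplyInnerSelf_apply,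
          map_smul, real_inner_smul_left, inner_smul_right, RCLike.re_to_real]
        field_simp
      rwa [e] at this
  by_contra! hlt
  -- The error term vanishes at `m = ‖Δ‖`, so a failure of the claim persists for `m` near `‖Δ‖`;
  -- Rayleigh quotients come that close because their supremum is `‖Δ‖`.
  have hcont : Continuous fun m : ℝ => m ^ 2 - c * √(‖Δ‖ ^ 2 - m ^ 2) := by fun_prop
  have hev : ∀ᶠ m in 𝓝 ‖Δ‖, ‖A‖ < m ^ 2 - c * √(‖Δ‖ ^ 2 - m ^ 2) := by
    refine (hcont.tendsto ‖Δ‖).eventually_const_lt ?_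
    simpa using hlt
  -- Both `l` and `hl` are real numbers: the endpoints of an interval around `‖Δ‖`.
  obtain ⟨l, hl, hsub⟩ := (mem_nhds_iff_exists_Ioo_subset.1 hev)
  obtain ⟨hl1, hl2⟩ := hsub
  have hsup := ContinuousLinearMap.norm_eq_iSup_rayleighQuotient (T := Δ) hsym
  have hl3 : l < ⨆ x, |Δ.rayleighQuotient x| := by rw [← hsup]; exact hl1.1
  obtain ⟨x, hx⟩ := exists_lt_of_lt_ciSup hl3
  have hm : |Δ.rayleighQuotient x| < hl :=
    (ContinuousLinearMap.rayleighQuotient_le_norm Δ x).trans_lt hl1.2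
  have h1 : ‖A‖ < _ := hl2 ⟨hx, hm⟩
  have h2 := all x
  linarith

/-- The square root is Hölder continuous of exponent 1/2 in operator norm. This makes the output
injection `L W^{1/2}` a norm-continuous perturbation. -/
theorem continuousOn_of_isPositive_comp_self {E : Type*} [NormedAddCommGroup E]
    [InnerProductSpace ℝ E] {S W : ℝ → E →L[ℝ] E} {I : Set ℝ}
    (hS : ∀ t ∈ I, (S t).IsPositive ∧ (S t).comp (S t) = W t) (hW : ContinuousOn W I) :
    ContinuousOn S I := by
  intro t₀ ht₀
  have h1 : Tendsto (fun t => √‖W t - W t₀‖) (𝓝[I] t₀) (𝓝 0) := by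
    have : Tendsto (fun t => ‖W t - W t₀‖) (𝓝[I] t₀) (𝓝 ‖W t₀ - W t₀‖) :=
      ((hW t₀ ht₀).sub tendsto_const_nhds).norm
    simpa using this.sqrt
  refine tendsto_iff_norm_sub_tendsto_zero.2 (squeeze_zero' (Eventually.of_forall fun _ =>
    norm_nonneg _) ?_ h1)
  filter_upwards [self_mem_nhdsWithin] with t ht
  refine Real.le_sqrt_of_sq_le ?_
  rw [← (hS t ht).2, ← (hS t₀ ht₀).2]
  exact sq_norm_sub_le_norm_comp_self_sub (hS t ht).1 (hS t₀ ht₀).1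

/-! ### The linear-quadratic regulator problem -/

variable {H XB : Type*}
  [NormedAddCommGroup H] [InnerProductSpace ℝ H]
  [NormedAddCommGroup XB] [InnerProductSpace ℝ XB]

/-- The instantaneous cost of the state `z` and the control value `v` at time `r`. -/
noncomputable def runningCost (W : ℝ → H →L[ℝ] H) (R : ℝ → XB →L[ℝ] XB) (r : ℝ) (z : H) (v : XB) : ℝ :=
  ⟪z, W r z⟫_ℝ + ⟪v, R r v⟫_ℝ

/-- The running cost of the control `u` on `[s, T]`, from the state `x` at time `s`. -/
noncomputable def finiteHorizonCost (Y : ℝ → ℝ → H →L[ℝ] H) (B : ℝ → XB →L[ℝ] H) (W : ℝ → H →L[ℝ] H)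
    (R : ℝ → XB →L[ℝ] XB) (s : ℝ) (x : H) (u : ℝ → XB) (T : ℝ) : ℝ :=
  ∫ r in s..T, runningCost W R r (mildState Y B s x u r) (u r)

/-- The standing assumptions on a linear-quadratic regulator problem, with explicit constants. -/
structure IsRegulator (Y : ℝ → ℝ → H →L[ℝ] H) (B : ℝ → XB →L[ℝ] H) (W : ℝ → H →L[ℝ] H)
    (R : ℝ → XB →L[ℝ] XB) (b w ρ δ : ℝ) : Prop where
  evolution : IsEvolutionOperator (Ici 0) Y
  bound : ∀ T, ∃ C, IsTriangleBound Y T C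
  contB : ContinuousOn B (Ici 0)
  normB : ∀ t, 0 ≤ t → ‖B t‖ ≤ b
  contW : ContinuousOn W (Ici 0)
  normW : ∀ t, 0 ≤ t → ‖W t‖ ≤ w
  posW : ∀ t, 0 ≤ t → (W t).IsPositive
  contR : ContinuousOn R (Ici 0)
  normR : ∀ t, 0 ≤ t → ‖R t‖ ≤ ρ
  symR : ∀ t, 0 ≤ t → ∀ v v' : XB, ⟪R t v, v'⟫_ℝ = ⟪v, R t v'⟫_ℝ
  pos : 0 < δ
  coercive : ∀ t, 0 ≤ t → ∀ v : XB, δ * ‖v‖ ^ 2 ≤ ⟪v, R t v⟫_ℝ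

namespace IsRegulator

variable {Y : ℝ → ℝ → H →L[ℝ] H} {B : ℝ → XB →L[ℝ] H} {W : ℝ → H →L[ℝ] H}
  {R : ℝ → XB →L[ℝ] XB} {b w ρ δ : ℝ}

theorem b_nonneg (h : IsRegulator Y B W R b w ρ δ) : 0 ≤ b :=
  (norm_nonneg _).trans (h.normB 0 le_rfl)

theorem w_nonneg (h : IsRegulator Y B W R b w ρ δ) : 0 ≤ w :=
  (norm_nonneg _).trans (h.normW 0 le_rfl)

theorem ρ_nonneg (h : IsRegulator Y B W R b w ρ δ) : 0 ≤ ρ :=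
  (norm_nonneg _).trans (h.normR 0 le_rfl)

theorem evolution_Icc (h : IsRegulator Y B W R b w ρ δ) (T : ℝ) :
    IsEvolutionOperator (Icc 0 T) Y :=
  h.evolution.mono fun _ hr => hr.1

/-! #### The quadratic form of the running cost -/

section RunningCost

variable {r : ℝ} {z z' : H} {v v' : XB}

theorem inner_W_nonneg (h : IsRegulator Y B W R b w ρ δ) (hr : 0 ≤ r) (z : H) :
    0 ≤ ⟪z, W r z⟫_ℝ :=
  (h.posW r hr).inner_nonneg_right z

theorem coercive_runningCost (h : IsRegulator Y B W R b w ρ δ) (hr : 0 ≤ r) :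
    δ * ‖v‖ ^ 2 ≤ runningCost W R r z v := by
  have h1 := h.inner_W_nonneg hr z
  have h2 := h.coercive r hr v
  simp only [runningCost]
  linarith

theorem runningCost_nonneg (h : IsRegulator Y B W R b w ρ δ) (hr : 0 ≤ r) :
    0 ≤ runningCost W R r z v :=
  (mul_nonneg h.pos.le (sq_nonneg _)).trans (h.coercive_runningCost hr)

theorem inner_R_le (h : IsRegulator Y B W R b w ρ δ) (hr : 0 ≤ r) :
    ⟪v, R r v⟫_ℝ ≤ ρ * ‖v‖ ^ 2 := by
  calc ⟪v, R r v⟫_ℝ ≤ ‖v‖ * ‖R r v‖ := real_inner_le_norm _ _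
    _ ≤ ‖v‖ * (ρ * ‖v‖) := by gcongr; exact (R r).le_of_opNorm_le (h.normR r hr) v
    _ = ρ * ‖v‖ ^ 2 := by ring

theorem inner_W_le (h : IsRegulator Y B W R b w ρ δ) (hr : 0 ≤ r) :
    ⟪z, W r z⟫_ℝ ≤ w * ‖z‖ ^ 2 := by
  calc ⟪z, W r z⟫_ℝ ≤ ‖z‖ * ‖W r z‖ := real_inner_le_norm _ _
    _ ≤ ‖z‖ * (w * ‖z‖) := by gcongr; exact (W r).le_of_opNorm_le (h.normW r hr) z
    _ = w * ‖z‖ ^ 2 := by ring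

theorem runningCost_le (h : IsRegulator Y B W R b w ρ δ) (hr : 0 ≤ r) :
    runningCost W R r z v ≤ w * ‖z‖ ^ 2 + ρ * ‖v‖ ^ 2 :=
  add_le_add (h.inner_W_le hr) (h.inner_R_le hr)

theorem runningCost_add (h : IsRegulator Y B W R b w ρ δ) (hr : 0 ≤ r) :
    runningCost W R r (z + z') (v + v') = runningCost W R r z v + runningCost W R r z' v'
      + 2 * (⟪W r z, z'⟫_ℝ + ⟪R r v, v'⟫_ℝ) := by
  have h1 : ⟪z, W r z'⟫_ℝ = ⟪W r z, z'⟫_ℝ := ((h.posW r hr).isSymmetric z z').symm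
  have h2 : ⟪z', W r z⟫_ℝ = ⟪W r z, z'⟫_ℝ := real_inner_comm _ _
  have h3 : ⟪v, R r v'⟫_ℝ = ⟪R r v, v'⟫_ℝ := (h.symR r hr v v').symm
  have h4 : ⟪v', R r v⟫_ℝ = ⟪R r v, v'⟫_ℝ := real_inner_comm _ _
  simp only [runningCost, map_add, inner_add_left, inner_add_right, h1, h2, h3, h4]
  ring

theorem runningCost_smul (a : ℝ) :
    runningCost W R r (a • z) (a • v) = a ^ 2 * runningCost W R r z v := by
  simp only [runningCost, map_smul, real_inner_smul_left, inner_smul_right]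
  ring

theorem runningCost_sub (h : IsRegulator Y B W R b w ρ δ) (hr : 0 ≤ r) :
    runningCost W R r (z - z') (v - v') = runningCost W R r z v + runningCost W R r z' v'
      - 2 * (⟪W r z, z'⟫_ℝ + ⟪R r v, v'⟫_ℝ) := by
  have h1 := runningCost_smul (W := W) (R := R) (r := r) (z := z') (v := v') (-1)
  rw [sub_eq_add_neg, sub_eq_add_neg, h.runningCost_add hr]
  simp only [neg_smul, one_smul] at h1
  rw [h1]
  simp only [inner_neg_right]
  ring

theorem runningCost_parallelogram (h : IsRegulator Y B W R b w ρ δ) (hr : 0 ≤ r) :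
    runningCost W R r (z - z') (v - v') + runningCost W R r (z + z') (v + v')
      = 2 * runningCost W R r z v + 2 * runningCost W R r z' v' := by
  rw [h.runningCost_sub hr, h.runningCost_add hr]
  ring

/-- Young's inequality, from nonnegativity of the cost at `(θz - z', θv - v')`. A factor `1 + θ`
close to 1 lets cost bounds pass to limits without loss. -/
theorem runningCost_add_le (h : IsRegulator Y B W R b w ρ δ) (hr : 0 ≤ r) {θ : ℝ} (hθ : 0 < θ) :
    runningCost W R r (z + z') (v + v')
      ≤ (1 + θ) * runningCost W R r z v + (1 + θ⁻¹) * runningCost W R r z' v' := by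
  have h1 := h.runningCost_nonneg (z := θ • z - z') (v := θ • v - v') hr
  rw [h.runningCost_sub hr, runningCost_smul] at h1
  simp only [map_smul, real_inner_smul_left] at h1
  rw [h.runningCost_add hr]
  set p := ⟪W r z, z'⟫_ℝ + ⟪R r v, v'⟫_ℝ with hp
  have h2 : 2 * (θ * p) ≤ θ ^ 2 * runningCost W R r z v + runningCost W R r z' v' := by
    rw [hp]; linarith
  have h3 : 2 * p ≤ θ * runningCost W R r z v + θ⁻¹ * runningCost W R r z' v' := by
    have := mul_le_mul_of_nonneg_left h2 (inv_nonneg.2 hθ.le)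
    calc 2 * p = θ⁻¹ * (2 * (θ * p)) := by field_simp
      _ ≤ _ := this
      _ = _ := by field_simp
  linarith

end RunningCost

/-! #### Mild states -/

section MildState

variable {s t T : ℝ} {x x' : H} {u u' : ℝ → XB}

theorem _root_.MeasureTheory.MemLp.mono_Ioc {G : Type*} [NormedAddCommGroup G] {u : ℝ → G}
    {s' t' : ℝ}
    (hu : MemLp u 2 (volume.restrict (Ioc s T))) (hs : s ≤ s') (ht : t' ≤ T) :
    MemLp u 2 (volume.restrict (Ioc s' t')) :=
  hu.mono_measure (Measure.restrict_mono (Ioc_subset_Ioc hs ht) le_rfl)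

theorem intervalIntegrable_sq {G : Type*} [NormedAddCommGroup G] {u : ℝ → G} (hsT : s ≤ T)
    (hu : MemLp u 2 (volume.restrict (Ioc s T))) : IntervalIntegrable (fun r => ‖u r‖ ^ 2) volume s T := by
  rw [intervalIntegrable_iff_integrableOn_Ioc_of_le hsT]
  exact hu.norm.integrable_sq

theorem aestronglyMeasurable_input (h : IsRegulator Y B W R b w ρ δ) (hs : 0 ≤ s) {μ : Measure ℝ}
    (hu : AEStronglyMeasurable u (μ.restrict (Ioc s T))) :
    AEStronglyMeasurable (fun r => B r (u r)) (μ.restrict (Ioc s T)) :=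
  aestronglyMeasurable_clm_apply (fun _ =>
    ((h.contB.mono fun r (hr : r ∈ Ioc s T) => mem_Ici.2 (hs.trans hr.1.le)).clm_apply
      continuousOn_const).aestronglyMeasurable measurableSet_Ioc) hu

theorem intervalIntegrable_input (h : IsRegulator Y B W R b w ρ δ) (hs : 0 ≤ s) (hsT : s ≤ T)
    (hu : MemLp u 2 (volume.restrict (Ioc s T))) :
    IntervalIntegrable (fun r => B r (u r)) volume s T := by
  rw [intervalIntegrable_iff_integrableOn_Ioc_of_le hsT]
  have hu1 : IntegrableOn u (Ioc s T) := hu.integrable one_le_two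
  refine (hu1.norm.const_mul b).mono' (h.aestronglyMeasurable_input hs hu.1) ?_
  filter_upwards [ae_restrict_mem measurableSet_Ioc] with r hr
  exact (B r).le_of_opNorm_le (h.normB r (hs.trans hr.1.le)) _

theorem intervalIntegrable_mildState (h : IsRegulator Y B W R b w ρ δ) (hs : 0 ≤ s) (hsT : s ≤ T)
    (hu : MemLp u 2 (volume.restrict (Ioc s T))) :
    IntervalIntegrable (fun r => Y T r (B r (u r))) volume s T := by
  obtain ⟨C, hC⟩ := h.bound T
  exact (h.evolution_Icc T).intervalIntegrable_apply hC hs hsT le_rfl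
    (h.intervalIntegrable_input hs hsT hu)

theorem continuousOn_mildState (h : IsRegulator Y B W R b w ρ δ) (hs : 0 ≤ s) (hsT : s ≤ T)
    (hu : MemLp u 2 (volume.restrict (Ioc s T))) (x : H) :
    ContinuousOn (mildState Y B s x u) (Icc s T) := by
  obtain ⟨C, hC⟩ := h.bound T
  exact ((h.evolution_Icc T).continuousOn_Icc_left hs hsT x).add
    ((h.evolution_Icc T).continuousOn_integral hC hs hsT (h.intervalIntegrable_input hs hsT hu))

theorem mildState_add (h : IsRegulator Y B W R b w ρ δ) (hs : 0 ≤ s) (hst : s ≤ t)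
    (hu : MemLp u 2 (volume.restrict (Ioc s t))) (hu' : MemLp u' 2 (volume.restrict (Ioc s t))) :
    mildState Y B s (x + x') (fun r => u r + u' r) t
      = mildState Y B s x u t + mildState Y B s x' u' t := by
  simp only [mildState, map_add]
  rw [intervalIntegral.integral_add (h.intervalIntegrable_mildState hs hst hu)
    (h.intervalIntegrable_mildState hs hst hu')]
  abel

theorem mildState_smul (a : ℝ) :
    mildState Y B s (a • x) (fun r => a • u r) t = a • mildState Y B s x u t := by
  simp only [mildState, map_smul, intervalIntegral.integral_smul, smul_add]

theorem mildState_sub (h : IsRegulator Y B W R b w ρ δ) (hs : 0 ≤ s) (hst : s ≤ t)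
    (hu : MemLp u 2 (volume.restrict (Ioc s t))) (hu' : MemLp u' 2 (volume.restrict (Ioc s t))) :
    mildState Y B s (x - x') (fun r => u r - u' r) t
      = mildState Y B s x u t - mildState Y B s x' u' t := by
  simp only [mildState, map_sub]
  rw [intervalIntegral.integral_sub (h.intervalIntegrable_mildState hs hst hu)
    (h.intervalIntegrable_mildState hs hst hu')]
  abel

theorem mildState_congr (hst : s ≤ t) (huu' : ∀ᵐ r ∂(volume.restrict (Ioc s t)), u r = u' r) :
    mildState Y B s x u t = mildState Y B s x u' t := by
  simp only [mildState]
  congr 1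
  refine intervalIntegral.integral_congr_ae ?_
  rw [uIoc_of_le hst, ← ae_restrict_iff' measurableSet_Ioc]
  filter_upwards [huu'] with r hr
  rw [hr]

theorem mildState_restart [CompleteSpace H] (h : IsRegulator Y B W R b w ρ δ) {τ : ℝ}
    (hs : 0 ≤ s) (hsτ : s ≤ τ) (hτt : τ ≤ t) (hu : MemLp u 2 (volume.restrict (Ioc s t))) :
    mildState Y B s x u t = mildState Y B τ (mildState Y B s x u τ) u t := by
  obtain ⟨C, hC⟩ := h.bound t
  have hi := h.intervalIntegrable_input hs (hsτ.trans hτt) hu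
  have h1 : Y t τ (Y τ s x) = Y t s x := by
    rw [← h.evolution.comp s hs τ (hs.trans hsτ) t (hs.trans (hsτ.trans hτt)) hsτ hτt]; rfl
  have h2 := (h.evolution_Icc t).apply_integral hC hs hsτ hτt le_rfl
    (h.intervalIntegrable_input hs hsτ (hu.mono_Ioc le_rfl hτt))
  have h3 := h.intervalIntegrable_mildState hs (hsτ.trans hτt) hu
  simp only [mildState, map_add, h1, h2]
  rw [add_assoc, intervalIntegral.integral_add_adjacent_intervals]
  · exact h3.mono_set (by
      rw [uIcc_of_le hsτ, uIcc_of_le (hsτ.trans hτt)]; exact Icc_subset_Icc_right hτt)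
  · exact h3.mono_set (by
      rw [uIcc_of_le hτt, uIcc_of_le (hsτ.trans hτt)]; exact Icc_subset_Icc_left hsτ)

/-! #### Costs on finite horizons -/

theorem intervalIntegrable_runningCost (h : IsRegulator Y B W R b w ρ δ) (hs : 0 ≤ s) (hsT : s ≤ T)
    (hu : MemLp u 2 (volume.restrict (Ioc s T))) {z : ℝ → H} (hz : ContinuousOn z (Icc s T)) :
    IntervalIntegrable (fun r => runningCost W R r (z r) (u r)) volume s T := by
  refine IntervalIntegrable.add (ContinuousOn.intervalIntegrable ?_) ?_
  · rw [uIcc_of_le hsT]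
    exact hz.inner ((h.contW.mono fun r (hr : r ∈ Icc s T) =>
      mem_Ici.2 (hs.trans hr.1)).clm_apply hz)
  · rw [intervalIntegrable_iff_integrableOn_Ioc_of_le hsT]
    have hi := (intervalIntegrable_sq hsT hu).1.const_mul ρ
    refine hi.mono' (hu.1.inner (aestronglyMeasurable_clm_apply (fun _ =>
      ((h.contR.mono fun r (hr : r ∈ Ioc s T) => mem_Ici.2 (hs.trans hr.1.le)).clm_apply
        continuousOn_const).aestronglyMeasurable measurableSet_Ioc) hu.1)) ?_
    filter_upwards [ae_restrict_mem measurableSet_Ioc] with r hr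
    have hr0 : 0 ≤ r := hs.trans hr.1.le
    rw [Real.norm_of_nonneg ((mul_nonneg h.pos.le (sq_nonneg _)).trans (h.coercive r hr0 _))]
    exact h.inner_R_le hr0

theorem intervalIntegrable_cost (h : IsRegulator Y B W R b w ρ δ) (hs : 0 ≤ s) (hsT : s ≤ T)
    (hu : MemLp u 2 (volume.restrict (Ioc s T))) (x : H) :
    IntervalIntegrable (fun r => runningCost W R r (mildState Y B s x u r) (u r)) volume s T :=
  h.intervalIntegrable_runningCost hs hsT hu (h.continuousOn_mildState hs hsT hu x)

theorem finiteHorizonCost_nonneg (h : IsRegulator Y B W R b w ρ δ) (hs : 0 ≤ s) (hsT : s ≤ T) :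
    0 ≤ finiteHorizonCost Y B W R s x u T :=
  intervalIntegral.integral_nonneg hsT fun _ hr => h.runningCost_nonneg (hs.trans hr.1)

/-- The dynamic programming identity: the remaining cost is that of the problem restarted from the
state reached. -/
theorem finiteHorizonCost_restart [CompleteSpace H] (h : IsRegulator Y B W R b w ρ δ) {τ : ℝ}
    (hs : 0 ≤ s) (hsτ : s ≤ τ) (hτT : τ ≤ T) (hu : MemLp u 2 (volume.restrict (Ioc s T))) (x : H) :
    finiteHorizonCost Y B W R s x u T = finiteHorizonCost Y B W R s x u τ
      + finiteHorizonCost Y B W R τ (mildState Y B s x u τ) u T := by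
  have hi := h.intervalIntegrable_cost hs (hsτ.trans hτT) hu x
  have e : finiteHorizonCost Y B W R τ (mildState Y B s x u τ) u T
      = ∫ r in τ..T, runningCost W R r (mildState Y B s x u r) (u r) := by
    refine intervalIntegral.integral_congr fun r hr => ?_
    rw [uIcc_of_le hτT] at hr
    rw [← h.mildState_restart hs hsτ hr.1 (hu.mono_Ioc le_rfl hr.2)]
  rw [e, finiteHorizonCost, finiteHorizonCost, intervalIntegral.integral_add_adjacent_intervals]
  · exact hi.mono_set (by
      rw [uIcc_of_le hsτ, uIcc_of_le (hsτ.trans hτT)]; exact Icc_subset_Icc_right hτT)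
  · exact hi.mono_set (by
      rw [uIcc_of_le hτT, uIcc_of_le (hsτ.trans hτT)]; exact Icc_subset_Icc_left hsτ)

theorem finiteHorizonCost_mono [CompleteSpace H] (h : IsRegulator Y B W R b w ρ δ) {τ : ℝ}
    (hs : 0 ≤ s) (hsτ : s ≤ τ) (hτT : τ ≤ T) (hu : MemLp u 2 (volume.restrict (Ioc s T))) (x : H) :
    finiteHorizonCost Y B W R s x u τ ≤ finiteHorizonCost Y B W R s x u T := by
  rw [h.finiteHorizonCost_restart hs hsτ hτT hu x]
  have := h.finiteHorizonCost_nonneg (x := mildState Y B s x u τ) (u := u) (hs.trans hsτ) hτT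
  linarith

theorem coercive_finiteHorizonCost (h : IsRegulator Y B W R b w ρ δ) (hs : 0 ≤ s) (hsT : s ≤ T)
    (hu : MemLp u 2 (volume.restrict (Ioc s T))) (x : H) :
    δ * ∫ r in s..T, ‖u r‖ ^ 2 ≤ finiteHorizonCost Y B W R s x u T := by
  rw [← intervalIntegral.integral_const_mul]
  exact intervalIntegral.integral_mono_on hsT ((intervalIntegrable_sq hsT hu).const_mul δ)
    (h.intervalIntegrable_cost hs hsT hu x)
    fun r hr => h.coercive_runningCost (hs.trans hr.1)

theorem finiteHorizonCost_smul (a : ℝ) :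
    finiteHorizonCost Y B W R s (a • x) (fun r => a • u r) T
      = a ^ 2 * finiteHorizonCost Y B W R s x u T := by
  simp only [finiteHorizonCost, mildState_smul, runningCost_smul,
    intervalIntegral.integral_const_mul]

theorem finiteHorizonCost_parallelogram (h : IsRegulator Y B W R b w ρ δ) (hs : 0 ≤ s)
    (hsT : s ≤ T) (hu : MemLp u 2 (volume.restrict (Ioc s T)))
    (hu' : MemLp u' 2 (volume.restrict (Ioc s T))) :
    finiteHorizonCost Y B W R s (x - x') (fun r => u r - u' r) T
      + finiteHorizonCost Y B W R s (x + x') (fun r => u r + u' r) T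
      = 2 * finiteHorizonCost Y B W R s x u T + 2 * finiteHorizonCost Y B W R s x' u' T := by
  have i1 := h.intervalIntegrable_cost hs hsT hu x
  have i2 := h.intervalIntegrable_cost hs hsT hu' x'
  have i3 := h.intervalIntegrable_cost hs hsT (hu.sub hu') (x - x')
  have i4 := h.intervalIntegrable_cost hs hsT (hu.add hu') (x + x')
  simp only [finiteHorizonCost]
  rw [← intervalIntegral.integral_const_mul, ← intervalIntegral.integral_const_mul,
    ← intervalIntegral.integral_add (i1.const_mul 2) (i2.const_mul 2)]
  refine (intervalIntegral.integral_add i3 i4).symm.trans ?_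
  refine intervalIntegral.integral_congr fun r hr => ?_
  rw [uIcc_of_le hsT] at hr
  have m1 := h.mildState_sub (x := x) (x' := x') hs hr.1 (hu.mono_Ioc le_rfl hr.2)
    (hu'.mono_Ioc le_rfl hr.2)
  have m2 := h.mildState_add (x := x) (x' := x') hs hr.1 (hu.mono_Ioc le_rfl hr.2)
    (hu'.mono_Ioc le_rfl hr.2)
  change runningCost W R r (mildState Y B s (x - x') (fun r => u r - u' r) r) (u r - u' r)
    + runningCost W R r (mildState Y B s (x + x') (fun r => u r + u' r) r) (u r + u' r) = _
  rw [m1, m2, h.runningCost_parallelogram (hs.trans hr.1)]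

theorem finiteHorizonCost_add_le (h : IsRegulator Y B W R b w ρ δ) (hs : 0 ≤ s)
    (hsT : s ≤ T) (hu : MemLp u 2 (volume.restrict (Ioc s T)))
    (hu' : MemLp u' 2 (volume.restrict (Ioc s T))) {θ : ℝ} (hθ : 0 < θ) :
    finiteHorizonCost Y B W R s (x + x') (fun r => u r + u' r) T
      ≤ (1 + θ) * finiteHorizonCost Y B W R s x u T
        + (1 + θ⁻¹) * finiteHorizonCost Y B W R s x' u' T := by
  have i1 := h.intervalIntegrable_cost hs hsT hu x
  have i2 := h.intervalIntegrable_cost hs hsT hu' x'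
  have i4 := h.intervalIntegrable_cost hs hsT (hu.add hu') (x + x')
  simp only [finiteHorizonCost]
  rw [← intervalIntegral.integral_const_mul, ← intervalIntegral.integral_const_mul,
    ← intervalIntegral.integral_add (i1.const_mul _) (i2.const_mul _)]
  refine intervalIntegral.integral_mono_on hsT i4 ((i1.const_mul _).add (i2.const_mul _))
    fun r hr => ?_
  have m2 := h.mildState_add (x := x) (x' := x') hs hr.1 (hu.mono_Ioc le_rfl hr.2)
    (hu'.mono_Ioc le_rfl hr.2)
  change runningCost W R r (mildState Y B s (x + x') (fun r => u r + u' r) r) (u r + u' r) ≤ _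
  rw [m2]
  exact h.runningCost_add_le (hs.trans hr.1) hθ

theorem finiteHorizonCost_congr (hsT : s ≤ T)
    (huu' : ∀ᵐ r ∂(volume.restrict (Ioc s T)), u r = u' r) :
    finiteHorizonCost Y B W R s x u T = finiteHorizonCost Y B W R s x u' T := by
  refine intervalIntegral.integral_congr_ae ?_
  rw [uIoc_of_le hsT, ← ae_restrict_iff' measurableSet_Ioc]
  filter_upwards [huu', ae_restrict_mem measurableSet_Ioc] with r hr hrm
  rw [hr, mildState_congr (u := u) (u' := u') hrm.1.le
    (ae_mono (Measure.restrict_mono (Ioc_subset_Ioc_right hrm.2) le_rfl) huu')]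

theorem sq_integral_le (hst : s ≤ t) {φ : ℝ → ℝ} (hφ : MemLp φ 2 (volume.restrict (Ioc s t))) :
    (∫ r in s..t, φ r) ^ 2 ≤ (t - s) * ∫ r in s..t, φ r ^ 2 := by
  have h1 := sq_integral_mul_le (μ := volume.restrict (Ioc s t)) (φ := fun _ => (1 : ℝ)) (ψ := φ)
    (memLp_const 1) hφ
  simpa [intervalIntegral.integral_of_le hst, hst] using h1

theorem exists_mildState_zero_le (h : IsRegulator Y B W R b w ρ δ) (T : ℝ) :
    ∃ K, 0 ≤ K ∧ ∀ s t, 0 ≤ s → s ≤ t → t ≤ T → ∀ u : ℝ → XB,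
      MemLp u 2 (volume.restrict (Ioc s t)) →
      ‖mildState Y B s 0 u t‖ ^ 2 ≤ K * ∫ r in s..t, ‖u r‖ ^ 2 := by
  obtain ⟨C, hC⟩ := h.bound T
  refine ⟨(C * b) ^ 2 * |T|, by positivity, fun s t hs hst ht u hu => ?_⟩
  have hu1 : IntegrableOn u (Ioc s t) := hu.integrable one_le_two
  have hC0 := hC.nonneg hs hst ht
  have hb0 := h.b_nonneg
  have hn : ‖mildState Y B s 0 u t‖ ≤ C * b * ∫ r in s..t, ‖u r‖ := by
    simp only [mildState, map_zero, zero_add]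
    rw [← intervalIntegral.integral_const_mul]
    refine intervalIntegral.norm_integral_le_of_norm_le hst (ae_of_all _ fun r hr => ?_)
      (((intervalIntegrable_iff_integrableOn_Ioc_of_le hst).2 hu1.norm).const_mul _)
    calc ‖Y t r (B r (u r))‖ ≤ C * ‖B r (u r)‖ := hC.le (hs.trans hr.1.le) hr.2 ht _
      _ ≤ C * (b * ‖u r‖) := by
          gcongr; exact (B r).le_of_opNorm_le (h.normB r (hs.trans hr.1.le)) _
      _ = C * b * ‖u r‖ := by ring
  have hI0 : 0 ≤ ∫ r in s..t, ‖u r‖ ^ 2 :=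
    intervalIntegral.integral_nonneg hst fun r _ => sq_nonneg _
  calc ‖mildState Y B s 0 u t‖ ^ 2 ≤ (C * b * ∫ r in s..t, ‖u r‖) ^ 2 := by gcongr
    _ = (C * b) ^ 2 * (∫ r in s..t, ‖u r‖) ^ 2 := by ring
    _ ≤ (C * b) ^ 2 * ((t - s) * ∫ r in s..t, ‖u r‖ ^ 2) := by
        gcongr; exact sq_integral_le hst hu.norm
    _ ≤ (C * b) ^ 2 * (|T| * ∫ r in s..t, ‖u r‖ ^ 2) := by
        gcongr
        linarith [le_abs_self T]
    _ = _ := by ring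

/-- With zero initial state the state is bounded by the L² norm of the control (Cauchy–Schwarz),
hence so is the cost. It gives L² continuity of the cost in the control. -/
theorem exists_finiteHorizonCost_zero_le (h : IsRegulator Y B W R b w ρ δ) (T : ℝ) :
    ∃ K, 0 ≤ K ∧ ∀ s t, 0 ≤ s → s ≤ t → t ≤ T → ∀ u : ℝ → XB,
      MemLp u 2 (volume.restrict (Ioc s t)) →
      finiteHorizonCost Y B W R s 0 u t ≤ K * ∫ r in s..t, ‖u r‖ ^ 2 := by
  obtain ⟨K, hK0, hK⟩ := h.exists_mildState_zero_le T
  have hw0 := h.w_nonneg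
  have hρ0 := h.ρ_nonneg
  refine ⟨w * K * |T| + ρ, by positivity, fun s t hs hst ht u hu => ?_⟩
  have hi := intervalIntegrable_sq hst hu
  set I := ∫ r in s..t, ‖u r‖ ^ 2 with hI
  have hI0 : 0 ≤ I := intervalIntegral.integral_nonneg hst fun r _ => sq_nonneg _
  calc finiteHorizonCost Y B W R s 0 u t ≤ ∫ r in s..t, (w * (K * I) + ρ * ‖u r‖ ^ 2) := by
        refine intervalIntegral.integral_mono_on hst (h.intervalIntegrable_cost hs hst hu 0)
          (intervalIntegrable_const.add (hi.const_mul ρ)) fun r hr => ?_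
        refine (h.runningCost_le (hs.trans hr.1)).trans ?_
        gcongr
        refine (hK s r hs hr.1 (hr.2.trans ht) u (hu.mono_Ioc le_rfl hr.2)).trans ?_
        gcongr
        exact intervalIntegral.integral_mono_interval le_rfl hr.1 hr.2
          (ae_of_all _ fun r => sq_nonneg _) hi
    _ = (t - s) * (w * (K * I)) + ρ * I := by
        rw [intervalIntegral.integral_add intervalIntegrable_const (hi.const_mul ρ),
          intervalIntegral.integral_const, intervalIntegral.integral_const_mul, smul_eq_mul]
    _ ≤ |T| * (w * (K * I)) + ρ * I := by
        gcongr
        linarith [le_abs_self T]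
    _ = _ := by ring

end MildState

end IsRegulator

end Regulator

/-! ### Detectability: the state is controlled by the cost -/

section Detectability

open Filter Topology

variable {H XB : Type*}
  [NormedAddCommGroup H] [InnerProductSpace ℝ H]
  [NormedAddCommGroup XB] [InnerProductSpace ℝ XB]

/-- A regulator problem whose states are controlled by their cost, uniformly in time. -/
structure IsDetectableRegulator (Y : ℝ → ℝ → H →L[ℝ] H) (B : ℝ → XB →L[ℝ] H)
    (W : ℝ → H →L[ℝ] H) (R : ℝ → XB →L[ℝ] XB) (b w ρ δ κ α : ℝ) : Prop
    extends IsRegulator Y B W R b w ρ δ where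
  κ_nonneg : 0 ≤ κ
  α_pos : 0 < α
  decay : ∀ (s t : ℝ) (x : H) (u : ℝ → XB), 0 ≤ s → s ≤ t →
    MemLp u 2 (volume.restrict (Ioc s t)) → ‖mildState Y B s x u t‖ ^ 2
      ≤ κ * Real.exp (-α * (t - s)) * ‖x‖ ^ 2 + κ * finiteHorizonCost Y B W R s x u t

theorem integral_exp_neg_sq_le {α s t : ℝ} (hα : 0 < α) :
    ∫ r in s..t, Real.exp (-α * (t - r)) ^ 2 ≤ (2 * α)⁻¹ := by
  have hd : ∀ r ∈ uIcc s t, HasDerivAt (fun r => (2 * α)⁻¹ * Real.exp (-(2 * α) * (t - r)))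
      (Real.exp (-α * (t - r)) ^ 2) r := by
    intro r _
    have h1 : HasDerivAt (fun r : ℝ => -(2 * α) * (t - r)) (-(2 * α) * (-1)) r :=
      ((hasDerivAt_id r).const_sub t).const_mul _
    refine (h1.exp.const_mul ((2 * α)⁻¹)).congr_deriv ?_
    have e : Real.exp (-α * (t - r)) ^ 2 = Real.exp (-(2 * α) * (t - r)) := by
      rw [← Real.exp_nat_mul]; congr 1; push_cast; ring
    rw [e]
    field_simp
  rw [intervalIntegral.integral_eq_sub_of_hasDerivAt hd
    (Continuous.intervalIntegrable (by fun_prop) _ _)]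
  have : 0 ≤ (2 * α)⁻¹ * Real.exp (-(2 * α) * (t - s)) := by positivity
  simp only [sub_self, mul_zero, Real.exp_zero, mul_one]
  linarith

variable [CompleteSpace H] {Y : ℝ → ℝ → H →L[ℝ] H} {B : ℝ → XB →L[ℝ] H} {W : ℝ → H →L[ℝ] H}
  {R : ℝ → XB →L[ℝ] XB} {b w ρ δ : ℝ}

/-- Relative to `YL`, the state is `YL x` plus the convolution of `YL` with `f = Bu - L S z`. Here
`‖Bu‖² ≤ (b²/δ)⟪u, Ru⟫` by coercivity and `‖LSz‖² ≤ l²‖Sz‖² = l²⟪z, Wz⟫`, so `‖f‖²` is at most a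
constant times the running cost. Cauchy–Schwarz against the exponential kernel bounds the
convolution uniformly in time. -/
theorem IsRegulator.norm_sq_mildState_le (h : IsRegulator Y B W R b w ρ δ)
    {S L : ℝ → H →L[ℝ] H} {YL : ℝ → ℝ → H →L[ℝ] H} {l M α : ℝ}
    (hS : ∀ t : ℝ, 0 ≤ t → (S t).IsPositive ∧ (S t).comp (S t) = W t)
    (hLc : ContinuousOn L (Ici 0)) (hL : ∀ t, 0 ≤ t → ‖L t‖ ≤ l)
    (hYL : IsPerturbedEvolution (Ici 0) Y (fun r => (L r).comp (S r)) YL)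
    (hM : 0 ≤ M) (hα : 0 < α)
    (hexp : ∀ s t : ℝ, 0 ≤ s → s ≤ t → ‖YL t s‖ ≤ M * Real.exp (-α * (t - s)))
    {s t : ℝ} {x : H} {u : ℝ → XB} (hs : 0 ≤ s) (hst : s ≤ t)
    (hu : MemLp u 2 (volume.restrict (Ioc s t))) :
    ‖mildState Y B s x u t‖ ^ 2 ≤ 2 * M ^ 2 * Real.exp (-(2 * α) * (t - s)) * ‖x‖ ^ 2
      + 2 * M ^ 2 * (2 * α)⁻¹ * (2 * (b ^ 2 / δ + l ^ 2)) * finiteHorizonCost Y B W R s x u t := by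
  have hl0 : 0 ≤ l := (norm_nonneg _).trans (hL 0 le_rfl)
  have hSz : ∀ r, 0 ≤ r → ∀ z, ‖S r z‖ ^ 2 = ⟪z, W r z⟫_ℝ := by
    intro r hr z
    rw [← (hS r hr).2, ← real_inner_self_eq_norm_sq]
    exact (hS r hr).1.isSymmetric z (S r z)
  have hSn : ∀ r, 0 ≤ r → ‖S r‖ ≤ √w := fun r hr => by
    refine (S r).opNorm_le_bound (Real.sqrt_nonneg _) fun z => ?_
    rw [← Real.sqrt_sq (norm_nonneg z), ← Real.sqrt_mul h.w_nonneg]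
    refine Real.le_sqrt_of_sq_le ?_
    rw [hSz r hr]
    exact h.inner_W_le hr
  set D : ℝ → H →L[ℝ] H := fun r => (L r).comp (S r) with hD
  have hSc : ContinuousOn S (Ici 0) := continuousOn_of_isPositive_comp_self hS h.contW
  have hDc : ContinuousOn D (Ici 0) := hLc.clm_comp hSc
  have hd0 : 0 ≤ l * √w := mul_nonneg hl0 (Real.sqrt_nonneg _)
  have hDn : ∀ r, 0 ≤ r → ‖D r‖ ≤ l * √w := fun r hr =>
    ((L r).opNorm_comp_le (S r)).trans (mul_le_mul (hL r hr) (hSn r hr) (norm_nonneg _) hl0)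
  obtain ⟨C, hC⟩ := h.bound t
  have hC' : IsTriangleBound YL t M := fun s' t' hs' hst' _ => by
    refine (hexp s' t' hs' hst').trans (mul_le_of_le_one_right hM ?_)
    refine Real.exp_le_one_iff.2 ?_
    nlinarith
  have hI : Icc (0 : ℝ) t ⊆ Ici 0 := fun r hr => hr.1
  have hzc := h.continuousOn_mildState hs hst hu x
  set z := mildState Y B s x u with hz
  have hBu := h.intervalIntegrable_input hs hst hu
  have key := (hYL.mono hI).variation_of_constants (h.evolution_Icc t) hC hC' hd0
    (fun r hr => hDn r hr.1) (fun x => ((hDc.mono hI).clm_apply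
      continuousOn_const).aestronglyMeasurable measurableSet_Icc) hs hst hBu (x := x) (z := z)
    (fun r _ => rfl) t ⟨hst, le_rfl⟩
  set f : ℝ → H := fun r => B r (u r) - D r (z r) with hf
  have hb0 := h.b_nonneg
  have hδ := h.pos
  set c : ℝ := 2 * (b ^ 2 / δ + l ^ 2) with hc
  have hc0 : 0 ≤ c := by positivity
  have hfq : ∀ r ∈ Icc s t, ‖f r‖ ^ 2 ≤ c * runningCost W R r (z r) (u r) := by
    intro r hr
    have hr0 : 0 ≤ r := hs.trans hr.1
    have h1 : ‖B r (u r)‖ ^ 2 ≤ b ^ 2 / δ * ⟪u r, R r (u r)⟫_ℝ := by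
      calc ‖B r (u r)‖ ^ 2 ≤ (b * ‖u r‖) ^ 2 := by
            gcongr; exact (B r).le_of_opNorm_le (h.normB r hr0) _
        _ = b ^ 2 / δ * (δ * ‖u r‖ ^ 2) := by field_simp
        _ ≤ _ := by gcongr; exact h.coercive r hr0 _
    have h2 : ‖D r (z r)‖ ^ 2 ≤ l ^ 2 * ⟪z r, W r (z r)⟫_ℝ := by
      rw [← hSz r hr0, ← mul_pow]
      gcongr
      exact (L r).le_of_opNorm_le (hL r hr0) _
    have h3 : ‖f r‖ ^ 2 ≤ 2 * (‖B r (u r)‖ ^ 2 + ‖D r (z r)‖ ^ 2) := by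
      have := norm_sub_le (B r (u r)) (D r (z r))
      calc ‖f r‖ ^ 2 ≤ (‖B r (u r)‖ + ‖D r (z r)‖) ^ 2 := by gcongr
        _ ≤ _ := add_sq_le
    have hWz := h.inner_W_nonneg hr0 (z r)
    have hRu : 0 ≤ ⟪u r, R r (u r)⟫_ℝ :=
      (mul_nonneg hδ.le (sq_nonneg _)).trans (h.coercive r hr0 _)
    have h4 : 0 ≤ b ^ 2 / δ * ⟪z r, W r (z r)⟫_ℝ := by positivity
    have h5 : 0 ≤ l ^ 2 * ⟪u r, R r (u r)⟫_ℝ := by positivity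
    calc ‖f r‖ ^ 2 ≤ _ := h3
      _ ≤ 2 * (b ^ 2 / δ * ⟪u r, R r (u r)⟫_ℝ + l ^ 2 * ⟪z r, W r (z r)⟫_ℝ) := by gcongr
      _ ≤ c * runningCost W R r (z r) (u r) := by
          simp only [runningCost, hc]; nlinarith
  have hq := h.intervalIntegrable_cost hs hst hu x
  have hDz : IntervalIntegrable (fun r => D r (z r)) volume s t :=
    ContinuousOn.intervalIntegrable (by
      rw [uIcc_of_le hst]
      exact (hDc.mono fun r (hr : r ∈ Icc s t) => mem_Ici.2 (hs.trans hr.1)).clm_apply hzc)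
  have hfi : IntervalIntegrable f volume s t := hBu.sub hDz
  have hfm : AEStronglyMeasurable f (volume.restrict (Ioc s t)) := hfi.1.aestronglyMeasurable
  have hf2 : Integrable (fun r => ‖f r‖ ^ 2) (volume.restrict (Ioc s t)) := by
    refine (hq.1.const_mul c).mono' (hfm.norm.pow 2) ?_
    filter_upwards [ae_restrict_mem measurableSet_Ioc] with r hr
    rw [Real.norm_of_nonneg (sq_nonneg _)]
    exact hfq r ⟨hr.1.le, hr.2⟩
  have hfL : MemLp (fun r => ‖f r‖) 2 (volume.restrict (Ioc s t)) :=
    ((memLp_two_iff_integrable_sq_norm hfm).2 hf2).norm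
  have hφc : Continuous fun r => Real.exp (-α * (t - r)) := by fun_prop
  have hφL : MemLp (fun r => Real.exp (-α * (t - r))) 2 (volume.restrict (Ioc s t)) := by
    refine (memLp_two_iff_integrable_sq hφc.aestronglyMeasurable).2 ?_
    exact ((hφc.pow 2).intervalIntegrable s t).1
  have hint : ‖∫ r in s..t, YL t r (f r)‖
      ≤ M * ∫ r in s..t, Real.exp (-α * (t - r)) * ‖f r‖ := by
    rw [← intervalIntegral.integral_const_mul]
    refine intervalIntegral.norm_integral_le_of_norm_le hst (ae_of_all _ fun r hr => ?_) ?_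
    · rw [← mul_assoc]
      exact (YL t r).le_of_opNorm_le (hexp r t (hs.trans hr.1.le) hr.2) _
    · rw [intervalIntegrable_iff_integrableOn_Ioc_of_le hst]
      exact (hφL.integrable_mul hfL).const_mul M
  have hCS : (∫ r in s..t, Real.exp (-α * (t - r)) * ‖f r‖) ^ 2
      ≤ (2 * α)⁻¹ * (c * finiteHorizonCost Y B W R s x u t) := by
    have h1 := sq_integral_mul_le hφL hfL
    simp only [← intervalIntegral.integral_of_le hst] at h1
    refine h1.trans (mul_le_mul (integral_exp_neg_sq_le hα) ?_
      (intervalIntegral.integral_nonneg hst fun r _ => sq_nonneg _) (by positivity))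
    rw [finiteHorizonCost, ← intervalIntegral.integral_const_mul]
    exact intervalIntegral.integral_mono_on hst
      ((intervalIntegrable_iff_integrableOn_Ioc_of_le hst).2 hf2) (hq.const_mul c) hfq
  have hx1 : ‖YL t s x‖ ≤ M * Real.exp (-α * (t - s)) * ‖x‖ :=
    (YL t s).le_of_opNorm_le (hexp s t hs hst) x
  have e2 : Real.exp (-(2 * α) * (t - s)) = Real.exp (-α * (t - s)) ^ 2 := by
    rw [← Real.exp_nat_mul]; congr 1; push_cast; ring
  rw [key]
  calc ‖YL t s x + ∫ r in s..t, YL t r (f r)‖ ^ 2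
      ≤ (‖YL t s x‖ + ‖∫ r in s..t, YL t r (f r)‖) ^ 2 := by gcongr; exact norm_add_le _ _
    _ ≤ 2 * (‖YL t s x‖ ^ 2 + ‖∫ r in s..t, YL t r (f r)‖ ^ 2) := add_sq_le
    _ ≤ 2 * ((M * Real.exp (-α * (t - s)) * ‖x‖) ^ 2
        + (M * ∫ r in s..t, Real.exp (-α * (t - r)) * ‖f r‖) ^ 2) := by gcongr
    _ ≤ 2 * ((M * Real.exp (-α * (t - s)) * ‖x‖) ^ 2
        + M ^ 2 * ((2 * α)⁻¹ * (c * finiteHorizonCost Y B W R s x u t))) := by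
        rw [mul_pow M (∫ r in s..t, Real.exp (-α * (t - r)) * ‖f r‖)]
        gcongr
    _ = _ := by rw [e2]; ring

theorem exists_isDetectableRegulator [CompleteSpace XB]
    (hY : IsEvolutionOperator (Set.Ici 0) Y) (hB : IsBoundedContinuousInTime B)
    (hW : IsBoundedContinuousInTime W) (hWpos : ∀ t : ℝ, 0 ≤ t → (W t).IsPositive)
    (hR : IsBoundedContinuousInTime R) (hRcoer : IsUniformlyCoercive R)
    {S : ℝ → H →L[ℝ] H} (hS : ∀ t : ℝ, 0 ≤ t → (S t).IsPositive ∧ (S t).comp (S t) = W t)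
    (hdet : IsUniformlyDetectable Y S) :
    ∃ b w ρ δ κ α : ℝ, IsDetectableRegulator Y B W R b w ρ δ κ α := by
  obtain ⟨hBc, b, hb⟩ := hB
  obtain ⟨hWc, w, hw⟩ := hW
  obtain ⟨hRc, ρ, hρ⟩ := hR
  obtain ⟨hRs, δ, hδ, hRδ⟩ := hRcoer
  obtain ⟨L, ⟨hLc, l, hl⟩, YL, hYL, M, α, hM, hα, hexp⟩ := hdet
  have hl0 : 0 ≤ l := (norm_nonneg _).trans (hl 0 le_rfl)
  have hw0 : 0 ≤ w := (norm_nonneg _).trans (hw 0 le_rfl)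
  have hSn : ∀ r, 0 ≤ r → ‖S r‖ ≤ √w := fun r hr => by
    refine (S r).opNorm_le_bound (Real.sqrt_nonneg _) fun z => ?_
    rw [← Real.sqrt_sq (norm_nonneg z), ← Real.sqrt_mul hw0]
    refine Real.le_sqrt_of_sq_le ?_
    calc ‖S r z‖ ^ 2 = ⟪z, W r z⟫_ℝ := by
          rw [← (hS r hr).2, ← real_inner_self_eq_norm_sq]
          exact (hS r hr).1.isSymmetric z (S r z)
      _ ≤ ‖z‖ * ‖W r z‖ := real_inner_le_norm _ _
      _ ≤ ‖z‖ * (w * ‖z‖) := by gcongr; exact (W r).le_of_opNorm_le (hw r hr) z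
      _ = w * ‖z‖ ^ 2 := by ring
  have hDn : ∀ r, 0 ≤ r → ‖(L r).comp (S r)‖ ≤ l * √w := fun r hr =>
    ((L r).opNorm_comp_le (S r)).trans (mul_le_mul (hl r hr) (hSn r hr) (norm_nonneg _) hl0)
  have hreg : IsRegulator Y B W R b w ρ δ :=
    { evolution := hY
      -- The local bound on `Y` is not part of the definition of an evolution operator; here it is
      -- deduced from the stability of `YL`.
      bound := fun T => ⟨_, hYL.triangleBound_of_bounded hY hM (fun s t hs hst =>
        (hexp s t hs hst).trans (mul_le_of_le_one_right hM (Real.exp_le_one_iff.2 (by nlinarith))))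
        (mul_nonneg hl0 (Real.sqrt_nonneg _)) hDn T⟩
      contB := hBc
      normB := hb
      contW := hWc
      normW := hw
      posW := hWpos
      contR := hRc
      normR := hρ
      symR := fun t ht v v' => (hRs t ht).isSymmetric v v'
      pos := hδ
      coercive := hRδ }
  set c : ℝ := 2 * (b ^ 2 / δ + l ^ 2) with hc
  have hc0 : 0 ≤ c := by positivity
  -- `κ` is the sum of the two constants of the estimate, so that one constant serves both terms;
  -- the rate doubles because norms are squared.
  refine ⟨b, w, ρ, δ, 2 * M ^ 2 + 2 * M ^ 2 * (2 * α)⁻¹ * c, 2 * α, hreg, by positivity,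
    by positivity, fun s t x u hs hst hu => ?_⟩
  refine (hreg.norm_sq_mildState_le hS hLc hl hYL hM hα hexp hs hst hu).trans ?_
  have hJ := hreg.finiteHorizonCost_nonneg (x := x) (u := u) hs hst
  gcongr
  · exact le_add_of_nonneg_right (by positivity)
  · exact le_add_of_nonneg_left (by positivity)

end Detectability

/-! ### The finite-horizon Riccati equation and completion of squares -/

section FiniteHorizon

open Filter Topology

variable {H XB : Type*}
  [NormedAddCommGroup H] [InnerProductSpace ℝ H] [CompleteSpace H]
  [NormedAddCommGroup XB] [InnerProductSpace ℝ XB] [CompleteSpace XB]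

/-- The operator `B(t) R(t)⁻¹ B(t)*`. -/
noncomputable def controlWeight (B : ℝ → XB →L[ℝ] H) (R : ℝ → XB →L[ℝ] XB) (t : ℝ) : H →L[ℝ] H :=
  (B t).comp ((Ring.inverse (R t)).comp (ContinuousLinearMap.adjoint (B t)))

namespace IsRegulator

variable {Y : ℝ → ℝ → H →L[ℝ] H} {B : ℝ → XB →L[ℝ] H} {W : ℝ → H →L[ℝ] H}
  {R : ℝ → XB →L[ℝ] XB} {b w ρ δ : ℝ} {P : ℝ → H →L[ℝ] H} {r s t T p : ℝ} {x y z : H}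

/-! #### Feedback gains -/

theorem inner_controlWeight_comm (h : IsRegulator Y B W R b w ρ δ) (hr : 0 ≤ r) (x y : H) :
    ⟪controlWeight B R r x, y⟫_ℝ = ⟪x, controlWeight B R r y⟫_ℝ := by
  simp only [controlWeight, ContinuousLinearMap.comp_apply]
  rw [← ContinuousLinearMap.adjoint_inner_right, ← ContinuousLinearMap.adjoint_inner_left (B r)]
  exact inner_ringInverse_comm_of_coercive h.pos (h.coercive r hr)
    (ContinuousLinearMap.isSelfAdjoint_iff_isSymmetric.2 (h.symR r hr)) _ _

theorem norm_inverse_R_comp_le (h : IsRegulator Y B W R b w ρ δ) (hr : 0 ≤ r) (z : H) :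
    ‖Ring.inverse (R r) (ContinuousLinearMap.adjoint (B r) z)‖ ≤ δ⁻¹ * (b * ‖z‖) := by
  refine (Ring.inverse (R r)).le_of_opNorm_le_of_le
    (norm_ringInverse_le_of_coercive h.pos (h.coercive r hr)) ?_
  refine (ContinuousLinearMap.adjoint (B r)).le_of_opNorm_le ?_ z
  rw [LinearIsometryEquiv.norm_map]
  exact h.normB r hr

theorem norm_controlWeight_le (h : IsRegulator Y B W R b w ρ δ) (hr : 0 ≤ r) :
    ‖controlWeight B R r‖ ≤ b * (δ⁻¹ * b) := by
  have hb := h.b_nonneg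
  have hδ := h.pos
  refine (controlWeight B R r).opNorm_le_bound (by positivity) fun z => ?_
  refine ((B r).le_of_opNorm_le_of_le (h.normB r hr) (h.norm_inverse_R_comp_le hr z)).trans ?_
  exact le_of_eq (by ring)

theorem continuousOn_inverse_R_comp (h : IsRegulator Y B W R b w ρ δ) :
    ContinuousOn (fun r => (Ring.inverse (R r)).comp (ContinuousLinearMap.adjoint (B r)))
      (Ici 0) := by
  have h1 : ContinuousOn (fun r => Ring.inverse (R r)) (Ici 0) := fun r hr => by
    obtain ⟨v, hv⟩ := isUnit_of_coercive h.pos (h.coercive r hr)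
    have := NormedRing.inverse_continuousAt v
    rw [hv] at this
    exact this.comp_continuousWithinAt (h.contR r hr)
  have h2 : ContinuousOn (fun r => ContinuousLinearMap.adjoint (B r)) (Ici 0) :=
    ContinuousLinearMap.adjoint.continuous.comp_continuousOn h.contB
  exact h1.clm_comp h2

theorem R_feedbackGain (h : IsRegulator Y B W R b w ρ δ) (hr : 0 ≤ r) (z : H) :
    R r (feedbackGain B R P r z) = ContinuousLinearMap.adjoint (B r) (P r z) :=
  apply_ringInverse_of_coercive h.pos (h.coercive r hr) _

theorem norm_feedbackGain_le (h : IsRegulator Y B W R b w ρ δ) (hr : 0 ≤ r) (hp : ‖P r‖ ≤ p) :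
    ‖feedbackGain B R P r‖ ≤ δ⁻¹ * (b * p) := by
  have hb := h.b_nonneg
  have hδ := h.pos
  have hp0 : 0 ≤ p := (norm_nonneg _).trans hp
  refine (feedbackGain B R P r).opNorm_le_bound (by positivity) fun z => ?_
  calc ‖feedbackGain B R P r z‖ ≤ δ⁻¹ * (b * ‖P r z‖) := h.norm_inverse_R_comp_le hr (P r z)
    _ ≤ δ⁻¹ * (b * (p * ‖z‖)) := by gcongr; exact (P r).le_of_opNorm_le hp z
    _ = δ⁻¹ * (b * p) * ‖z‖ := by ring

theorem norm_closedLoop_le (h : IsRegulator Y B W R b w ρ δ) (hr : 0 ≤ r) (hp : ‖P r‖ ≤ p) :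
    ‖-((B r).comp (feedbackGain B R P r))‖ ≤ b * (δ⁻¹ * (b * p)) := by
  rw [norm_neg]
  exact ((B r).opNorm_comp_le _).trans (mul_le_mul (h.normB r hr)
    (h.norm_feedbackGain_le hr hp) (norm_nonneg _) h.b_nonneg)

theorem aestronglyMeasurable_feedbackGain (h : IsRegulator Y B W R b w ρ δ)
    (hP : ∀ x, AEStronglyMeasurable (fun t => P t x) (volume.restrict (Icc 0 T)))
    {f : ℝ → H} (hf : AEStronglyMeasurable f (volume.restrict (Icc 0 T))) :
    AEStronglyMeasurable (fun r => feedbackGain B R P r (f r)) (volume.restrict (Icc 0 T)) := by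
  refine aestronglyMeasurable_clm_apply
    (T := fun r => (Ring.inverse (R r)).comp (ContinuousLinearMap.adjoint (B r)))
    (fun x => ?_) (aestronglyMeasurable_clm_apply hP hf)
  exact ((h.continuousOn_inverse_R_comp.mono fun r (hr : r ∈ Icc 0 T) => hr.1).clm_apply
    continuousOn_const).aestronglyMeasurable measurableSet_Icc

theorem aestronglyMeasurable_B_feedbackGain (h : IsRegulator Y B W R b w ρ δ)
    (hP : ∀ x, AEStronglyMeasurable (fun t => P t x) (volume.restrict (Icc 0 T)))
    {f : ℝ → H} (hf : AEStronglyMeasurable f (volume.restrict (Icc 0 T))) :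
    AEStronglyMeasurable (fun r => B r (feedbackGain B R P r (f r)))
      (volume.restrict (Icc 0 T)) := by
  refine aestronglyMeasurable_clm_apply (fun x => ?_) (h.aestronglyMeasurable_feedbackGain hP hf)
  exact ((h.contB.mono fun r (hr : r ∈ Icc 0 T) => hr.1).clm_apply
    continuousOn_const).aestronglyMeasurable measurableSet_Icc

/-! #### The Riccati integral equation -/

variable {P₀ : H →L[ℝ] H} {Z : ℝ → ℝ → H →L[ℝ] H}

theorem exists_closedLoop_bound (h : IsRegulator Y B W R b w ρ δ)
    (hF : IsFiniteHorizonRiccati Y B W R P₀ T P Z) : ∃ C, IsTriangleBound Z T C := by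
  obtain ⟨p, hp⟩ := hF.bounded
  obtain ⟨C, hC⟩ := h.bound T
  have hb := h.b_nonneg
  have hδ := h.pos
  have hp' : ∀ r ∈ Icc 0 T, ‖P r‖ ≤ |p| := fun r hr => (hp r hr).trans (le_abs_self p)
  exact hF.closedLoop.exists_bound hC (by positivity)
    fun r hr => h.norm_closedLoop_le hr.1 (hp' r hr)

theorem inner_riccati (hF : IsFiniteHorizonRiccati Y B W R P₀ T P Z) (hs : 0 ≤ s) (hsT : s ≤ T)
    (x y : H) : ⟪P s x, y⟫_ℝ = ⟪P₀ (Z T s x), Z T s y⟫_ℝ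
      + ∫ r in s..T, ⟪W r (Z r s x) + P r (B r (feedbackGain B R P r (Z r s x))), Z r s y⟫_ℝ := by
  have hi := hF.integrable s ⟨hs, hsT⟩ x
  rw [hF.riccati s ⟨hs, hsT⟩ x, inner_add_left, ContinuousLinearMap.adjoint_inner_left,
    real_inner_comm y, ← innerSL_apply_apply ℝ y, ← ContinuousLinearMap.intervalIntegral_comp_comm _ hi]
  congr 1
  refine intervalIntegral.integral_congr fun r _ => ?_
  simp only [innerSL_apply_apply, riccatiIntegrand]
  rw [real_inner_comm, ContinuousLinearMap.adjoint_inner_left]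

theorem intervalIntegrable_inner_riccati (hF : IsFiniteHorizonRiccati Y B W R P₀ T P Z)
    (hs : 0 ≤ s) (hsT : s ≤ T) (x y : H) :
    IntervalIntegrable (fun r =>
      ⟪W r (Z r s x) + P r (B r (feedbackGain B R P r (Z r s x))), Z r s y⟫_ℝ) volume s T := by
  have hi := hF.integrable s ⟨hs, hsT⟩ x
  rw [intervalIntegrable_iff_integrableOn_Ioc_of_le hsT] at hi ⊢
  refine (hi.inner_const (𝕜 := ℝ) y).congr (ae_of_all _ fun r => ?_)
  simp only [riccatiIntegrand, ContinuousLinearMap.adjoint_inner_left]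

/-- Symmetry of `P` is not part of the definition of a solution. With `E = P - P*` and `G = B R⁻¹
B*` symmetric, the `P₀` and `W` terms cancel in the difference of the equations for `⟪Px, y⟫` and
`⟪Py, x⟫`, and the quadratic term leaves `⟪E G P a, c⟫ + ⟪E a, G P c⟫`, which is linear in `E`.
Backward Grönwall with zero terminal value forces `E = 0`. -/
theorem riccati_symm (h : IsRegulator Y B W R b w ρ δ) (hP₀ : P₀.IsPositive)
    (hF : IsFiniteHorizonRiccati Y B W R P₀ T P Z) :
    ∀ s ∈ Icc 0 T, ∀ x y, ⟪P s x, y⟫_ℝ = ⟪x, P s y⟫_ℝ := by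
  obtain ⟨p, hp⟩ := hF.bounded
  obtain ⟨C, hC⟩ := h.exists_closedLoop_bound hF
  set k : ℝ := b * (δ⁻¹ * b) with hk
  have hb := h.b_nonneg
  have hδ := h.pos
  have hk0 : 0 ≤ k := by positivity
  have hp' : ∀ r ∈ Icc 0 T, ‖P r‖ ≤ |p| := fun r hr => (hp r hr).trans (le_abs_self p)
  set E : ℝ → H →L[ℝ] H := fun r => P r - ContinuousLinearMap.adjoint (P r) with hE
  have hEin : ∀ r a c, ⟪E r a, c⟫_ℝ = ⟪P r a, c⟫_ℝ - ⟪a, P r c⟫_ℝ := fun r a c => by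
    rw [hE, sub_apply, inner_sub_left, ContinuousLinearMap.adjoint_inner_left]
  have hpt : ∀ r ∈ Icc 0 T, ∀ a c, ∀ e, ‖E r‖ ≤ e →
      |⟪W r a + P r (B r (feedbackGain B R P r a)), c⟫_ℝ
        - ⟪W r c + P r (B r (feedbackGain B R P r c)), a⟫_ℝ|
      ≤ 2 * (k * |p|) * e * (‖a‖ * ‖c‖) := by
    intro r hr a c e he
    have he0 : 0 ≤ e := (norm_nonneg _).trans he
    have hK : ∀ a, B r (feedbackGain B R P r a) = controlWeight B R r (P r a) := fun a => rfl
    have hKn : ∀ a, ‖controlWeight B R r (P r a)‖ ≤ k * (|p| * ‖a‖) := fun a =>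
      (controlWeight B R r).le_of_opNorm_le_of_le (h.norm_controlWeight_le hr.1)
        ((P r).le_of_opNorm_le (hp' r hr) a)
    have e1 : ⟪W r a + P r (B r (feedbackGain B R P r a)), c⟫_ℝ
        - ⟪W r c + P r (B r (feedbackGain B R P r c)), a⟫_ℝ
        = ⟪E r (controlWeight B R r (P r a)), c⟫_ℝ
          + ⟪E r a, controlWeight B R r (P r c)⟫_ℝ := by
      rw [hEin, hEin, hK, hK, inner_add_left, inner_add_left]
      have h1 : ⟪W r c, a⟫_ℝ = ⟪W r a, c⟫_ℝ :=
        ((h.posW r hr.1).isSymmetric c a).trans (real_inner_comm _ _)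
      have h2 := h.inner_controlWeight_comm hr.1 (P r a) (P r c)
      rw [h1, h2, real_inner_comm a]
      ring
    rw [e1]
    refine (abs_add_le _ _).trans ?_
    have h1 : |⟪E r (controlWeight B R r (P r a)), c⟫_ℝ| ≤ e * (k * (|p| * ‖a‖)) * ‖c‖ := by
      refine (abs_real_inner_le_norm _ _).trans ?_
      gcongr
      exact (E r).le_of_opNorm_le_of_le he (hKn a)
    have h2 : |⟪E r a, controlWeight B R r (P r c)⟫_ℝ| ≤ (e * ‖a‖) * (k * (|p| * ‖c‖)) := by
      refine (abs_real_inner_le_norm _ _).trans ?_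
      gcongr
      · exact (E r).le_of_opNorm_le he a
      · exact hKn c
    calc _ ≤ e * (k * (|p| * ‖a‖)) * ‖c‖ + (e * ‖a‖) * (k * (|p| * ‖c‖)) := add_le_add h1 h2
      _ = _ := by ring
  have key := le_exp_of_forall_majorant (f := fun r => ‖E r‖) (a := 0) (b := T) (A := 0)
    (C := 2 * (k * |p|) * C ^ 2) (c := 2 * |p|) le_rfl (by positivity) (by positivity)
    (fun r hr => by
      calc ‖E r‖ ≤ ‖P r‖ + ‖ContinuousLinearMap.adjoint (P r)‖ := norm_sub_le _ _
        _ ≤ |p| + |p| := by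
            rw [LinearIsometryEquiv.norm_map]; exact add_le_add (hp' r hr) (hp' r hr)
        _ = 2 * |p| := by ring)
    (fun g hg hfg s hs => by
      have hg0 : ∀ r ∈ Icc s T, 0 ≤ g r := fun r hr =>
        (norm_nonneg _).trans (hfg r ⟨hs.1.trans hr.1, hr.2⟩)
      have hI0 : 0 ≤ ∫ r in s..T, g r := intervalIntegral.integral_nonneg hs.2 hg0
      rw [zero_add]
      refine ContinuousLinearMap.opNorm_le_of_re_inner_le (𝕜 := ℝ) (by positivity)
        fun x y hx hy => ?_
      simp only [RCLike.re_to_real]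
      have i1 := intervalIntegrable_inner_riccati hF hs.1 hs.2 x y
      have i2 := intervalIntegrable_inner_riccati hF hs.1 hs.2 y x
      have e0 : ⟪P₀ (Z T s y), Z T s x⟫_ℝ = ⟪P₀ (Z T s x), Z T s y⟫_ℝ :=
        (hP₀.isSymmetric _ _).trans (real_inner_comm _ _)
      rw [hEin, real_inner_comm _ x, inner_riccati hF hs.1 hs.2 x y,
        inner_riccati hF hs.1 hs.2 y x, e0, add_sub_add_left_eq_sub,
        ← intervalIntegral.integral_sub i1 i2, ← intervalIntegral.integral_const_mul]
      refine (Real.le_norm_self _).trans ?_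
      refine intervalIntegral.norm_integral_le_of_norm_le hs.2 (ae_of_all _ fun r hr => ?_)
        ((hg.const_smul (2 * (k * |p|) * C ^ 2)).intervalIntegrable _ _)
      have hrm : r ∈ Icc 0 T := ⟨hs.1.trans hr.1.le, hr.2⟩
      refine (hpt r hrm (Z r s x) (Z r s y) (g r) (hfg r hrm)).trans ?_
      have hx' := hC.le hs.1 hr.1.le hr.2 x
      have hy' := hC.le hs.1 hr.1.le hr.2 y
      rw [hx, mul_one] at hx'
      rw [hy, mul_one] at hy'
      have hC0 : 0 ≤ C := (norm_nonneg _).trans hx'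
      have := hg0 r ⟨hr.1.le, hr.2⟩
      calc 2 * (k * |p|) * g r * (‖Z r s x‖ * ‖Z r s y‖)
          ≤ 2 * (k * |p|) * g r * (C * C) := by gcongr
        _ = 2 * (k * |p|) * C ^ 2 * g r := by ring)
  intro s hs x y
  have h1 := key s hs
  simp only [mul_zero, zero_mul] at h1
  have h2 : E s = 0 := norm_le_zero_iff.1 h1
  have h3 := hEin s x y
  rw [h2, zero_apply, inner_zero_left] at h3
  linarith

theorem inner_R_feedbackGain (h : IsRegulator Y B W R b w ρ δ) (hr : 0 ≤ r)
    (hsymm : ∀ x y, ⟪P r x, y⟫_ℝ = ⟪x, P r y⟫_ℝ) (z : H) :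
    ⟪feedbackGain B R P r z, R r (feedbackGain B R P r z)⟫_ℝ
      = ⟪P r (B r (feedbackGain B R P r z)), z⟫_ℝ := by
  rw [h.R_feedbackGain hr, ContinuousLinearMap.adjoint_inner_right, ← hsymm]

/-- The optimal feedback control on a finite horizon. -/
noncomputable def _root_.feedbackControl (B : ℝ → XB →L[ℝ] H) (R : ℝ → XB →L[ℝ] XB)
    (P : ℝ → H →L[ℝ] H) (Z : ℝ → ℝ → H →L[ℝ] H) (s : ℝ) (x : H) (r : ℝ) : XB :=
  -(feedbackGain B R P r (Z r s x))

theorem mildState_feedbackControl (hZ : IsClosedLoop (Icc 0 T) Y B R P Z) (hs : 0 ≤ s)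
    (hst : s ≤ t) (htT : t ≤ T) (x : H) :
    mildState Y B s x (feedbackControl B R P Z s x) t = Z t s x := by
  rw [hZ.eq s ⟨hs, hst.trans htT⟩ t ⟨hs.trans hst, htT⟩ hst x]
  simp [mildState, feedbackControl]

theorem memLp_feedbackControl (h : IsRegulator Y B W R b w ρ δ)
    (hF : IsFiniteHorizonRiccati Y B W R P₀ T P Z) (hs : 0 ≤ s) (hsT : s ≤ T) (x : H) :
    MemLp (feedbackControl B R P Z s x) 2 (volume.restrict (Ioc s T)) := by
  obtain ⟨p, hp⟩ := hF.bounded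
  obtain ⟨C, hC⟩ := h.exists_closedLoop_bound hF
  have hb := h.b_nonneg
  have hδ := h.pos
  have hp' : ∀ r ∈ Icc 0 T, ‖P r‖ ≤ |p| := fun r hr => (hp r hr).trans (le_abs_self p)
  have hsub : Ioc s T ⊆ Icc 0 T := fun r hr => ⟨hs.trans hr.1.le, hr.2⟩
  have hm : AEStronglyMeasurable (feedbackControl B R P Z s x) (volume.restrict (Ioc s T)) := by
    refine AEStronglyMeasurable.neg ?_
    have hind : AEStronglyMeasurable ((Ioc s T).indicator fun r => Z r s x)
        (volume.restrict (Icc 0 T)) :=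
      ((aestronglyMeasurable_indicator_iff measurableSet_Ioc).2
        (((hF.closedLoop.evolution.continuousOn_Icc_left hs hsT x).mono
          Ioc_subset_Icc_self).aestronglyMeasurable measurableSet_Ioc)).mono_measure
        Measure.restrict_le_self
    refine ((h.aestronglyMeasurable_feedbackGain hF.measurable hind).mono_measure
      (Measure.restrict_mono hsub le_rfl)).congr ?_
    filter_upwards [ae_restrict_mem measurableSet_Ioc] with r hr
    rw [indicator_of_mem hr]
  refine MemLp.of_bound hm (δ⁻¹ * (b * |p|) * (C * ‖x‖)) ?_
  filter_upwards [ae_restrict_mem measurableSet_Ioc] with r hr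
  rw [feedbackControl, norm_neg]
  exact (feedbackGain B R P r).le_of_opNorm_le_of_le
    (h.norm_feedbackGain_le (hsub hr).1 (hp' r (hsub hr))) (hC.le hs hr.1.le hr.2 x)

/-- Along the closed loop, symmetry of `P` turns `⟪P B K z, z⟫` into `⟪Kz, R Kz⟫`, the control cost
of the feedback. -/
theorem inner_riccati_self (h : IsRegulator Y B W R b w ρ δ) (hP₀ : P₀.IsPositive)
    (hF : IsFiniteHorizonRiccati Y B W R P₀ T P Z) (hs : 0 ≤ s) (hsT : s ≤ T) (x : H) :
    ⟪P s x, x⟫_ℝ = ⟪P₀ (Z T s x), Z T s x⟫_ℝ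
      + finiteHorizonCost Y B W R s x (feedbackControl B R P Z s x) T := by
  rw [inner_riccati hF hs hsT, finiteHorizonCost]
  congr 1
  refine intervalIntegral.integral_congr fun r hr => ?_
  rw [uIcc_of_le hsT] at hr
  have hr0 : 0 ≤ r := hs.trans hr.1
  have e1 := mildState_feedbackControl hF.closedLoop hs hr.1 hr.2 x
  have e2 := h.inner_R_feedbackGain hr0 (h.riccati_symm hP₀ hF r ⟨hr0, hr.2⟩) (Z r s x)
  simp only [runningCost, e1]
  simp only [feedbackControl, map_neg, inner_neg_neg]
  rw [e2, inner_add_left, real_inner_comm]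

theorem isPositive_riccati (h : IsRegulator Y B W R b w ρ δ) (hP₀ : P₀.IsPositive)
    (hF : IsFiniteHorizonRiccati Y B W R P₀ T P Z) (hs : 0 ≤ s) (hsT : s ≤ T) :
    (P s).IsPositive := by
  refine ⟨h.riccati_symm hP₀ hF s ⟨hs, hsT⟩, fun x => ?_⟩
  change 0 ≤ ⟪P s x, x⟫_ℝ
  rw [h.inner_riccati_self hP₀ hF hs hsT]
  exact add_nonneg (hP₀.inner_nonneg_left _) (h.finiteHorizonCost_nonneg hs hsT)

/-- The first-order optimality condition for the feedback control. -/
theorem optimality_feedbackControl (h : IsRegulator Y B W R b w ρ δ) (hP₀ : P₀.IsPositive)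
    (hF : IsFiniteHorizonRiccati Y B W R P₀ T P Z) (hs : 0 ≤ s) (hsT : s ≤ T) (x : H)
    {v : ℝ → XB} (hv : MemLp v 2 (volume.restrict (Ioc s T))) :
    IntervalIntegrable (fun r => ⟪W r (Z r s x), mildState Y B s 0 v r⟫_ℝ
      + ⟪R r (feedbackControl B R P Z s x r), v r⟫_ℝ) volume s T ∧
    (∫ r in s..T, (⟪W r (Z r s x), mildState Y B s 0 v r⟫_ℝ
      + ⟪R r (feedbackControl B R P Z s x r), v r⟫_ℝ))
      = -⟪P₀ (Z T s x), mildState Y B s 0 v T⟫_ℝ := by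
  obtain ⟨p, hp⟩ := hF.bounded
  obtain ⟨C, hC⟩ := h.bound T
  obtain ⟨C', hC'⟩ := h.exists_closedLoop_bound hF
  have hb := h.b_nonneg
  have hw := h.w_nonneg
  have hδ := h.pos
  have hC'0 := hC'.nonneg hs hsT le_rfl
  have hp' : ∀ r ∈ Icc 0 T, ‖P r‖ ≤ |p| := fun r hr => (hp r hr).trans (le_abs_self p)
  have hsymm := h.riccati_symm hP₀ hF
  have hsub : Ioc s T ⊆ Icc 0 T := fun r hr => ⟨hs.trans hr.1.le, hr.2⟩
  have hrestr : ∀ {f : ℝ → H}, AEStronglyMeasurable f (volume.restrict (Icc 0 T)) →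
      AEStronglyMeasurable f (volume.restrict (Ioc s T)) := fun hf =>
    hf.mono_measure (Measure.restrict_mono hsub le_rfl)
  have hPm : ∀ x, AEStronglyMeasurable (fun t => P t x) (volume.restrict (Ioc s T)) := fun x =>
    hrestr (hF.measurable x)
  have hGm : ∀ x, AEStronglyMeasurable (fun r => B r (feedbackGain B R P r x))
      (volume.restrict (Icc 0 T)) := fun x =>
    h.aestronglyMeasurable_B_feedbackGain hF.measurable aestronglyMeasurable_const
  have hWm : ∀ x, AEStronglyMeasurable (fun r => W r x) (volume.restrict (Ioc s T)) := fun x =>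
    ((h.contW.mono fun r (hr : r ∈ Ioc s T) => mem_Ici.2 (hs.trans hr.1.le)).clm_apply
      continuousOn_const).aestronglyMeasurable measurableSet_Ioc
  set z : ℝ → H := fun r => Z r s x with hz
  set ζ : ℝ → H := mildState Y B s 0 v with hζ
  have hζc : ContinuousOn ζ (Icc s T) := h.continuousOn_mildState hs hsT hv 0
  have hζm : AEStronglyMeasurable ζ (volume.restrict (Ioc s T)) :=
    (hζc.mono Ioc_subset_Icc_self).aestronglyMeasurable measurableSet_Ioc
  have hzm : AEStronglyMeasurable z (volume.restrict (Ioc s T)) :=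
    ((hF.closedLoop.evolution.continuousOn_Icc_left hs hsT x).mono
      Ioc_subset_Icc_self).aestronglyMeasurable measurableSet_Ioc
  obtain ⟨cζ, hcζ⟩ := isCompact_Icc.exists_bound_of_continuousOn hζc
  have hcζ0 : 0 ≤ cζ := (norm_nonneg _).trans (hcζ s ⟨le_rfl, hsT⟩)
  -- The variation `ζ` belongs to the open loop; relative to the closed loop `Z` it is driven by
  -- `g`. Only `Z` appears in the Riccati equation.
  set g : ℝ → H := fun r => B r (v r) + B r (feedbackGain B R P r (ζ r)) with hg
  have hBG : IntervalIntegrable (fun r => B r (feedbackGain B R P r (ζ r))) volume s T :=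
    intervalIntegrable_clm_apply (D := fun r => (B r).comp (feedbackGain B R P r))
      (d := b * (δ⁻¹ * (b * |p|)))
      (fun r hr => by rw [← norm_neg]; exact h.norm_closedLoop_le hr.1 (hp' r hr)) hGm hs hsT
      le_rfl hζc
  have hBv := h.intervalIntegrable_input hs hsT hv
  have hgi : IntervalIntegrable g volume s T := hBv.add hBG
  have hζZ : ∀ t ∈ Icc s T, ζ t = ∫ r in s..t, Z t r (g r) := by
    intro t ht
    have := hF.closedLoop.variation_of_constants (h.evolution_Icc T) hC hC'
      (d := b * (δ⁻¹ * (b * |p|))) (by positivity)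
      (fun r hr => h.norm_closedLoop_le hr.1 (hp' r hr)) (fun x => (hGm x).neg) hs hsT hBv
      (x := 0) (z := ζ) (fun t _ => rfl) t ht
    simpa [hg, sub_neg_eq_add] using this
  set q : ℝ → H := fun σ => W σ (z σ) + P σ (B σ (feedbackGain B R P σ (z σ))) with hq
  have hBGz : AEStronglyMeasurable (fun r => B r (feedbackGain B R P r (z r)))
      (volume.restrict (Ioc s T)) :=
    aestronglyMeasurable_clm_apply (T := fun r => (B r).comp (feedbackGain B R P r))
      (fun x => hrestr (hGm x)) hzm
  have hqm : AEStronglyMeasurable q (volume.restrict (Ioc s T)) :=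
    (aestronglyMeasurable_clm_apply hWm hzm).add (aestronglyMeasurable_clm_apply hPm hBGz)
  set cq : ℝ := w * (C' * ‖x‖) + |p| * (b * (δ⁻¹ * (b * |p|)) * (C' * ‖x‖)) with hcq
  have hqn : ∀ r ∈ Ioc s T, ‖q r‖ ≤ cq := by
    intro r hr
    have hr0 := (hsub hr).1
    have hzn : ‖z r‖ ≤ C' * ‖x‖ := hC'.le hs hr.1.le hr.2 x
    have h1 : ‖B r (feedbackGain B R P r (z r))‖ ≤ b * (δ⁻¹ * (b * |p|)) * (C' * ‖x‖) :=
      ((B r).comp (feedbackGain B R P r)).le_of_opNorm_le_of_le (by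
        rw [← norm_neg]; exact h.norm_closedLoop_le hr0 (hp' r (hsub hr))) hzn
    exact (norm_add_le _ _).trans (add_le_add
      ((W r).le_of_opNorm_le_of_le (h.normW r hr0) hzn)
      ((P r).le_of_opNorm_le_of_le (hp' r (hsub hr)) h1))
  have hcq0 : 0 ≤ cq := by positivity
  -- pairing the costate with the driving term
  have hcomp : ∀ r ∈ Icc s T, ∀ σ ∈ Icc r T, Z σ r (z r) = z σ := by
    intro r hr σ hσ
    have hsr := hs.trans hr.1
    have := hF.closedLoop.evolution.comp s ⟨hs, hsT⟩ r ⟨hsr, hr.2⟩ σ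
      ⟨hsr.trans hσ.1, hσ.2⟩ hr.1 hσ.1
    exact congrArg (fun V : H →L[ℝ] H => V x) this
  have hpair : ∀ r ∈ Icc s T, ⟪P r (z r), g r⟫_ℝ = ⟪P₀ (z T), Z T r (g r)⟫_ℝ
      + ∫ σ in r..T, ⟪q σ, Z σ r (g r)⟫_ℝ := by
    intro r hr
    rw [inner_riccati hF (hs.trans hr.1) hr.2, hcomp r hr T ⟨hr.2, le_rfl⟩]
    congr 1
    refine intervalIntegral.integral_congr fun σ hσ => ?_
    rw [uIcc_of_le hr.2] at hσ
    simp only [hcomp r hr σ hσ, hq]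
  have hPzm : AEStronglyMeasurable (fun r => P r (z r)) (volume.restrict (Ioc s T)) :=
    aestronglyMeasurable_clm_apply hPm hzm
  have iPg : IntervalIntegrable (fun r => ⟪P r (z r), g r⟫_ℝ) volume s T := by
    rw [intervalIntegrable_iff_integrableOn_Ioc_of_le hsT]
    refine (hgi.1.norm.const_mul (|p| * (C' * ‖x‖))).mono' (hPzm.inner hgi.1.1) ?_
    filter_upwards [ae_restrict_mem measurableSet_Ioc] with r hr
    refine (norm_inner_le_norm _ _).trans ?_
    gcongr
    exact (P r).le_of_opNorm_le_of_le (hp' r (hsub hr)) (hC'.le hs hr.1.le hr.2 x)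
  have iZg := hF.closedLoop.evolution.intervalIntegrable_apply hC' hs hsT le_rfl hgi
  have iT : IntervalIntegrable (fun r => ⟪P₀ (z T), Z T r (g r)⟫_ℝ) volume s T := by
    rw [intervalIntegrable_iff_integrableOn_Ioc_of_le hsT] at iZg ⊢
    exact iZg.const_inner (𝕜 := ℝ) _
  have e1 : ∫ r in s..T, ∫ σ in r..T, ⟪q σ, Z σ r (g r)⟫_ℝ
      = (∫ r in s..T, ⟪P r (z r), g r⟫_ℝ) - ∫ r in s..T, ⟪P₀ (z T), Z T r (g r)⟫_ℝ := by
    rw [← intervalIntegral.integral_sub iPg iT]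
    refine intervalIntegral.integral_congr fun r hr => ?_
    rw [uIcc_of_le hsT] at hr
    simp only [hpair r hr, add_sub_cancel_left]
  -- Exchanging the order of integration reassembles `∫ Z σ r (g r) dr = ζ σ`, replacing the
  -- differentiation of `⟪P z, ζ⟫` that a classical solution would allow.
  have e2 := intervalIntegral_triangle_swap (f := fun r σ => ⟪q σ, Z σ r (g r)⟫_ℝ) hsT
    (k := fun r => cq * (C' * ‖g r‖)) ((hgi.norm.const_mul C').const_mul cq)
    ((aestronglyMeasurable_snd_triangle hqm).inner
      (aestronglyMeasurable_clm_apply (T := fun p : ℝ × ℝ => Z p.2 p.1)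
        (fun x => hF.closedLoop.evolution.aestronglyMeasurable_triangle hs hsT le_rfl x)
        (aestronglyMeasurable_fst_triangle hgi.1.1)))
    (fun r σ hsr hrσ hσ => by
      refine (norm_inner_le_norm _ _).trans ?_
      exact mul_le_mul (hqn σ ⟨hsr.trans hrσ, hσ⟩)
        (hC'.le (hs.trans hsr.le) hrσ.le hσ _) (norm_nonneg _) hcq0)
  have e3 : ∫ σ in s..T, ∫ r in s..σ, ⟪q σ, Z σ r (g r)⟫_ℝ = ∫ σ in s..T, ⟪q σ, ζ σ⟫_ℝ := by
    refine intervalIntegral.integral_congr fun σ hσ => ?_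
    rw [uIcc_of_le hsT] at hσ
    have hi := hF.closedLoop.evolution.intervalIntegrable_apply hC' hs hσ.1 hσ.2
      (hgi.mono_set (by rw [uIcc_of_le hsT, uIcc_of_le hσ.1]; exact Icc_subset_Icc_right hσ.2))
    have := (innerSL ℝ (q σ)).intervalIntegral_comp_comm hi
    simp only [innerSL_apply_apply] at this
    rw [this, ← hζZ σ hσ]
  have e4 : ∫ r in s..T, ⟪P₀ (z T), Z T r (g r)⟫_ℝ = ⟪P₀ (z T), ζ T⟫_ℝ := by
    have := (innerSL ℝ (P₀ (z T))).intervalIntegral_comp_comm iZg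
    simp only [innerSL_apply_apply] at this
    rw [this, ← hζZ T ⟨hsT, le_rfl⟩]
  have iq : IntervalIntegrable (fun σ => ⟪q σ, ζ σ⟫_ℝ) volume s T := by
    rw [intervalIntegrable_iff_integrableOn_Ioc_of_le hsT]
    refine IntegrableOn.of_bound measure_Ioc_lt_top (hqm.inner hζm) (cq * cζ) ?_
    filter_upwards [ae_restrict_mem measurableSet_Ioc] with r hr
    exact (norm_inner_le_norm _ _).trans (mul_le_mul (hqn r hr) (hcζ r ⟨hr.1.le, hr.2⟩)
      (norm_nonneg _) hcq0)
  -- The two feedback terms cancel by symmetry of `P` and `B R⁻¹ B*`; what is left of the control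
  -- term is `-⟪P z, B v⟫ = ⟪R u₀, v⟫` for the feedback control `u₀`.
  have hpt : ∀ r ∈ Icc s T, ⟪q r, ζ r⟫_ℝ - ⟪P r (z r), g r⟫_ℝ
      = ⟪W r (z r), ζ r⟫_ℝ + ⟪R r (feedbackControl B R P Z s x r), v r⟫_ℝ := by
    intro r hr
    have hr0 : 0 ≤ r := hs.trans hr.1
    have h1 : ⟪P r (B r (feedbackGain B R P r (z r))), ζ r⟫_ℝ
        = ⟪P r (z r), B r (feedbackGain B R P r (ζ r))⟫_ℝ := by
      rw [hsymm r ⟨hr0, hr.2⟩]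
      exact h.inner_controlWeight_comm hr0 (P r (z r)) (P r (ζ r))
    have h2 : ⟪R r (feedbackControl B R P Z s x r), v r⟫_ℝ = -⟪P r (z r), B r (v r)⟫_ℝ := by
      rw [feedbackControl, map_neg, h.R_feedbackGain hr0, inner_neg_left,
        ContinuousLinearMap.adjoint_inner_left]
    simp only [hq, hg, inner_add_left, inner_add_right]
    rw [h1, h2]
    ring
  have hptI : EqOn (fun r => ⟪q r, ζ r⟫_ℝ - ⟪P r (z r), g r⟫_ℝ)
      (fun r => ⟪W r (z r), ζ r⟫_ℝ + ⟪R r (feedbackControl B R P Z s x r), v r⟫_ℝ)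
      (uIcc s T) := by
    rw [uIcc_of_le hsT]
    exact hpt
  refine ⟨(iq.sub iPg).congr (hptI.mono uIoc_subset_uIcc), ?_⟩
  rw [← intervalIntegral.integral_congr hptI, intervalIntegral.integral_sub iq iPg, ← e4]
  rw [e3] at e2
  linarith

/-- Completion of squares: the total cost of an arbitrary control, in terms of the optimal one. -/
theorem total_cost_eq (h : IsRegulator Y B W R b w ρ δ) (hP₀ : P₀.IsPositive)
    (hF : IsFiniteHorizonRiccati Y B W R P₀ T P Z) (hs : 0 ≤ s) (hsT : s ≤ T) (x : H)
    {u : ℝ → XB} (hu : MemLp u 2 (volume.restrict (Ioc s T))) :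
    finiteHorizonCost Y B W R s x u T
        + ⟪P₀ (mildState Y B s x u T), mildState Y B s x u T⟫_ℝ
      = ⟪P s x, x⟫_ℝ
        + (finiteHorizonCost Y B W R s 0 (fun r => u r - feedbackControl B R P Z s x r) T
        + ⟪P₀ (mildState Y B s x u T - Z T s x), mildState Y B s x u T - Z T s x⟫_ℝ) := by
  set u₀ := feedbackControl B R P Z s x with hu₀
  have hu₀m : MemLp u₀ 2 (volume.restrict (Ioc s T)) := h.memLp_feedbackControl hF hs hsT x
  set v : ℝ → XB := fun r => u r - u₀ r with hv
  have hvm : MemLp v 2 (volume.restrict (Ioc s T)) := hu.sub hu₀m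
  obtain ⟨hi, hopt⟩ := h.optimality_feedbackControl hP₀ hF hs hsT x hvm
  have hst : ∀ r ∈ Icc s T, mildState Y B s x u₀ r = Z r s x := fun r hr =>
    mildState_feedbackControl hF.closedLoop hs hr.1 hr.2 x
  have hsub : ∀ r ∈ Icc s T, mildState Y B s 0 v r = mildState Y B s x u r - Z r s x := by
    intro r hr
    have := h.mildState_sub (x := x) (x' := x) hs hr.1 (hu.mono_Ioc le_rfl hr.2)
      (hu₀m.mono_Ioc le_rfl hr.2)
    rw [sub_self, hst r hr] at this
    exact this
  have hJ : finiteHorizonCost Y B W R s x u T = finiteHorizonCost Y B W R s x u₀ T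
      + finiteHorizonCost Y B W R s 0 v T
      + 2 * ∫ r in s..T, (⟪W r (Z r s x), mildState Y B s 0 v r⟫_ℝ + ⟪R r (u₀ r), v r⟫_ℝ) := by
    have i1 := h.intervalIntegrable_cost hs hsT hu₀m x
    have i2 := h.intervalIntegrable_cost hs hsT hvm 0
    simp only [finiteHorizonCost]
    rw [← intervalIntegral.integral_const_mul, ← intervalIntegral.integral_add i1 i2,
      ← intervalIntegral.integral_add (i1.add i2) (hi.const_mul 2)]
    refine intervalIntegral.integral_congr fun r hr => ?_
    rw [uIcc_of_le hsT] at hr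
    have e1 : mildState Y B s x u r = Z r s x + mildState Y B s 0 v r := by
      rw [hsub r hr]; abel
    have e2 : u r = u₀ r + v r := by simp [hv]
    rw [hst r hr, e1, e2, h.runningCost_add (hs.trans hr.1)]
  -- The cross term of the running cost becomes `-2⟪P₀ a, c - a⟫`, exactly what completes the
  -- terminal square.
  rw [hJ, hopt, h.inner_riccati_self hP₀ hF hs hsT, hsub T ⟨hsT, le_rfl⟩]
  set a := Z T s x
  set c := mildState Y B s x u T
  have hsm : ⟪P₀ c, a⟫_ℝ = ⟪P₀ a, c⟫_ℝ := (hP₀.isSymmetric c a).trans (real_inner_comm _ _)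
  simp only [map_sub, inner_sub_left, inner_sub_right, hsm]
  ring

end IsRegulator

end FiniteHorizon

/-! ### Optimal controls on infinite horizons and decay of finite-cost states -/

section InfiniteHorizon

open Filter Topology

variable {H XB : Type*}
  [NormedAddCommGroup H] [InnerProductSpace ℝ H]
  [NormedAddCommGroup XB] [InnerProductSpace ℝ XB]

theorem MeasureTheory.MemLp.eLpNorm_two_eq {α E : Type*} [MeasurableSpace α] {μ : Measure α}
    [NormedAddCommGroup E] {f : α → E} (hf : MemLp f 2 μ) :
    eLpNorm f 2 μ = ENNReal.ofReal (√(∫ a, ‖f a‖ ^ 2 ∂μ)) := by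
  rw [hf.eLpNorm_eq_integral_rpow_norm (by norm_num) (by norm_num), Real.sqrt_eq_rpow]
  simp

theorem iUnion_Ioc_add_natCast (s : ℝ) : ⋃ n : ℕ, Ioc s (s + n) = Ioi s := by
  ext r
  simp only [mem_iUnion, mem_Ioc, mem_Ioi]
  constructor
  · rintro ⟨n, h, -⟩; exact h
  · intro hr
    obtain ⟨n, hn⟩ := exists_nat_ge (r - s)
    exact ⟨n, hr, by linarith⟩

namespace IsRegulator

variable {Y : ℝ → ℝ → H →L[ℝ] H} {B : ℝ → XB →L[ℝ] H} {W : ℝ → H →L[ℝ] H}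
  {R : ℝ → XB →L[ℝ] XB} {b w ρ δ : ℝ} {s t T : ℝ} {x : H} {u u' : ℝ → XB}

theorem memLp_of_infiniteHorizonCost_lt_top (h : IsRegulator Y B W R b w ρ δ) (hs : 0 ≤ s)
    (hu : AEStronglyMeasurable u (volume.restrict (Ioi s)))
    (hJ : infiniteHorizonCost Y B W R s x u < ⊤) : MemLp u 2 (volume.restrict (Ioi s)) := by
  have hδ := h.pos
  rw [memLp_two_iff_integrable_sq_norm hu]
  have hi : Integrable (fun r => δ * ‖u r‖ ^ 2) (volume.restrict (Ioi s)) := by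
    refine ⟨(hu.norm.pow 2).const_mul δ, ?_⟩
    rw [hasFiniteIntegral_iff_ofReal (ae_of_all _ fun r => by positivity)]
    refine lt_of_le_of_lt (setLIntegral_mono_ae' measurableSet_Ioi
      (ae_of_all _ fun r hr => ?_)) hJ
    exact ENNReal.ofReal_le_ofReal (h.coercive_runningCost (hs.trans (le_of_lt hr)))
  refine (hi.const_mul δ⁻¹).congr (ae_of_all _ fun r => ?_)
  simp only
  field_simp

theorem ofReal_finiteHorizonCost (h : IsRegulator Y B W R b w ρ δ) (hs : 0 ≤ s) (hsT : s ≤ T)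
    (hu : MemLp u 2 (volume.restrict (Ioc s T))) (x : H) :
    ENNReal.ofReal (finiteHorizonCost Y B W R s x u T)
      = ∫⁻ r in Ioc s T, ENNReal.ofReal (runningCost W R r (mildState Y B s x u r) (u r)) := by
  rw [finiteHorizonCost, intervalIntegral.integral_of_le hsT, ofReal_integral_eq_lintegral_ofReal
    (h.intervalIntegrable_cost hs hsT hu x).1]
  filter_upwards [ae_restrict_mem measurableSet_Ioc] with r hr
  exact h.runningCost_nonneg (hs.trans hr.1.le)

theorem ofReal_finiteHorizonCost_le (h : IsRegulator Y B W R b w ρ δ) (hs : 0 ≤ s) (hsT : s ≤ T)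
    (hu : MemLp u 2 (volume.restrict (Ioc s T))) (x : H) :
    ENNReal.ofReal (finiteHorizonCost Y B W R s x u T) ≤ infiniteHorizonCost Y B W R s x u := by
  rw [h.ofReal_finiteHorizonCost hs hsT hu x]
  exact lintegral_mono_set Ioc_subset_Ioi_self

/-- Exhaust `(s, ∞)` by the intervals `(s, s + n]`. -/
theorem infiniteHorizonCost_le (h : IsRegulator Y B W R b w ρ δ) (hs : 0 ≤ s)
    (hu : MemLp u 2 (volume.restrict (Ioi s))) {j : ℝ}
    (hj : ∀ T, s ≤ T → finiteHorizonCost Y B W R s x u T ≤ j) :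
    infiniteHorizonCost Y B W R s x u ≤ ENNReal.ofReal j := by
  have hdir : Directed (· ⊆ ·) fun n : ℕ => Ioc s (s + n) :=
    Monotone.directed_le fun n m hnm => Ioc_subset_Ioc_right (by
      have : (n : ℝ) ≤ m := by exact_mod_cast hnm
      linarith)
  rw [infiniteHorizonCost, ← iUnion_Ioc_add_natCast s, setLIntegral_iUnion_of_directed _ hdir]
  refine iSup_le fun n => ?_
  have hn : s ≤ s + n := by simp
  refine le_trans (le_of_eq ?_) (ENNReal.ofReal_le_ofReal (hj (s + n) hn))
  exact (h.ofReal_finiteHorizonCost hs hn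
    (hu.mono_measure (Measure.restrict_mono Ioc_subset_Ioi_self le_rfl)) x).symm

/-- The infimum of the running cost on `[s, T]`. -/
noncomputable def _root_.finiteHorizonValue (Y : ℝ → ℝ → H →L[ℝ] H) (B : ℝ → XB →L[ℝ] H)
    (W : ℝ → H →L[ℝ] H) (R : ℝ → XB →L[ℝ] XB) (s : ℝ) (x : H) (T : ℝ) : ℝ :=
  sInf ((fun u => finiteHorizonCost Y B W R s x u T) ''
    {u : ℝ → XB | MemLp u 2 (volume.restrict (Ioc s T))})

theorem finiteHorizonValue_le (h : IsRegulator Y B W R b w ρ δ) (hs : 0 ≤ s) (hsT : s ≤ T)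
    (hu : MemLp u 2 (volume.restrict (Ioc s T))) (x : H) :
    finiteHorizonValue Y B W R s x T ≤ finiteHorizonCost Y B W R s x u T :=
  csInf_le ⟨0, by rintro _ ⟨u, -, rfl⟩; exact h.finiteHorizonCost_nonneg hs hsT⟩ ⟨u, hu, rfl⟩

theorem le_finiteHorizonValue {c : ℝ}
    (hc : ∀ u : ℝ → XB, MemLp u 2 (volume.restrict (Ioc s T)) →
      c ≤ finiteHorizonCost Y B W R s x u T) : c ≤ finiteHorizonValue Y B W R s x T := by
  refine le_csInf ⟨_, 0, MemLp.zero', rfl⟩ ?_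
  rintro _ ⟨u, hu, rfl⟩
  exact hc u hu

theorem exists_finiteHorizonCost_lt {ε : ℝ} (hε : 0 < ε) (s T : ℝ) (x : H) :
    ∃ u : ℝ → XB, MemLp u 2 (volume.restrict (Ioc s T)) ∧
      finiteHorizonCost Y B W R s x u T < finiteHorizonValue Y B W R s x T + ε := by
  by_contra! hcon
  have := le_finiteHorizonValue (Y := Y) (B := B) (W := W) (R := R) (s := s) (T := T) (x := x)
    fun u hu => hcon u hu
  linarith

/-- Uniform convexity: in the parallelogram identity the midpoint control costs at least the value,
and coercivity bounds the cost of the difference from below. -/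
theorem sq_integral_sub_le (h : IsRegulator Y B W R b w ρ δ) (hs : 0 ≤ s) (hsT : s ≤ T)
    (hu : MemLp u 2 (volume.restrict (Ioc s T))) (hu' : MemLp u' 2 (volume.restrict (Ioc s T)))
    (x : H) :
    δ * ∫ r in s..T, ‖u r - u' r‖ ^ 2 ≤ 2 * finiteHorizonCost Y B W R s x u T
      + 2 * finiteHorizonCost Y B W R s x u' T - 4 * finiteHorizonValue Y B W R s x T := by
  have h1 := h.finiteHorizonCost_parallelogram (x := x) (x' := x) hs hsT hu hu'
  have h2 := h.coercive_finiteHorizonCost hs hsT (hu.sub hu') (x - x)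
  have hm : MemLp (fun r => (1 / 2 : ℝ) • (u r + u' r)) 2 (volume.restrict (Ioc s T)) :=
    (hu.add hu').const_smul (1 / 2 : ℝ)
  have h3 := h.finiteHorizonValue_le hs hsT hm x
  have h4 := finiteHorizonCost_smul (Y := Y) (B := B) (W := W) (R := R) (s := s) (T := T)
    (x := x + x) (u := fun r => u r + u' r) (1 / 2 : ℝ)
  have h5 : (1 / 2 : ℝ) • (x + x) = x := by rw [← two_smul ℝ x, smul_smul]; norm_num
  rw [h5] at h4
  have h6 : δ * ∫ r in s..T, ‖u r - u' r‖ ^ 2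
      ≤ finiteHorizonCost Y B W R s (x - x) (fun r => u r - u' r) T := h2
  rw [h4] at h3
  linarith

variable [CompleteSpace H]

theorem finiteHorizonValue_mono (h : IsRegulator Y B W R b w ρ δ) (hs : 0 ≤ s) (hst : s ≤ t)
    (htT : t ≤ T) (x : H) :
    finiteHorizonValue Y B W R s x t ≤ finiteHorizonValue Y B W R s x T :=
  le_finiteHorizonValue fun _ hu =>
    (h.finiteHorizonValue_le hs hst (hu.mono_Ioc le_rfl htT) x).trans
      (h.finiteHorizonCost_mono hs hst htT hu x)

theorem sq_integral_tail_le (h : IsRegulator Y B W R b w ρ δ) (hs : 0 ≤ s) (hst : s ≤ t)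
    (htT : t ≤ T) (hu : MemLp u 2 (volume.restrict (Ioc s T))) (x : H) :
    δ * ∫ r in t..T, ‖u r‖ ^ 2
      ≤ finiteHorizonCost Y B W R s x u T - finiteHorizonCost Y B W R s x u t := by
  rw [h.finiteHorizonCost_restart hs hst htT hu x, add_sub_cancel_left]
  exact h.coercive_finiteHorizonCost (hs.trans hst) htT (hu.mono_Ioc hst le_rfl) _

theorem exists_tendsto_finiteHorizonValue (h : IsRegulator Y B W R b w ρ δ) (hs : 0 ≤ s)
    {j : ℝ} (hj : ∀ T, s ≤ T → finiteHorizonValue Y B W R s x T ≤ j) :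
    ∃ v, 0 ≤ v ∧ Tendsto (finiteHorizonValue Y B W R s x) atTop (𝓝 v) ∧
      ∀ T, s ≤ T → finiteHorizonValue Y B W R s x T ≤ v := by
  set m : ℝ → ℝ := fun T => finiteHorizonValue Y B W R s x (max s T) with hm
  have hmono : Monotone m := fun t T htT =>
    h.finiteHorizonValue_mono hs (le_max_left _ _) (max_le_max le_rfl htT) x
  have hbdd : BddAbove (range m) := ⟨j, by rintro _ ⟨T, rfl⟩; exact hj _ (le_max_left _ _)⟩
  have hlim := tendsto_atTop_ciSup hmono hbdd
  have hle : ∀ T, s ≤ T → finiteHorizonValue Y B W R s x T ≤ ⨆ T, m T := fun T hT => by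
    have := le_ciSup hbdd T
    simpa only [hm, max_eq_right hT] using this
  refine ⟨⨆ T, m T, ?_, hlim.congr' ?_, hle⟩
  · exact (le_finiteHorizonValue fun u _ => h.finiteHorizonCost_nonneg hs le_rfl).trans
      (hle s le_rfl)
  · filter_upwards [eventually_ge_atTop s] with T hT
    simp only [hm, max_eq_right hT]

/-- On `[s, t]` convexity contributes `2(v - value) + 4ε`, since the longer control `u'` costs at
most `v + ε` there. On `[t, T]` only `u'` survives, and its tail costs at most `v - value + ε`. -/
theorem cauchy_bound (h : IsRegulator Y B W R b w ρ δ) (hs : 0 ≤ s) {v : ℝ}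
    (hv : ∀ T, s ≤ T → finiteHorizonValue Y B W R s x T ≤ v) (hst : s ≤ t) (htT : t ≤ T)
    {ε : ℝ} (hu : MemLp u 2 (volume.restrict (Ioc s t)))
    (hu' : MemLp u' 2 (volume.restrict (Ioc s T)))
    (hJ : finiteHorizonCost Y B W R s x u t ≤ finiteHorizonValue Y B W R s x t + ε)
    (hJ' : finiteHorizonCost Y B W R s x u' T ≤ finiteHorizonValue Y B W R s x T + ε) :
    δ * ∫ r in Ioi s, ‖(Iic t).indicator u r - (Iic T).indicator u' r‖ ^ 2
      ≤ 3 * (v - finiteHorizonValue Y B W R s x t) + 5 * ε := by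
  have hu't := hu'.mono_Ioc le_rfl htT
  have h1 := h.sq_integral_sub_le hs hst hu hu't x
  have h2 := h.sq_integral_tail_le hs hst htT hu' x
  have h3 := h.finiteHorizonCost_mono hs hst htT hu' x
  have h4 := hv T (hst.trans htT)
  have h5 := h.finiteHorizonValue_le hs hst hu't x
  set f : ℝ → ℝ := fun r => ‖(Iic t).indicator u r - (Iic T).indicator u' r‖ ^ 2 with hf
  have e1 : EqOn (fun r => ‖u r - u' r‖ ^ 2) f (Ioc s t) := by
    intro r hr
    simp only [hf]
    rw [indicator_of_mem (mem_Iic.2 hr.2), indicator_of_mem (mem_Iic.2 (hr.2.trans htT))]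
  have e2 : EqOn (fun r => ‖u' r‖ ^ 2) f (Ioc t T) := by
    intro r hr
    simp only [hf]
    rw [indicator_of_notMem (notMem_Iic.2 hr.1), indicator_of_mem (mem_Iic.2 hr.2), zero_sub,
      norm_neg]
  have i1 : IntegrableOn f (Ioc s t) :=
    ((hu.sub hu't).norm.integrable_sq).congr (by
      filter_upwards [ae_restrict_mem measurableSet_Ioc] with r hr using e1 hr)
  have i2 : IntegrableOn f (Ioc t T) :=
    ((hu'.mono_Ioc hst le_rfl).norm.integrable_sq).congr (by
      filter_upwards [ae_restrict_mem measurableSet_Ioc] with r hr using e2 hr)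
  have e3 : ∫ r in Ioi s, f r = (∫ r in s..t, ‖u r - u' r‖ ^ 2) + ∫ r in t..T, ‖u' r‖ ^ 2 := by
    rw [intervalIntegral.integral_of_le hst, intervalIntegral.integral_of_le htT,
      setIntegral_congr_fun measurableSet_Ioc e1, setIntegral_congr_fun measurableSet_Ioc e2,
      ← setIntegral_union (Ioc_disjoint_Ioc_of_le le_rfl) measurableSet_Ioc i1 i2,
      Ioc_union_Ioc_eq_Ioc hst htT]
    refine (setIntegral_eq_of_subset_of_forall_sdiff_eq_zero measurableSet_Ioi
      Ioc_subset_Ioi_self ?_)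
    rintro r ⟨hr1, hr2⟩
    have hr3 : T < r := by
      by_contra! hc
      exact hr2 ⟨hr1, hc⟩
    simp only [hf]
    rw [indicator_of_notMem (notMem_Iic.2 (htT.trans_lt hr3)),
      indicator_of_notMem (notMem_Iic.2 hr3)]
    simp
  rw [e3, mul_add]
  linarith

variable [CompleteSpace XB]

/-- Existence of an optimal control on an infinite horizon. -/
theorem exists_optimal_control (h : IsRegulator Y B W R b w ρ δ) (hs : 0 ≤ s)
    (hfin : ∃ u : ℝ → XB, AEStronglyMeasurable u (volume.restrict (Ioi s)) ∧
      infiniteHorizonCost Y B W R s x u < ⊤) :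
    ∃ (u : ℝ → XB) (v : ℝ), 0 ≤ v ∧ MemLp u 2 (volume.restrict (Ioi s)) ∧
      (∀ T, s ≤ T → finiteHorizonCost Y B W R s x u T ≤ v) ∧
      Tendsto (finiteHorizonValue Y B W R s x) atTop (𝓝 v) ∧
      optimalCost Y B W R s x = ENNReal.ofReal v := by
  have hδ := h.pos
  have hres : ∀ {u : ℝ → XB}, MemLp u 2 (volume.restrict (Ioi s)) → ∀ T,
      MemLp u 2 (volume.restrict (Ioc s T)) := fun hu T =>
    hu.mono_measure (Measure.restrict_mono Ioc_subset_Ioi_self le_rfl)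
  have hlow : ∀ u : ℝ → XB, AEStronglyMeasurable u (volume.restrict (Ioi s)) →
      infiniteHorizonCost Y B W R s x u < ⊤ → ∀ T, s ≤ T →
      finiteHorizonValue Y B W R s x T ≤ (infiniteHorizonCost Y B W R s x u).toReal := by
    intro u hu hJ T hT
    have hu2 := h.memLp_of_infiniteHorizonCost_lt_top hs hu hJ
    refine (h.finiteHorizonValue_le hs hT (hres hu2 T) x).trans ?_
    exact (ENNReal.ofReal_le_iff_le_toReal hJ.ne).1
      (h.ofReal_finiteHorizonCost_le hs hT (hres hu2 T) x)
  obtain ⟨u₀, hu₀, hJ₀⟩ := hfin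
  obtain ⟨v, hv0, hlim, hv⟩ := h.exists_tendsto_finiteHorizonValue hs (hlow u₀ hu₀ hJ₀)
  have hτ : ∀ n : ℕ, s ≤ s + n := fun n => by simp
  have hτmono : ∀ {n k : ℕ}, n ≤ k → s + (n : ℝ) ≤ s + k := fun {n k} hnk => by
    have : (n : ℝ) ≤ k := by exact_mod_cast hnk
    linarith
  have hε : ∀ n : ℕ, (0 : ℝ) < 1 / ((n : ℝ) + 1) := fun n => by positivity
  -- Approximate minimisers on `[s, s + n]` suffice; existence of exact ones is not needed.
  choose uu huu hJuu using fun n : ℕ => exists_finiteHorizonCost_lt (Y := Y) (B := B) (W := W)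
    (R := R) (hε n) s (s + n) x
  set a : ℕ → ℝ → XB := fun n => (Iic (s + (n : ℝ))).indicator (uu n) with ha
  have haL : ∀ n, MemLp (a n) 2 (volume.restrict (Ioi s)) := fun n => by
    rw [ha, memLp_indicator_iff_restrict measurableSet_Iic,
      Measure.restrict_restrict measurableSet_Iic, inter_comm, Ioi_inter_Iic]
    exact huu n
  set e : ℕ → ℝ := fun n => δ⁻¹ * (3 * (v - finiteHorizonValue Y B W R s x (s + n))
    + 5 * (1 / ((n : ℝ) + 1))) with he
  have helim : Tendsto e atTop (𝓝 0) := by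
    have h1 : Tendsto (fun n : ℕ => finiteHorizonValue Y B W R s x (s + n)) atTop (𝓝 v) :=
      hlim.comp (tendsto_atTop_add_const_left _ _ tendsto_natCast_atTop_atTop)
    have h2 := (((h1.const_sub v).const_mul 3).add
      (tendsto_one_div_add_atTop_nhds_zero_nat.const_mul 5)).const_mul δ⁻¹
    simpa [he] using h2
  have hdist : ∀ n k, n ≤ k → ∫ r in Ioi s, ‖a n r - a k r‖ ^ 2 ≤ e n := by
    intro n k hnk
    have hk : 1 / ((k : ℝ) + 1) ≤ 1 / ((n : ℝ) + 1) := by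
      have : (n : ℝ) ≤ k := by exact_mod_cast hnk
      gcongr
    have := h.cauchy_bound hs hv (hτ n) (hτmono hnk) (ε := 1 / ((n : ℝ) + 1)) (huu n) (huu k)
      (hJuu n).le ((hJuu k).le.trans (by linarith))
    change _ ≤ δ⁻¹ * _
    rw [← div_eq_inv_mul, le_div_iff₀' hδ]
    exact this
  set A : ℕ → Lp XB 2 (volume.restrict (Ioi s)) := fun n => (haL n).toLp (a n) with hA
  have hnorm : ∀ n k, n ≤ k → dist (A n) (A k) ≤ √(e n) := by
    intro n k hnk
    rw [dist_eq_norm, hA, ← MemLp.toLp_sub, Lp.norm_toLp, ((haL n).sub (haL k)).eLpNorm_two_eq,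
      ENNReal.toReal_ofReal (Real.sqrt_nonneg _)]
    exact Real.sqrt_le_sqrt (hdist n k hnk)
  have hcau : CauchySeq A := cauchySeq_of_le_tendsto_0' (fun n => √(e n)) hnorm
    (by simpa using helim.sqrt)
  obtain ⟨U, hU⟩ := cauchySeq_tendsto_of_complete hcau
  have hUL : MemLp U 2 (volume.restrict (Ioi s)) := Lp.memLp U
  have hUn : Tendsto (fun n => ∫ r in Ioi s, ‖U r - a n r‖ ^ 2) atTop (𝓝 0) := by
    have h1 : ∀ n, ∫ r in Ioi s, ‖U r - a n r‖ ^ 2 = ‖U - A n‖ ^ 2 := by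
      intro n
      have h2 : U - A n = (hUL.sub (haL n)).toLp _ := by
        rw [MemLp.toLp_sub hUL (haL n), Lp.toLp_coeFn]
      rw [h2, Lp.norm_toLp, (hUL.sub (haL n)).eLpNorm_two_eq,
        ENNReal.toReal_ofReal (Real.sqrt_nonneg _),
        Real.sq_sqrt (integral_nonneg fun r => sq_nonneg _)]
      rfl
    have h3 : Tendsto (fun n => ‖U - A n‖ ^ 2) atTop (𝓝 (‖U - U‖ ^ 2)) :=
      ((hU.const_sub U).norm).pow 2
    simp only [h1]
    simpa using h3
  have hcost : ∀ T, s ≤ T → finiteHorizonCost Y B W R s x U T ≤ v := by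
    intro T hT
    obtain ⟨K, hK0, hK⟩ := h.exists_finiteHorizonCost_zero_le T
    -- Write `U = a n + (U - a n)`: for fixed `θ` the remainder disappears as `n → ∞`, and only then
    -- does `θ` tend to 0.
    have hθ : ∀ θ : ℝ, 0 < θ → finiteHorizonCost Y B W R s x U T ≤ (1 + θ) * v := by
      intro θ hθ
      have hb : ∀ᶠ n : ℕ in atTop, finiteHorizonCost Y B W R s x U T
          ≤ (1 + θ) * (v + 1 / ((n : ℝ) + 1))
            + (1 + θ⁻¹) * (K * ∫ r in Ioi s, ‖U r - a n r‖ ^ 2) := by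
        obtain ⟨n₀, hn₀⟩ := exists_nat_ge (T - s)
        filter_upwards [eventually_ge_atTop n₀] with n hn
        have hTn : T ≤ s + n := by linarith [hτmono hn]
        have hd : MemLp (fun r => U r - a n r) 2 (volume.restrict (Ioc s T)) :=
          (hres hUL T).sub (hres (haL n) T)
        have h1 := h.finiteHorizonCost_add_le (x := x) (x' := 0) hs hT (hres (haL n) T) hd hθ
        simp only [add_zero, add_sub_cancel] at h1
        have h2 : finiteHorizonCost Y B W R s x (a n) T ≤ v + 1 / ((n : ℝ) + 1) := by
          have e1 : finiteHorizonCost Y B W R s x (a n) T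
              = finiteHorizonCost Y B W R s x (uu n) T := by
            refine finiteHorizonCost_congr hT ?_
            filter_upwards [ae_restrict_mem measurableSet_Ioc] with r hr
            exact indicator_of_mem (mem_Iic.2 (hr.2.trans hTn)) _
          rw [e1]
          refine (h.finiteHorizonCost_mono hs hT hTn (huu n) x).trans ((hJuu n).le.trans ?_)
          linarith [hv _ (hτ n)]
        have h3 : finiteHorizonCost Y B W R s 0 (fun r => U r - a n r) T
            ≤ K * ∫ r in Ioi s, ‖U r - a n r‖ ^ 2 := by
          refine (hK s T hs hT le_rfl _ hd).trans ?_
          gcongr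
          rw [intervalIntegral.integral_of_le hT]
          exact setIntegral_mono_set (hUL.sub (haL n)).norm.integrable_sq
            (ae_of_all _ fun r => sq_nonneg _) (ae_of_all _ fun r hr => hr.1)
        refine h1.trans ?_
        gcongr
      have hl : Tendsto (fun n : ℕ => (1 + θ) * (v + 1 / ((n : ℝ) + 1))
            + (1 + θ⁻¹) * (K * ∫ r in Ioi s, ‖U r - a n r‖ ^ 2)) atTop
          (𝓝 ((1 + θ) * (v + 0) + (1 + θ⁻¹) * (K * 0))) :=
        ((tendsto_one_div_add_atTop_nhds_zero_nat.const_add v).const_mul _).add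
          ((hUn.const_mul K).const_mul _)
      have := ge_of_tendsto hl hb
      simpa using this
    refine le_of_forall_pos_le_add fun ε hε => ?_
    -- The denominator is `v + 1` because `v` may vanish.
    have := hθ (ε / (v + 1)) (by positivity)
    refine this.trans ?_
    have : ε / (v + 1) * v ≤ ε := by
      rw [div_mul_eq_mul_div, div_le_iff₀ (by positivity)]
      nlinarith
    linarith
  refine ⟨U, v, hv0, hUL, hcost, hlim, le_antisymm ?_ ?_⟩
  · exact (iInf₂_le (U : ℝ → XB) hUL.1).trans (h.infiniteHorizonCost_le hs hUL hcost)
  · refine le_iInf₂ fun u hu => ?_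
    rcases eq_or_ne (infiniteHorizonCost Y B W R s x u) ⊤ with htop | htop
    · rw [htop]; exact le_top
    · rw [ENNReal.ofReal_le_iff_le_toReal htop]
      refine le_of_tendsto hlim ?_
      filter_upwards [eventually_ge_atTop s] with T hT
      exact hlow u hu (lt_top_iff_ne_top.2 htop) T hT

end IsRegulator

namespace IsDetectableRegulator

variable {Y : ℝ → ℝ → H →L[ℝ] H} {B : ℝ → XB →L[ℝ] H} {W : ℝ → H →L[ℝ] H}
  {R : ℝ → XB →L[ℝ] XB} {b w ρ δ κ α : ℝ} {s t T : ℝ} {x : H} {u : ℝ → XB}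

theorem norm_sq_mildState_le (h : IsDetectableRegulator Y B W R b w ρ δ κ α) (hs : 0 ≤ s)
    (hst : s ≤ t) (hu : MemLp u 2 (volume.restrict (Ioc s t))) :
    ‖mildState Y B s x u t‖ ^ 2 ≤ κ * (‖x‖ ^ 2 + finiteHorizonCost Y B W R s x u t) := by
  have hκ := h.κ_nonneg
  have hα := h.α_pos
  have h1 : Real.exp (-α * (t - s)) ≤ 1 := Real.exp_le_one_iff.2 (by nlinarith)
  calc ‖mildState Y B s x u t‖ ^ 2
      ≤ κ * Real.exp (-α * (t - s)) * ‖x‖ ^ 2 + κ * finiteHorizonCost Y B W R s x u t :=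
        h.decay s t x u hs hst hu
    _ ≤ κ * 1 * ‖x‖ ^ 2 + κ * finiteHorizonCost Y B W R s x u t := by gcongr
    _ = _ := by ring

/-- States of finite cost decay to zero. -/
theorem tendsto_mildState_zero [CompleteSpace H] (h : IsDetectableRegulator Y B W R b w ρ δ κ α)
    (hs : 0 ≤ s) (hu : MemLp u 2 (volume.restrict (Ioi s))) {v : ℝ}
    (hv : ∀ T, s ≤ T → finiteHorizonCost Y B W R s x u T ≤ v) :
    Tendsto (fun t => ‖mildState Y B s x u t‖ ^ 2) atTop (𝓝 0) := by
  have hκ := h.κ_nonneg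
  have hα := h.α_pos
  have hres : ∀ T, MemLp u 2 (volume.restrict (Ioc s T)) := fun T =>
    hu.mono_measure (Measure.restrict_mono Ioc_subset_Ioi_self le_rfl)
  set J : ℝ → ℝ := fun T => finiteHorizonCost Y B W R s x u (max s T) with hJ
  have hmono : Monotone J := fun t T htT =>
    h.finiteHorizonCost_mono hs (le_max_left _ _) (max_le_max le_rfl htT) (hres _) x
  have hbdd : BddAbove (range J) := ⟨v, by rintro _ ⟨T, rfl⟩; exact hv _ (le_max_left _ _)⟩
  have hlim := tendsto_atTop_ciSup hmono hbdd
  rw [Metric.tendsto_atTop]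
  intro ε hε
  -- Choose `τ` so late that the remaining cost is at most `ε / (2(κ+1))`, then apply the decay
  -- estimate restarted at `τ`: the cost term is at most `ε/2` and the initial term decays
  -- exponentially.
  obtain ⟨τ, hτ⟩ := (((hlim.eventually_const_lt (show (⨆ T, J T) - ε / (2 * (κ + 1)) < ⨆ T, J T by
    have : 0 < ε / (2 * (κ + 1)) := by positivity
    linarith)).and (eventually_ge_atTop s)).exists)
  obtain ⟨hτ1, hτ2⟩ := hτ
  have hexp : Tendsto (fun t => κ * Real.exp (-α * (t - τ)) * ‖mildState Y B s x u τ‖ ^ 2) atTop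
      (𝓝 (κ * 0 * ‖mildState Y B s x u τ‖ ^ 2)) := by
    refine ((Real.tendsto_exp_atBot.comp ?_).const_mul κ).mul_const _
    exact (tendsto_atTop_add_const_right _ (-τ) tendsto_id).const_mul_atTop_of_neg (by linarith)
  rw [mul_zero, zero_mul] at hexp
  obtain ⟨N, hN⟩ := eventually_atTop.1
    ((hexp.eventually_lt_const (half_pos hε)).and (eventually_ge_atTop τ))
  refine ⟨N, fun t ht => ?_⟩
  obtain ⟨h1, h2⟩ := hN t ht
  have hst : s ≤ t := hτ2.trans h2
  have h3 := h.decay τ t (mildState Y B s x u τ) u (hs.trans hτ2) h2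
    ((hres t).mono_Ioc hτ2 le_rfl)
  rw [← h.mildState_restart hs hτ2 h2 (hres t)] at h3
  have h4 := h.finiteHorizonCost_restart hs hτ2 h2 (hres t) x
  have h5 : finiteHorizonCost Y B W R s x u t ≤ ⨆ T, J T := by
    have := le_ciSup hbdd t
    simpa only [hJ, max_eq_right hst] using this
  have h6 : (⨆ T, J T) - ε / (2 * (κ + 1)) < finiteHorizonCost Y B W R s x u τ := by
    simpa only [hJ, max_eq_right hτ2] using hτ1
  have h7 : finiteHorizonCost Y B W R τ (mildState Y B s x u τ) u t ≤ ε / (2 * (κ + 1)) := by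
    linarith
  have h8 : κ * finiteHorizonCost Y B W R τ (mildState Y B s x u τ) u t ≤ ε / 2 := by
    calc _ ≤ κ * (ε / (2 * (κ + 1))) := by gcongr
      _ ≤ (κ + 1) * (ε / (2 * (κ + 1))) := by gcongr; linarith
      _ = ε / 2 := by field_simp
  rw [Real.dist_eq, sub_zero, abs_of_nonneg (sq_nonneg _)]
  linarith

end IsDetectableRegulator

end InfiniteHorizon

/-! ### Comparison of finite-horizon feedbacks with the infinite-horizon optimum -/

section Convergence

open Filter Topology

variable {H XB : Type*}
  [NormedAddCommGroup H] [InnerProductSpace ℝ H]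
  [NormedAddCommGroup XB] [InnerProductSpace ℝ XB]

/-- `u` is an optimal control on `[s, ∞)` from the state `x`, with cost `v`, and `v` is the limit
of the optimal running costs on finite horizons. -/
structure IsOptimalControl (Y : ℝ → ℝ → H →L[ℝ] H) (B : ℝ → XB →L[ℝ] H) (W : ℝ → H →L[ℝ] H)
    (R : ℝ → XB →L[ℝ] XB) (s : ℝ) (x : H) (u : ℝ → XB) (v : ℝ) : Prop where
  nonneg : 0 ≤ v
  memLp : MemLp u 2 (volume.restrict (Ioi s))
  cost_le : ∀ T, s ≤ T → finiteHorizonCost Y B W R s x u T ≤ v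
  tendsto : Tendsto (finiteHorizonValue Y B W R s x) atTop (𝓝 v)
  optimal : optimalCost Y B W R s x = ENNReal.ofReal v

variable {Y : ℝ → ℝ → H →L[ℝ] H} {B : ℝ → XB →L[ℝ] H} {W : ℝ → H →L[ℝ] H}
  {R : ℝ → XB →L[ℝ] XB} {b w ρ δ κ α : ℝ} {s t T v : ℝ} {x : H} {u : ℝ → XB}
  {P₀ : H →L[ℝ] H}

theorem inner_le_norm_mul_sq (A : H →L[ℝ] H) (z : H) : ⟪A z, z⟫_ℝ ≤ ‖A‖ * ‖z‖ ^ 2 := by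
  calc ⟪A z, z⟫_ℝ ≤ ‖A z‖ * ‖z‖ := real_inner_le_norm _ _
    _ ≤ ‖A‖ * ‖z‖ * ‖z‖ := by gcongr; exact A.le_opNorm z
    _ = ‖A‖ * ‖z‖ ^ 2 := by ring

theorem tendsto_inner_of_forms {Q : H →L[ℝ] H} (hQ : Q.IsPositive) {A : ℕ → H →L[ℝ] H}
    (hA : ∀ n, (A n).IsPositive)
    (hAQ : ∀ x, Tendsto (fun n => ⟪A n x, x⟫_ℝ) atTop (𝓝 ⟪Q x, x⟫_ℝ)) (x y : H) :
    Tendsto (fun n => ⟪A n x, y⟫_ℝ) atTop (𝓝 ⟪Q x, y⟫_ℝ) := by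
  have h1 := inner_tendsto_of_inner_self_tendsto (Eventually.of_forall hA) hAQ x y
  have h2 := inner_tendsto_of_inner_self_tendsto (l := (atTop : Filter ℕ)) (A := fun _ => Q)
    (Eventually.of_forall fun _ => hQ) (v := fun x => ⟪Q x, x⟫_ℝ)
    (fun x => tendsto_const_nhds) x y
  rwa [tendsto_nhds_unique h2 tendsto_const_nhds] at h1

namespace IsOptimalControl

theorem memLp_Ioc (ho : IsOptimalControl Y B W R s x u v) (T : ℝ) :
    MemLp u 2 (volume.restrict (Ioc s T)) :=
  ho.memLp.mono_measure (Measure.restrict_mono Ioc_subset_Ioi_self le_rfl)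

theorem eq_inner (ho : IsOptimalControl Y B W R s x u v)
    {Q : H →L[ℝ] H} (hQ : Q.IsPositive)
    (hQo : ENNReal.ofReal ⟪Q x, x⟫_ℝ = optimalCost Y B W R s x) : v = ⟪Q x, x⟫_ℝ := by
  rw [ho.optimal, ENNReal.ofReal_eq_ofReal_iff (hQ.inner_nonneg_left x) ho.nonneg] at hQo
  exact hQo.symm

/-- An upper bound for the suboptimality of `u` on `[s, T]` with terminal weight `P₀`. -/
noncomputable def _root_.optimalityGap (Y : ℝ → ℝ → H →L[ℝ] H) (B : ℝ → XB →L[ℝ] H)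
    (W : ℝ → H →L[ℝ] H) (R : ℝ → XB →L[ℝ] XB) (P₀ : H →L[ℝ] H) (s : ℝ) (x : H) (u : ℝ → XB)
    (v T : ℝ) : ℝ :=
  v + ‖P₀‖ * ‖mildState Y B s x u T‖ ^ 2 - finiteHorizonValue Y B W R s x T

variable [CompleteSpace H]

theorem tendsto_norm_sq (h : IsDetectableRegulator Y B W R b w ρ δ κ α) (hs : 0 ≤ s)
    (ho : IsOptimalControl Y B W R s x u v) :
    Tendsto (fun T => v + ‖P₀‖ * ‖mildState Y B s x u T‖ ^ 2) atTop (𝓝 v) := by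
  simpa using ((h.tendsto_mildState_zero hs ho.memLp ho.cost_le).const_mul ‖P₀‖).const_add v

theorem tendsto_optimalityGap (h : IsDetectableRegulator Y B W R b w ρ δ κ α) (hs : 0 ≤ s)
    (ho : IsOptimalControl Y B W R s x u v) :
    Tendsto (optimalityGap Y B W R P₀ s x u v) atTop (𝓝 0) := by
  have := (ho.tendsto_norm_sq h hs (P₀ := P₀)).sub ho.tendsto
  rwa [sub_self] at this

variable [CompleteSpace XB]

section FiniteHorizonComparison

variable {P : ℝ → H →L[ℝ] H} {Z : ℝ → ℝ → H →L[ℝ] H}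

theorem value_le_inner (h : IsRegulator Y B W R b w ρ δ) (hP₀ : P₀.IsPositive)
    (hF : IsFiniteHorizonRiccati Y B W R P₀ T P Z) (hs : 0 ≤ s) (hsT : s ≤ T) (x : H) :
    finiteHorizonValue Y B W R s x T ≤ ⟪P s x, x⟫_ℝ := by
  have h1 := h.inner_riccati_self hP₀ hF hs hsT x
  have h2 := h.finiteHorizonValue_le hs hsT (h.memLp_feedbackControl hF hs hsT x) x
  have h3 := hP₀.inner_nonneg_left (Z T s x)
  linarith

/-- The infinite-horizon optimal control is an admissible competitor; it pays at most `v` for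
running and the terminal weight at `z(T)`. -/
theorem inner_le (h : IsRegulator Y B W R b w ρ δ) (hP₀ : P₀.IsPositive)
    (hF : IsFiniteHorizonRiccati Y B W R P₀ T P Z) (hs : 0 ≤ s) (hsT : s ≤ T)
    (ho : IsOptimalControl Y B W R s x u v) :
    ⟪P s x, x⟫_ℝ ≤ v + ‖P₀‖ * ‖mildState Y B s x u T‖ ^ 2 := by
  have h1 := h.total_cost_eq hP₀ hF hs hsT x (ho.memLp_Ioc T)
  have h2 := ho.cost_le T hsT
  have h3 := inner_le_norm_mul_sq P₀ (mildState Y B s x u T)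
  have h4 := hP₀.inner_nonneg_left (mildState Y B s x u T - Z T s x)
  have h5 := h.finiteHorizonCost_nonneg (x := 0)
    (u := fun r => u r - feedbackControl B R P Z s x r) hs hsT
  linarith

/-- The completed square is the excess of the competitor's total cost over `⟪P s x, x⟫`. Bounding
`⟪P s x, x⟫` below by the value without terminal weight yields the gap. -/
theorem cost_sub_le (h : IsRegulator Y B W R b w ρ δ) (hP₀ : P₀.IsPositive)
    (hF : IsFiniteHorizonRiccati Y B W R P₀ T P Z) (hs : 0 ≤ s) (hsT : s ≤ T)
    (ho : IsOptimalControl Y B W R s x u v) :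
    finiteHorizonCost Y B W R s 0 (fun r => u r - feedbackControl B R P Z s x r) T
      ≤ optimalityGap Y B W R P₀ s x u v T := by
  have h1 := h.total_cost_eq hP₀ hF hs hsT x (ho.memLp_Ioc T)
  have h2 := ho.cost_le T hsT
  have h3 := inner_le_norm_mul_sq P₀ (mildState Y B s x u T)
  have h4 := hP₀.inner_nonneg_left (mildState Y B s x u T - Z T s x)
  have h5 := value_le_inner h hP₀ hF hs hsT x
  rw [optimalityGap]
  linarith

/-- The difference of the two trajectories is a mild state from 0, so detectability bounds it by its
cost alone. The right-hand side does not involve `t`. -/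
theorem norm_sq_sub_le (h : IsDetectableRegulator Y B W R b w ρ δ κ α) (hP₀ : P₀.IsPositive)
    (hF : IsFiniteHorizonRiccati Y B W R P₀ T P Z) (hs : 0 ≤ s) (hst : s ≤ t) (htT : t ≤ T)
    (ho : IsOptimalControl Y B W R s x u v) :
    ‖mildState Y B s x u t - Z t s x‖ ^ 2 ≤ κ * optimalityGap Y B W R P₀ s x u v T := by
  have hκ := h.κ_nonneg
  have hu₀ := h.memLp_feedbackControl hF hs (hst.trans htT) x
  have hd : MemLp (fun r => u r - feedbackControl B R P Z s x r) 2 (volume.restrict (Ioc s T)) :=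
    (ho.memLp_Ioc T).sub hu₀
  have e1 := h.mildState_sub (x := x) (x' := x) hs hst (ho.memLp_Ioc t)
    (hu₀.mono_Ioc le_rfl htT)
  rw [sub_self, IsRegulator.mildState_feedbackControl hF.closedLoop hs hst htT] at e1
  have h1 := h.norm_sq_mildState_le (x := 0) hs hst (hd.mono_Ioc le_rfl htT)
  rw [e1, norm_zero] at h1
  have h2 := h.finiteHorizonCost_mono hs hst htT hd 0
  have h3 := ho.cost_sub_le h.toIsRegulator hP₀ hF hs (hst.trans htT)
  refine h1.trans ?_
  gcongr
  linarith

theorem sq_integral_sub_le (h : IsRegulator Y B W R b w ρ δ) (hP₀ : P₀.IsPositive)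
    (hF : IsFiniteHorizonRiccati Y B W R P₀ T P Z) (hs : 0 ≤ s) (hsT : s ≤ T)
    (ho : IsOptimalControl Y B W R s x u v) :
    δ * ∫ r in s..T, ‖u r - feedbackControl B R P Z s x r‖ ^ 2
      ≤ optimalityGap Y B W R P₀ s x u v T :=
  (h.coercive_finiteHorizonCost hs hsT
    ((ho.memLp_Ioc T).sub (h.memLp_feedbackControl hF hs hsT x)) 0).trans
    (ho.cost_sub_le h hP₀ hF hs hsT)

end FiniteHorizonComparison

/-! ### Families of finite-horizon problems -/

variable {P : ℝ → ℝ → H →L[ℝ] H} {Z : ℝ → ℝ → ℝ → H →L[ℝ] H}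

/-- Squeezed between the value without terminal weight and `v + ‖P₀‖ ‖z(T)‖²`, both tending to `v`.
-/
theorem tendsto_inner (h : IsDetectableRegulator Y B W R b w ρ δ κ α) (hP₀ : P₀.IsPositive)
    (hP : ∀ T, 0 < T → IsFiniteHorizonRiccati Y B W R P₀ T (P T) (Z T)) (hs : 0 ≤ s)
    (ho : IsOptimalControl Y B W R s x u v) :
    Tendsto (fun T => ⟪P T s x, x⟫_ℝ) atTop (𝓝 v) := by
  refine tendsto_of_tendsto_of_tendsto_of_le_of_le' ho.tendsto
    (ho.tendsto_norm_sq h hs (P₀ := P₀)) ?_ ?_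
  · filter_upwards [eventually_gt_atTop s] with T hT
    exact value_le_inner h.toIsRegulator hP₀ (hP T (hs.trans_lt hT)) hs hT.le x
  · filter_upwards [eventually_gt_atTop s] with T hT
    exact ho.inner_le h.toIsRegulator hP₀ (hP T (hs.trans_lt hT)) hs hT.le

theorem exists_forall_norm_sub_lt (h : IsDetectableRegulator Y B W R b w ρ δ κ α)
    (hP₀ : P₀.IsPositive)
    (hP : ∀ T, 0 < T → IsFiniteHorizonRiccati Y B W R P₀ T (P T) (Z T)) (hs : 0 ≤ s)
    (ho : IsOptimalControl Y B W R s x u v) {ε : ℝ} (hε : 0 < ε) :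
    ∃ T₀, ∀ T, T₀ ≤ T → ∀ t, s ≤ t → t ≤ T → ‖Z T t s x - mildState Y B s x u t‖ < ε := by
  have h1 := (ho.tendsto_optimalityGap h hs (P₀ := P₀)).const_mul κ
  rw [mul_zero] at h1
  obtain ⟨N, hN⟩ := eventually_atTop.1 ((h1.eventually_lt_const (pow_pos hε 2)).and
    (eventually_gt_atTop s))
  refine ⟨N, fun T hT t hst htT => ?_⟩
  obtain ⟨h2, h3⟩ := hN T hT
  have h4 := ho.norm_sq_sub_le h hP₀ (hP T (hs.trans_lt h3)) hs hst htT
  rw [norm_sub_rev]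
  exact lt_of_pow_lt_pow_left₀ 2 hε.le (h4.trans_lt h2)

theorem tendsto_closedLoop (h : IsDetectableRegulator Y B W R b w ρ δ κ α) (hP₀ : P₀.IsPositive)
    (hP : ∀ T, 0 < T → IsFiniteHorizonRiccati Y B W R P₀ T (P T) (Z T)) (hs : 0 ≤ s)
    (hst : s ≤ t) (ho : IsOptimalControl Y B W R s x u v) :
    Tendsto (fun T => Z T t s x) atTop (𝓝 (mildState Y B s x u t)) := by
  rw [Metric.tendsto_atTop]
  intro ε hε
  obtain ⟨T₀, hT₀⟩ := ho.exists_forall_norm_sub_lt h hP₀ hP hs hε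
  refine ⟨max T₀ t, fun T hT => ?_⟩
  rw [dist_eq_norm]
  exact hT₀ T ((le_max_left _ _).trans hT) t hst ((le_max_right _ _).trans hT)

/-- Finiteness of the optimal cost is only assumed pointwise. Uniform boundedness of the Riccati
operators at the single time `S` gives a quadratic bound there; from an earlier `s`, apply no
control up to `S` and continue optimally, which makes the bound uniform in `s`. -/
theorem exists_value_bound (h : IsDetectableRegulator Y B W R b w ρ δ κ α) (hP₀ : P₀.IsPositive)
    (hP : ∀ T, 0 < T → IsFiniteHorizonRiccati Y B W R P₀ T (P T) (Z T))
    (hopt : ∀ s x, 0 ≤ s → ∃ u v, IsOptimalControl Y B W R s x u v) {S : ℝ} (hS : 0 ≤ S) :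
    ∃ c, 0 ≤ c ∧ ∀ s, 0 ≤ s → s ≤ S → ∀ x u v, IsOptimalControl Y B W R s x u v →
      v ≤ c * ‖x‖ ^ 2 := by
  have hTn : ∀ n : ℕ, S < S + 1 + n := fun n => by
    have : (0 : ℝ) ≤ n := by positivity
    linarith
  have hTlim : Tendsto (fun n : ℕ => S + 1 + (n : ℝ)) atTop atTop :=
    tendsto_atTop_add_const_left _ _ tendsto_natCast_atTop_atTop
  set A : ℕ → H →L[ℝ] H := fun n => P (S + 1 + n) S with hA
  have hlim : ∀ {x u v}, IsOptimalControl Y B W R S x u v →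
      Tendsto (fun n => ⟪A n x, x⟫_ℝ) atTop (𝓝 v) := fun ho =>
    (ho.tendsto_inner h hP₀ hP hS).comp hTlim
  obtain ⟨c, hc⟩ := bounded_of_inner_self_bounded (A := A)
    (fun n => h.isPositive_riccati hP₀ (hP _ (hS.trans_lt (hTn n))) hS (hTn n).le)
    (fun x => by
      obtain ⟨u, v, ho⟩ := hopt S x hS
      obtain ⟨c, hc⟩ := (hlim ho).bddAbove_range
      exact ⟨c, fun n => hc ⟨n, rfl⟩⟩)
  have hc0 : 0 ≤ c := (norm_nonneg _).trans (hc 0)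
  have hcS : ∀ x u v, IsOptimalControl Y B W R S x u v → v ≤ c * ‖x‖ ^ 2 := fun x u v ho =>
    le_of_tendsto' (hlim ho) fun n => (inner_le_norm_mul_sq (A n) x).trans (by gcongr; exact hc n)
  obtain ⟨C, hC⟩ := h.bound S
  have hw := h.w_nonneg
  have hC0 : 0 ≤ C := hC.nonneg le_rfl hS le_rfl
  refine ⟨w * C ^ 2 * S + c * C ^ 2, by positivity, fun s hs hsS x u v ho => ?_⟩
  obtain ⟨u', v', ho'⟩ := hopt S (Y S s x) hS
  set u'' : ℝ → XB := (Ioi S).indicator u' with hu''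
  have hu''0 : ∀ r, r ≤ S → u'' r = 0 := fun r hr => indicator_of_notMem (notMem_Ioi.2 hr) _
  have hmem : MemLp u'' 2 (volume.restrict (Ioi s)) := by
    rw [hu'', memLp_indicator_iff_restrict measurableSet_Ioi,
      Measure.restrict_restrict measurableSet_Ioi,
      inter_eq_self_of_subset_left (Ioi_subset_Ioi hsS)]
    exact ho'.memLp
  have hmemT : ∀ T, MemLp u'' 2 (volume.restrict (Ioc s T)) := fun T =>
    hmem.mono_measure (Measure.restrict_mono Ioc_subset_Ioi_self le_rfl)
  have hst : ∀ r ∈ Icc s S, mildState Y B s x u'' r = Y r s x := by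
    intro r hr
    rw [IsRegulator.mildState_congr (u' := fun _ => 0) hr.1]
    · simp [mildState]
    · filter_upwards [ae_restrict_mem measurableSet_Ioc] with σ hσ
      exact hu''0 σ (hσ.2.trans hr.2)
  have hJS : finiteHorizonCost Y B W R s x u'' S ≤ w * C ^ 2 * S * ‖x‖ ^ 2 := by
    calc finiteHorizonCost Y B W R s x u'' S ≤ ∫ r in s..S, w * (C * ‖x‖) ^ 2 := by
          refine intervalIntegral.integral_mono_on hsS
            (h.intervalIntegrable_cost hs hsS (hmemT S) x) intervalIntegrable_const fun r hr => ?_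
          rw [hst r hr, hu''0 r hr.2]
          refine (h.runningCost_le (hs.trans hr.1)).trans ?_
          rw [norm_zero]
          have := hC.le hs hr.1 hr.2 x
          have : w * ‖Y r s x‖ ^ 2 ≤ w * (C * ‖x‖) ^ 2 := by gcongr
          linarith
      _ = (S - s) * (w * (C * ‖x‖) ^ 2) := by
          rw [intervalIntegral.integral_const, smul_eq_mul]
      _ ≤ S * (w * (C * ‖x‖) ^ 2) := by gcongr; linarith
      _ = _ := by ring
  have hJ : ∀ T, s ≤ T → finiteHorizonCost Y B W R s x u'' T
      ≤ w * C ^ 2 * S * ‖x‖ ^ 2 + v' := by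
    intro T hT
    refine (h.finiteHorizonCost_mono hs hT (le_max_left T S) (hmemT _) x).trans ?_
    rw [h.finiteHorizonCost_restart hs hsS (le_max_right T S) (hmemT _), hst S ⟨hsS, le_rfl⟩,
      IsRegulator.finiteHorizonCost_congr (u := u'') (u' := u') (le_max_right T S)]
    · exact add_le_add hJS (ho'.cost_le _ (le_max_right T S))
    · filter_upwards [ae_restrict_mem measurableSet_Ioc] with r hr
      exact indicator_of_mem (mem_Ioi.2 hr.1) _
  have hv' : v' ≤ c * C ^ 2 * ‖x‖ ^ 2 := by
    refine (hcS _ _ _ ho').trans ?_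
    rw [mul_assoc, ← mul_pow]
    gcongr
    exact hC.le hs hsS le_rfl x
  have hle : ENNReal.ofReal v ≤ ENNReal.ofReal (w * C ^ 2 * S * ‖x‖ ^ 2 + v') := by
    rw [← ho.optimal]
    exact (iInf₂_le u'' hmem.1).trans (h.infiniteHorizonCost_le hs hmem hJ)
  have hv'0 := ho'.nonneg
  rw [ENNReal.ofReal_le_ofReal_iff (by positivity)] at hle
  linarith

/-- Bounds for the finite-horizon problems that are uniform in the horizon. -/
theorem exists_uniform_bounds (h : IsDetectableRegulator Y B W R b w ρ δ κ α)
    (hP₀ : P₀.IsPositive)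
    (hP : ∀ T, 0 < T → IsFiniteHorizonRiccati Y B W R P₀ T (P T) (Z T))
    (hopt : ∀ s x, 0 ≤ s → ∃ u v, IsOptimalControl Y B W R s x u v) {S : ℝ} (hS : 0 ≤ S) :
    ∃ c, 0 ≤ c ∧ ∀ T, 0 < T → ∀ s, 0 ≤ s → s ≤ S → s ≤ T →
      ‖P T s‖ ≤ c ∧ (∀ t, s ≤ t → t ≤ T → ‖Z T t s‖ ≤ c) ∧
      ∀ t, s ≤ t → t ≤ S → t ≤ T → ∀ x, ‖Z T t s x - Y t s x‖ ≤ c * (t - s) * ‖x‖ := by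
  obtain ⟨c, hc0, hc⟩ := exists_value_bound h hP₀ hP hopt hS
  obtain ⟨C, hC⟩ := h.bound S
  have hκ := h.κ_nonneg
  have hb := h.b_nonneg
  have hδ := h.pos
  have hC0 : 0 ≤ C := hC.nonneg le_rfl hS le_rfl
  -- `p` bounds the Riccati operators: optimal cost plus terminal weight, with `‖z(T)‖²` estimated
  -- by detectability. Then `q` bounds the closed loops, whose running cost is at most `p‖x‖²`, and
  -- `k` bounds the integrand of the perturbation equation.
  set p : ℝ := c + ‖P₀‖ * (κ * (1 + c)) with hp
  have hp0 : 0 ≤ p := by positivity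
  set q : ℝ := √(κ * (1 + p)) with hq
  have hq0 : 0 ≤ q := Real.sqrt_nonneg _
  set k : ℝ := C * (b * (δ⁻¹ * (b * p)) * q) with hk
  have hk0 : 0 ≤ k := by positivity
  have hinner : ∀ T, 0 < T → ∀ s, 0 ≤ s → s ≤ S → s ≤ T → ∀ x, ⟪P T s x, x⟫_ℝ ≤ p * ‖x‖ ^ 2 := by
    intro T hT s hs hsS hsT x
    obtain ⟨u, v, ho⟩ := hopt s x hs
    have h1 := ho.inner_le h.toIsRegulator hP₀ (hP T hT) hs hsT
    have h2 := hc s hs hsS x u v ho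
    have h3 := h.norm_sq_mildState_le (x := x) hs hsT (ho.memLp_Ioc T)
    have h4 := ho.cost_le T hsT
    calc ⟪P T s x, x⟫_ℝ ≤ v + ‖P₀‖ * ‖mildState Y B s x u T‖ ^ 2 := h1
      _ ≤ c * ‖x‖ ^ 2 + ‖P₀‖ * (κ * (‖x‖ ^ 2 + c * ‖x‖ ^ 2)) := by
          gcongr
          refine h3.trans ?_
          gcongr
          linarith
      _ = p * ‖x‖ ^ 2 := by rw [hp]; ring
  have hPn : ∀ T, 0 < T → ∀ s, 0 ≤ s → s ≤ S → s ≤ T → ‖P T s‖ ≤ p := fun T hT s hs hsS hsT =>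
    norm_le_of_inner_self_le (h.isPositive_riccati hP₀ (hP T hT) hs hsT) hp0
      (hinner T hT s hs hsS hsT)
  have hZn : ∀ T, 0 < T → ∀ s, 0 ≤ s → s ≤ S → ∀ t, s ≤ t → t ≤ T → ‖Z T t s‖ ≤ q := by
    intro T hT s hs hsS t hst htT
    have hsT := hst.trans htT
    refine (Z T t s).opNorm_le_bound hq0 fun x => ?_
    have hu₀ := h.memLp_feedbackControl (hP T hT) hs hsT x
    have h1 := h.norm_sq_mildState_le (x := x) hs hst (hu₀.mono_Ioc le_rfl htT)
    rw [IsRegulator.mildState_feedbackControl (hP T hT).closedLoop hs hst htT] at h1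
    have h2 := h.finiteHorizonCost_mono hs hst htT hu₀ x
    have h3 := h.inner_riccati_self hP₀ (hP T hT) hs hsT x
    have h4 := hP₀.inner_nonneg_left (Z T T s x)
    have h5 := hinner T hT s hs hsS hsT x
    rw [hq, ← Real.sqrt_sq (norm_nonneg x), ← Real.sqrt_mul (by positivity)]
    refine Real.le_sqrt_of_sq_le (h1.trans ?_)
    rw [mul_assoc]
    gcongr
    linarith
  refine ⟨max p (max q k), le_max_of_le_left hp0, fun T hT s hs hsS hsT => ⟨?_, ?_, ?_⟩⟩
  · exact (hPn T hT s hs hsS hsT).trans (le_max_left _ _)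
  · exact fun t hst htT => (hZn T hT s hs hsS t hst htT).trans
      ((le_max_left _ _).trans (le_max_right _ _))
  · intro t hst htS htT x
    have e := (hP T hT).closedLoop.eq s ⟨hs, hsT⟩ t ⟨hs.trans hst, htT⟩ hst x
    have h1 : ‖∫ r in s..t, Y t r (-((B r).comp (feedbackGain B R (P T) r)) (Z T r s x))‖
        ≤ k * ‖x‖ * |t - s| := by
      refine intervalIntegral.norm_integral_le_of_norm_le_const fun r hr => ?_
      rw [uIoc_of_le hst] at hr
      have hr0 : 0 ≤ r := hs.trans hr.1.le
      have h2 : ‖(-((B r).comp (feedbackGain B R (P T) r))) (Z T r s x)‖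
          ≤ b * (δ⁻¹ * (b * p)) * (q * ‖x‖) :=
        ContinuousLinearMap.le_of_opNorm_le_of_le _
          (h.norm_closedLoop_le hr0 (hPn T hT r hr0 (hr.2.trans htS) (hr.2.trans htT)))
          ((Z T r s).le_of_opNorm_le (hZn T hT s hs hsS r hr.1.le (hr.2.trans htT)) x)
      calc _ ≤ C * (b * (δ⁻¹ * (b * p)) * (q * ‖x‖)) :=
            (Y t r).le_of_opNorm_le_of_le (hC r t hr0 hr.2 htS) h2
        _ = k * ‖x‖ := by rw [hk]; ring
    rw [e, add_sub_cancel_left]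
    refine h1.trans ?_
    rw [abs_of_nonneg (sub_nonneg.2 hst)]
    calc k * ‖x‖ * (t - s) = k * (t - s) * ‖x‖ := by ring
      _ ≤ _ := by
        have : 0 ≤ t - s := sub_nonneg.2 hst
        gcongr
        exact (le_max_right _ _).trans (le_max_right _ _)

/-- The optimal control is given by the feedback law of the limiting Riccati operator. -/
theorem eq_feedback (h : IsDetectableRegulator Y B W R b w ρ δ κ α) (hP₀ : P₀.IsPositive)
    (hP : ∀ T, 0 < T → IsFiniteHorizonRiccati Y B W R P₀ T (P T) (Z T))
    (hopt : ∀ s x, 0 ≤ s → ∃ u v, IsOptimalControl Y B W R s x u v)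
    {Q : ℝ → H →L[ℝ] H} (hQ : ∀ r, 0 ≤ r → (Q r).IsPositive)
    (hQP : ∀ r, 0 ≤ r → ∀ x, Tendsto (fun T => ⟪P T r x, x⟫_ℝ) atTop (𝓝 ⟪Q r x, x⟫_ℝ))
    (hs : 0 ≤ s) (hst : s ≤ t) (ho : IsOptimalControl Y B W R s x u v) :
    ∀ᵐ r ∂(volume.restrict (Ioc s t)), u r = -(feedbackGain B R Q r (mildState Y B s x u r)) := by
  have hδ := h.pos
  have ht0 := hs.trans hst
  have hTn : ∀ n : ℕ, t < t + 1 + n := fun n => by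
    have : (0 : ℝ) ≤ n := by positivity
    linarith
  have hTlim : Tendsto (fun n : ℕ => t + 1 + (n : ℝ)) atTop atTop :=
    tendsto_atTop_add_const_left _ _ tendsto_natCast_atTop_atTop
  have hF : ∀ n : ℕ, IsFiniteHorizonRiccati Y B W R P₀ (t + 1 + n) (P (t + 1 + n))
      (Z (t + 1 + n)) := fun n => hP _ (ht0.trans_lt (hTn n))
  set a : ℕ → ℝ → XB := fun n => feedbackControl B R (P (t + 1 + n)) (Z (t + 1 + n)) s x with ha
  have hau : ∀ n, MemLp (fun r => u r - a n r) 2 (volume.restrict (Ioc s (t + 1 + n))) := fun n =>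
    (ho.memLp_Ioc _).sub (h.memLp_feedbackControl (hF n) hs (hst.trans (hTn n).le) x)
  have hau' : ∀ n, MemLp (fun r => u r - a n r) 2 (volume.restrict (Ioc s t)) := fun n =>
    (hau n).mono_Ioc le_rfl (hTn n).le
  have hgap : Tendsto (fun n : ℕ => δ⁻¹ * optimalityGap Y B W R P₀ s x u v (t + 1 + n)) atTop
      (𝓝 0) := by
    simpa using ((ho.tendsto_optimalityGap h hs (P₀ := P₀)).comp hTlim).const_mul δ⁻¹
  have hint : Tendsto (fun n => ∫ r in Ioc s t, ‖u r - a n r‖ ^ 2) atTop (𝓝 0) := by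
    refine squeeze_zero (fun n => integral_nonneg fun r => sq_nonneg _) (fun n => ?_) hgap
    rw [← intervalIntegral.integral_of_le hst, ← div_eq_inv_mul, le_div_iff₀' hδ]
    refine le_trans ?_ (ho.sq_integral_sub_le h.toIsRegulator hP₀ (hF n) hs (hst.trans (hTn n).le))
    gcongr
    exact intervalIntegral.integral_mono_interval le_rfl hst (hTn n).le
      (ae_of_all _ fun r => sq_nonneg _)
      (IsRegulator.intervalIntegrable_sq (hst.trans (hTn n).le) (hau n))
  -- L² convergence of the feedback controls is traded for almost everywhere convergence along a
  -- subsequence, since the feedback law is to be identified pointwise in time.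
  have hmeas : TendstoInMeasure (volume.restrict (Ioc s t)) (fun n r => u r - a n r) atTop
      (fun _ => (0 : XB)) := by
    refine tendstoInMeasure_of_tendsto_eLpNorm (p := 2) (by norm_num) (fun n => (hau' n).1)
      aestronglyMeasurable_const ?_
    have e : ∀ n, eLpNorm ((fun r => u r - a n r) - fun _ => (0 : XB)) 2 (volume.restrict (Ioc s t))
        = ENNReal.ofReal (√(∫ r in Ioc s t, ‖u r - a n r‖ ^ 2)) := fun n => by
      rw [← (hau' n).eLpNorm_two_eq]
      congr 1
      funext r
      simp
    simp only [e]
    have := ENNReal.tendsto_ofReal hint.sqrt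
    simpa using this
  obtain ⟨ns, hns, hae⟩ := hmeas.exists_seq_tendsto_ae
  obtain ⟨c, hc0, hc⟩ := exists_uniform_bounds h hP₀ hP hopt ht0
  filter_upwards [hae, ae_restrict_mem measurableSet_Ioc] with r hr hrm
  have hr0 : 0 ≤ r := hs.trans hrm.1.le
  have hlimT : Tendsto (fun k => t + 1 + (ns k : ℝ)) atTop atTop := hTlim.comp hns.tendsto_atTop
  set z := mildState Y B s x u r with hz
  have hzlim : Tendsto (fun k => Z (t + 1 + ns k) r s x) atTop (𝓝 z) :=
    (ho.tendsto_closedLoop h hP₀ hP hs hrm.1.le).comp hlimT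
  -- Weak convergence of the operators and strong convergence of the states combine thanks to the
  -- bound on `P` uniform in the horizon.
  have hPz : ∀ y, Tendsto (fun k => ⟪P (t + 1 + ns k) r (Z (t + 1 + ns k) r s x), y⟫_ℝ) atTop
      (𝓝 ⟪Q r z, y⟫_ℝ) := by
    intro y
    have h1 : Tendsto (fun k => ⟪P (t + 1 + ns k) r z, y⟫_ℝ) atTop (𝓝 ⟪Q r z, y⟫_ℝ) :=
      tendsto_inner_of_forms (hQ r hr0) (A := fun k => P (t + 1 + ns k) r)
        (fun k => h.isPositive_riccati hP₀ (hF (ns k)) hr0 (hrm.2.trans (hTn _).le))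
        (fun x => (hQP r hr0 x).comp hlimT) z y
    have h2 : Tendsto (fun k => ⟪P (t + 1 + ns k) r (Z (t + 1 + ns k) r s x - z), y⟫_ℝ) atTop
        (𝓝 0) := by
      have h3 : Tendsto (fun k => c * ‖Z (t + 1 + ns k) r s x - z‖ * ‖y‖) atTop (𝓝 0) := by
        have := (tendsto_iff_norm_sub_tendsto_zero.1 hzlim).const_mul c
        simpa using this.mul_const ‖y‖
      refine squeeze_zero_norm (fun k => (norm_inner_le_norm _ _).trans ?_) h3
      gcongr
      exact ContinuousLinearMap.le_of_opNorm_le _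
        (hc _ (ht0.trans_lt (hTn _)) r hr0 hrm.2 (hrm.2.trans (hTn _).le)).1 _
    have h4 := h1.add h2
    rw [add_zero] at h4
    refine h4.congr fun k => ?_
    rw [map_sub, inner_sub_left]
    abel
  have hua : Tendsto (fun k => a (ns k) r) atTop (𝓝 (u r)) := by
    have := hr.const_sub (u r)
    simpa using this
  -- Moving `R⁻¹ B*` onto the test vector lets the weak limit of `P z` identify the limit of the
  -- controls.
  have hG : ∀ (A : ℝ → H →L[ℝ] H) (y : H) (e : XB), ⟪-(feedbackGain B R A r y), e⟫_ℝ
      = -⟪A r y, B r (Ring.inverse (R r) e)⟫_ℝ := by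
    intro A y e
    rw [inner_neg_left, ← ContinuousLinearMap.adjoint_inner_left]
    congr 1
    exact inner_ringInverse_comm_of_coercive h.pos (h.coercive r hr0)
      (ContinuousLinearMap.isSelfAdjoint_iff_isSymmetric.2 (h.symR r hr0)) _ _
  refine ext_inner_right ℝ fun e => ?_
  rw [hG]
  refine tendsto_nhds_unique (hua.inner tendsto_const_nhds) ?_
  refine (hPz (B r (Ring.inverse (R r) e))).neg.congr fun k => ?_
  rw [ha]
  exact (hG (P (t + 1 + ns k)) _ e).symm

end IsOptimalControl

end Convergence

/-! ### The limiting closed loop: existence, identification, uniformity in the initial time -/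

section LimitingClosedLoop

open Filter Topology

variable {H XB : Type*}
  [NormedAddCommGroup H] [InnerProductSpace ℝ H]
  [NormedAddCommGroup XB] [InnerProductSpace ℝ XB]

/-- Only one time variable moves on each side of `s₀`, so separate continuity is enough. -/
theorem IsEvolutionOperator.tendsto_gap {Y : ℝ → ℝ → H →L[ℝ] H}
    (hY : IsEvolutionOperator (Ici 0) Y) {s₀ : ℝ} (hs₀ : 0 ≤ s₀) (x : H) :
    Tendsto (fun s => Y (max s s₀) (min s s₀) x) (𝓝[Ici 0] s₀) (𝓝 x) := by
  have hd : Y s₀ s₀ x = x := by rw [hY.diag s₀ hs₀]; rfl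
  have h1 : ContinuousWithinAt (fun s => Y (max s s₀) (min s s₀) x) (Ici 0 ∩ Ici s₀) s₀ := by
    refine ((hY.continuousOn_left s₀ hs₀ x) s₀ ⟨hs₀, le_refl s₀⟩).congr (fun s hs => ?_) (by simp)
    rw [max_eq_left hs.2, min_eq_right hs.2]
  have h2 : ContinuousWithinAt (fun s => Y (max s s₀) (min s s₀) x) (Ici 0 ∩ Iic s₀) s₀ := by
    refine ((hY.continuousOn_right s₀ hs₀ x) s₀ ⟨hs₀, le_refl s₀⟩).congr (fun s hs => ?_) (by simp)
    rw [max_eq_right hs.2, min_eq_left hs.2]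
  have h3 := h1.union h2
  rw [← inter_union_distrib_left, Ici_union_Iic, inter_univ, ContinuousWithinAt, max_self, min_self,
    hd] at h3
  exact h3

theorem tendsto_gap_bound {Y : ℝ → ℝ → H →L[ℝ] H} (hY : IsEvolutionOperator (Ici 0) Y) {s₀ : ℝ}
    (hs₀ : 0 ≤ s₀) (c : ℝ) (x : H) :
    Tendsto (fun s => c * (c * |s - s₀| * ‖x‖ + ‖Y (max s s₀) (min s s₀) x - x‖))
      (𝓝[Ici 0] s₀) (𝓝 0) := by
  have h1 : Tendsto (fun s => c * |s - s₀| * ‖x‖) (𝓝[Ici 0] s₀) (𝓝 0) := by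
    have : Continuous fun s => c * |s - s₀| * ‖x‖ := by fun_prop
    simpa using (this.tendsto s₀).mono_left nhdsWithin_le_nhds
  have h2 := (h1.add (tendsto_iff_norm_sub_tendsto_zero.1 (hY.tendsto_gap hs₀ x))).const_mul c
  simpa using h2

/-- For `a ≤ b`, `V t a - V t b = V t b (V b a - I)`, and over the short interval `V b a` differs
from `Y b a` by `O(b - a)`. The resulting modulus in `s` involves only `Y` and `c`, hence is common
to all horizons and all `t`. -/
theorem norm_sub_le_of_gap {Y V : ℝ → ℝ → H →L[ℝ] H} {T S c : ℝ} (hc : 0 ≤ c)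
    (hV : IsEvolutionOperator (Icc 0 T) V)
    (hVc : ∀ s t, 0 ≤ s → s ≤ S → s ≤ t → t ≤ T → ‖V t s‖ ≤ c)
    (hVY : ∀ s t, 0 ≤ s → s ≤ t → t ≤ S → t ≤ T → ∀ x, ‖V t s x - Y t s x‖ ≤ c * (t - s) * ‖x‖)
    {s s₀ t : ℝ} (hs : 0 ≤ s) (hsS : s ≤ S) (hs₀ : 0 ≤ s₀) (hs₀S : s₀ ≤ S) (hst : s ≤ t)
    (hs₀t : s₀ ≤ t) (htT : t ≤ T) (x : H) :
    ‖V t s x - V t s₀ x‖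
      ≤ c * (c * |s - s₀| * ‖x‖ + ‖Y (max s s₀) (min s s₀) x - x‖) := by
  have key : ∀ a b, 0 ≤ a → a ≤ b → b ≤ S → b ≤ t →
      ‖V t a x - V t b x‖ ≤ c * (c * (b - a) * ‖x‖ + ‖Y b a x - x‖) := by
    intro a b ha hab hbS hbt
    have hb := ha.trans hab
    have e : V t a x - V t b x = V t b ((V b a x - Y b a x) + (Y b a x - x)) := by
      rw [← hV.comp a ⟨ha, (hab.trans hbt).trans htT⟩ b ⟨hb, hbt.trans htT⟩ t
        ⟨hb.trans hbt, htT⟩ hab hbt]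
      simp [map_sub]
    rw [e]
    refine (V t b).le_of_opNorm_le_of_le (hVc b t hb hbS hbt htT) ((norm_add_le _ _).trans ?_)
    gcongr
    exact hVY a b ha hab hbS (hbt.trans htT) x
  rcases le_total s s₀ with hss | hss
  · rw [max_eq_right hss, min_eq_left hss, abs_sub_comm, abs_of_nonneg (sub_nonneg.2 hss)]
    exact key s s₀ hs hss hs₀S hs₀t
  · rw [max_eq_left hss, min_eq_right hss, abs_of_nonneg (sub_nonneg.2 hss), norm_sub_rev]
    exact key s₀ s hs₀ hss hsS hst

/-- A bounded perturbation of an evolution operator is determined by its generator. -/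
theorem IsPerturbedEvolution.unique {Y Z Z' : ℝ → ℝ → H →L[ℝ] H} {D : ℝ → H →L[ℝ] H}
    {T C d s t : ℝ} (hC : IsTriangleBound Y T C) (hd0 : 0 ≤ d) (hd : ∀ r ∈ Icc 0 T, ‖D r‖ ≤ d)
    (hZ : IsPerturbedEvolution (Icc 0 T) Y D Z) (hZ' : IsPerturbedEvolution (Icc 0 T) Y D Z')
    (hs : 0 ≤ s) (hst : s ≤ t) (ht : t ≤ T) (x : H) : Z t s x = Z' t s x := by
  have hsT := hst.trans ht
  refine sub_eq_zero.1 (eq_zero_of_volterra hC hs hsT hd0 hd (y := fun t => Z t s x - Z' t s x)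
    ((hZ.evolution.continuousOn_Icc_left hs hsT x).sub
      (hZ'.evolution.continuousOn_Icc_left hs hsT x)) (fun σ hσ => ?_) t ⟨hst, ht⟩)
  have hσ' : σ ∈ Icc 0 T := ⟨hs.trans hσ.1, hσ.2⟩
  simp only [map_sub]
  rw [intervalIntegral.integral_sub (hZ.integrable s ⟨hs, hsT⟩ σ hσ' hσ.1 x)
    (hZ'.integrable s ⟨hs, hsT⟩ σ hσ' hσ.1 x), hZ.eq s ⟨hs, hsT⟩ σ hσ' hσ.1 x,
    hZ'.eq s ⟨hs, hsT⟩ σ hσ' hσ.1 x, add_sub_add_left_eq_sub]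

/-- The closed-loop evolution operators converge pointwise to `V` as the horizon tends to `∞`. -/
def IsLimitLoop (Z : ℝ → ℝ → ℝ → H →L[ℝ] H) (V : ℝ → ℝ → H →L[ℝ] H) : Prop :=
  ∀ s t, 0 ≤ s → s ≤ t → ∀ x, Tendsto (fun T => Z T t s x) atTop (𝓝 (V t s x))

theorem IsLimitLoop.bounds {Y V : ℝ → ℝ → H →L[ℝ] H} {P : ℝ → ℝ → H →L[ℝ] H}
    {Z : ℝ → ℝ → ℝ → H →L[ℝ] H} (hV : IsLimitLoop Z V) {S c : ℝ}
    (hc : ∀ T, 0 < T → ∀ s, 0 ≤ s → s ≤ S → s ≤ T →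
      ‖P T s‖ ≤ c ∧ (∀ t, s ≤ t → t ≤ T → ‖Z T t s‖ ≤ c) ∧
      ∀ t, s ≤ t → t ≤ S → t ≤ T → ∀ x, ‖Z T t s x - Y t s x‖ ≤ c * (t - s) * ‖x‖)
    (hc0 : 0 ≤ c) :
    (∀ s t, 0 ≤ s → s ≤ S → s ≤ t → ‖V t s‖ ≤ c) ∧
      ∀ s t, 0 ≤ s → s ≤ t → t ≤ S → ∀ x, ‖V t s x - Y t s x‖ ≤ c * (t - s) * ‖x‖ := by
  constructor
  · intro s t hs hsS hst
    refine (V t s).opNorm_le_bound hc0 fun x => ?_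
    refine le_of_tendsto (hV s t hs hst x).norm ?_
    filter_upwards [eventually_gt_atTop t] with T hT
    exact (Z T t s).le_of_opNorm_le
      ((hc T ((hs.trans hst).trans_lt hT) s hs hsS (hst.trans hT.le)).2.1 t hst hT.le) x
  · intro s t hs hst htS x
    refine le_of_tendsto ((hV s t hs hst x).sub_const (Y t s x)).norm ?_
    filter_upwards [eventually_gt_atTop t] with T hT
    exact (hc T ((hs.trans hst).trans_lt hT) s hs (hst.trans htS) (hst.trans hT.le)).2.2 t hst htS
      hT.le x

variable [CompleteSpace H] [CompleteSpace XB]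
  {Y : ℝ → ℝ → H →L[ℝ] H} {B : ℝ → XB →L[ℝ] H} {W : ℝ → H →L[ℝ] H}
  {R : ℝ → XB →L[ℝ] XB} {b w ρ δ κ α : ℝ} {P₀ : H →L[ℝ] H}
  {P : ℝ → ℝ → H →L[ℝ] H} {Z : ℝ → ℝ → ℝ → H →L[ℝ] H}

namespace IsOptimalControl

theorem exists_isPositive (h : IsDetectableRegulator Y B W R b w ρ δ κ α) (hP₀ : P₀.IsPositive)
    (hP : ∀ T, 0 < T → IsFiniteHorizonRiccati Y B W R P₀ T (P T) (Z T))
    (hopt : ∀ s x, 0 ≤ s → ∃ u v, IsOptimalControl Y B W R s x u v) {s : ℝ} (hs : 0 ≤ s) :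
    ∃ Q : H →L[ℝ] H, Q.IsPositive ∧
      ∀ x, ENNReal.ofReal ⟪Q x, x⟫_ℝ = optimalCost Y B W R s x := by
  choose u v ho using fun x => hopt s x hs
  have hTn : ∀ n : ℕ, s < s + 1 + n := fun n => by
    have : (0 : ℝ) ≤ n := by positivity
    linarith
  have hTlim : Tendsto (fun n : ℕ => s + 1 + (n : ℝ)) atTop atTop :=
    tendsto_atTop_add_const_left _ _ tendsto_natCast_atTop_atTop
  obtain ⟨c, -, hc⟩ := exists_uniform_bounds h hP₀ hP hopt hs
  obtain ⟨Q, hQ, hQv⟩ := exists_isPositive_of_inner_self_tendsto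
    (A := fun n : ℕ => P (s + 1 + n) s) (v := v) (c := c)
    (Eventually.of_forall fun n =>
      h.isPositive_riccati hP₀ (hP _ (hs.trans_lt (hTn n))) hs (hTn n).le)
    (fun x => ((ho x).tendsto_inner h hP₀ hP hs).comp hTlim)
    (Eventually.of_forall fun n => (hc _ (hs.trans_lt (hTn n)) s hs le_rfl (hTn n).le).1)
  exact ⟨Q, hQ, fun x => by rw [hQv, (ho x).optimal]⟩

/-- A pointwise limit of a sequence of bounded operators on a Banach space is a bounded operator.
Off the triangle, where no value matters, the limit is set to 0. -/
theorem exists_isLimitLoop (h : IsDetectableRegulator Y B W R b w ρ δ κ α) (hP₀ : P₀.IsPositive)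
    (hP : ∀ T, 0 < T → IsFiniteHorizonRiccati Y B W R P₀ T (P T) (Z T))
    (hopt : ∀ s x, 0 ≤ s → ∃ u v, IsOptimalControl Y B W R s x u v) :
    ∃ V : ℝ → ℝ → H →L[ℝ] H, IsLimitLoop Z V := by
  have hV : ∀ t s, ∃ V : H →L[ℝ] H, 0 ≤ s → s ≤ t → ∀ x,
      Tendsto (fun T => Z T t s x) atTop (𝓝 (V x)) := by
    intro t s
    by_cases hst : 0 ≤ s ∧ s ≤ t
    · obtain ⟨hs, hst⟩ := hst
      choose u v ho using fun x => hopt s x hs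
      have hl := fun x => (ho x).tendsto_closedLoop h hP₀ hP hs hst
      have hTlim : Tendsto (fun n : ℕ => t + 1 + (n : ℝ)) atTop atTop :=
        tendsto_atTop_add_const_left _ _ tendsto_natCast_atTop_atTop
      have hl' : Tendsto (fun (n : ℕ) x => Z (t + 1 + n) t s x) atTop
          (𝓝 fun x => mildState Y B s x (u x) t) :=
        tendsto_pi_nhds.2 fun x => (hl x).comp hTlim
      exact ⟨continuousLinearMapOfTendsto (fun n : ℕ => Z (t + 1 + n) t s) hl', fun _ _ x => hl x⟩
    · exact ⟨0, fun h1 h2 => absurd ⟨h1, h2⟩ hst⟩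
  choose V hV using hV
  exact ⟨V, fun s t hs hst => hV t s hs hst⟩

variable {V : ℝ → ℝ → H →L[ℝ] H}

theorem eq_mildState (h : IsDetectableRegulator Y B W R b w ρ δ κ α) (hP₀ : P₀.IsPositive)
    (hP : ∀ T, 0 < T → IsFiniteHorizonRiccati Y B W R P₀ T (P T) (Z T)) (hV : IsLimitLoop Z V)
    {s t v : ℝ} {x : H} {u : ℝ → XB} (hs : 0 ≤ s) (hst : s ≤ t)
    (ho : IsOptimalControl Y B W R s x u v) : V t s x = mildState Y B s x u t :=
  tendsto_nhds_unique (hV s t hs hst x) (ho.tendsto_closedLoop h hP₀ hP hs hst)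

/-- The limit of the finite-horizon closed loops is an evolution operator. -/
theorem isEvolutionOperator_limit (h : IsDetectableRegulator Y B W R b w ρ δ κ α)
    (hP₀ : P₀.IsPositive)
    (hP : ∀ T, 0 < T → IsFiniteHorizonRiccati Y B W R P₀ T (P T) (Z T))
    (hopt : ∀ s x, 0 ≤ s → ∃ u v, IsOptimalControl Y B W R s x u v) (hV : IsLimitLoop Z V) :
    IsEvolutionOperator (Ici 0) V := by
  have hdiag : ∀ t ∈ Ici (0 : ℝ), V t t = ContinuousLinearMap.id ℝ H := by
    intro t ht
    ext x
    refine tendsto_nhds_unique (hV t t ht le_rfl x) (tendsto_const_nhds.congr' ?_)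
    filter_upwards [eventually_gt_atTop t] with T hT
    rw [(hP T ((mem_Ici.1 ht).trans_lt hT)).closedLoop.evolution.diag t ⟨ht, hT.le⟩]
  have hcomp : ∀ s ∈ Ici (0 : ℝ), ∀ r ∈ Ici (0 : ℝ), ∀ t ∈ Ici (0 : ℝ), s ≤ r → r ≤ t →
      (V t r).comp (V r s) = V t s := by
    intro s hs r hr t ht hsr hrt
    ext x
    obtain ⟨c, hc0, hc⟩ := exists_uniform_bounds h hP₀ hP hopt (mem_Ici.1 ht)
    refine tendsto_nhds_unique ?_ (hV s t hs (hsr.trans hrt) x)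
    have h1 := hV r t hr hrt (V r s x)
    -- The uniform bound on `Z T t r` allows the limit to be taken in a product of two strongly
    -- convergent families.
    have h2 : Tendsto (fun T => Z T t r (Z T r s x - V r s x)) atTop (𝓝 0) := by
      have h3 := (tendsto_iff_norm_sub_tendsto_zero.1 (hV s r hs hsr x)).const_mul c
      rw [mul_zero] at h3
      refine squeeze_zero_norm' ?_ h3
      filter_upwards [eventually_gt_atTop t] with T hT
      exact (Z T t r).le_of_opNorm_le
        ((hc T ((mem_Ici.1 ht).trans_lt hT) r hr hrt (hrt.trans hT.le)).2.1 t hrt hT.le) _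
    have h4 := h1.add h2
    rw [add_zero] at h4
    refine h4.congr' ?_
    filter_upwards [eventually_gt_atTop t] with T hT
    rw [← (hP T ((mem_Ici.1 ht).trans_lt hT)).closedLoop.evolution.comp s
      ⟨hs, (hsr.trans hrt).trans hT.le⟩ r ⟨hr, hrt.trans hT.le⟩ t ⟨ht, hT.le⟩ hsr hrt]
    simp
  have hleft : ∀ s ∈ Ici (0 : ℝ), ∀ x : H, ContinuousOn (fun t => V t s x) (Ici 0 ∩ Ici s) := by
    intro s hs x t ht
    obtain ⟨u, v, ho⟩ := hopt s x hs
    have ht' : s ≤ t := ht.2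
    -- In the first variable the limit is an optimal mild state. The horizon `t + 1` leaves room for
    -- a full neighbourhood of `t`.
    have h1 := h.continuousOn_mildState hs (ht'.trans (le_add_of_nonneg_right zero_le_one))
      (ho.memLp_Ioc (t + 1)) x t ⟨ht', le_add_of_nonneg_right zero_le_one⟩
    have h2 : ContinuousWithinAt (mildState Y B s x u) (Ici 0 ∩ Ici s) t := by
      refine h1.mono_of_mem_nhdsWithin ?_
      filter_upwards [self_mem_nhdsWithin, mem_nhdsWithin_of_mem_nhds
        (Iio_mem_nhds (lt_add_one t))] with r hr hr'
      exact ⟨hr.2, le_of_lt hr'⟩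
    exact h2.congr (fun r hr => eq_mildState h hP₀ hP hV hs hr.2 ho)
      (eq_mildState h hP₀ hP hV hs ht' ho)
  have hcont : ∀ t ∈ Ici (0 : ℝ), ∀ x : H, ContinuousOn (fun s => V t s x) (Ici 0 ∩ Iic t) := by
    intro t ht x s₀ hs₀
    obtain ⟨c, hc0, hc⟩ := exists_uniform_bounds h hP₀ hP hopt (mem_Ici.1 ht)
    -- In the second variable, the modulus common to all horizons survives the limit.
    have hgap : Tendsto (fun s => c * (c * |s - s₀| * ‖x‖ + ‖Y (max s s₀) (min s s₀) x - x‖))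
        (𝓝[Ici 0 ∩ Iic t] s₀) (𝓝 0) :=
      (tendsto_gap_bound h.evolution hs₀.1 c x).mono_left (nhdsWithin_mono _ inter_subset_left)
    refine tendsto_iff_norm_sub_tendsto_zero.2 (squeeze_zero' (Eventually.of_forall fun s =>
      norm_nonneg _) ?_ hgap)
    filter_upwards [self_mem_nhdsWithin] with s hs
    obtain ⟨hs0, hst⟩ := hs
    refine le_of_tendsto ((hV s t hs0 hst x).sub (hV s₀ t hs₀.1 hs₀.2 x)).norm ?_
    filter_upwards [eventually_gt_atTop t] with T hT
    have hT0 := (mem_Ici.1 ht).trans_lt hT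
    exact norm_sub_le_of_gap hc0 (hP T hT0).closedLoop.evolution
      (fun s t' hs hst hst' htT => (hc T hT0 s hs hst (hst'.trans htT)).2.1 t' hst' htT)
      (fun s t' hs hst' htt htT => (hc T hT0 s hs (hst'.trans htt) (hst'.trans htT)).2.2 t' hst'
        htt htT) hs0 hst hs₀.1 hs₀.2 hst hs₀.2 hT.le x
  exact ⟨hdiag, hcomp, hleft, hcont⟩

/-- The limit of the finite-horizon closed loops is the closed loop of the limiting Riccati
operator. -/
theorem isClosedLoop_limit (h : IsDetectableRegulator Y B W R b w ρ δ κ α) (hP₀ : P₀.IsPositive)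
    (hP : ∀ T, 0 < T → IsFiniteHorizonRiccati Y B W R P₀ T (P T) (Z T))
    (hopt : ∀ s x, 0 ≤ s → ∃ u v, IsOptimalControl Y B W R s x u v) (hV : IsLimitLoop Z V)
    {Q : ℝ → H →L[ℝ] H} (hQ : ∀ r, 0 ≤ r → (Q r).IsPositive)
    (hQo : ∀ s : ℝ, 0 ≤ s → ∀ x : H, ENNReal.ofReal ⟪Q s x, x⟫_ℝ = optimalCost Y B W R s x) :
    IsClosedLoop (Ici 0) Y B R Q V := by
  have hQP : ∀ r, 0 ≤ r → ∀ x, Tendsto (fun T => ⟪P T r x, x⟫_ℝ) atTop (𝓝 ⟪Q r x, x⟫_ℝ) := by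
    intro r hr x
    obtain ⟨u, v, ho⟩ := hopt r x hr
    rw [← ho.eq_inner (hQ r hr) (hQo r hr x)]
    exact ho.tendsto_inner h hP₀ hP hr
  -- Through the feedback law, the mild-solution formula for the optimal state becomes the
  -- perturbation equation of the closed loop.
  have key : ∀ s t x u v, 0 ≤ s → s ≤ t → IsOptimalControl Y B W R s x u v →
      ∀ᵐ r ∂(volume.restrict (Ioc s t)),
        Y t r (B r (u r)) = Y t r ((-((B r).comp (feedbackGain B R Q r))) (V r s x)) := by
    intro s t x u v hs hst ho
    filter_upwards [ho.eq_feedback h hP₀ hP hopt hQ hQP hs hst, ae_restrict_mem measurableSet_Ioc]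
      with r hr hrm
    rw [hr, eq_mildState h hP₀ hP hV hs hrm.1.le ho]
    simp
  refine ⟨isEvolutionOperator_limit h hP₀ hP hopt hV, fun s hs t ht hst x => ?_,
    fun s hs t ht hst x => ?_⟩
  · obtain ⟨u, v, ho⟩ := hopt s x hs
    refine (h.intervalIntegrable_mildState hs hst (ho.memLp_Ioc t)).congr_ae ?_
    rw [uIoc_of_le hst]
    exact key s t x u v hs hst ho
  · obtain ⟨u, v, ho⟩ := hopt s x hs
    rw [eq_mildState h hP₀ hP hV hs hst ho, mildState]
    congr 1
    refine intervalIntegral.integral_congr_ae ?_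
    rw [uIoc_of_le hst, ← ae_restrict_iff' measurableSet_Ioc]
    exact key s t x u v hs hst ho

/-- The optimal costs bound `Q` on `[0, t]`, so the closed-loop equation has a unique solution
there, and the limit loop solves it. No boundedness or measurability of `Q` in time has to be
assumed. -/
theorem isLimitLoop_of_isInfiniteHorizonOptimal (h : IsDetectableRegulator Y B W R b w ρ δ κ α)
    (hP₀ : P₀.IsPositive)
    (hP : ∀ T, 0 < T → IsFiniteHorizonRiccati Y B W R P₀ T (P T) (Z T))
    (hopt : ∀ s x, 0 ≤ s → ∃ u v, IsOptimalControl Y B W R s x u v)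
    {Q : ℝ → H →L[ℝ] H} (hQ : IsInfiniteHorizonOptimal Y B W R Q V) : IsLimitLoop Z V := by
  obtain ⟨V', hV'⟩ := exists_isLimitLoop h hP₀ hP hopt
  have hcl := isClosedLoop_limit h hP₀ hP hopt hV' hQ.positive hQ.optimal
  intro s t hs hst x
  have ht := hs.trans hst
  obtain ⟨C, hC⟩ := h.bound t
  obtain ⟨c, hc0, hc⟩ := exists_value_bound h hP₀ hP hopt ht
  have hQc : ∀ r ∈ Icc 0 t, ‖Q r‖ ≤ c := fun r hr =>
    norm_le_of_inner_self_le (hQ.positive r hr.1) hc0 fun y => by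
      obtain ⟨u, v, ho⟩ := hopt r y hr.1
      rw [← ho.eq_inner (hQ.positive r hr.1) (hQ.optimal r hr.1 y)]
      exact hc r hr.1 hr.2 y u v ho
  have hb := h.b_nonneg
  have hδ := h.pos
  have hsub : Icc 0 t ⊆ Ici 0 := fun r hr => hr.1
  rw [IsPerturbedEvolution.unique hC (by positivity)
    (fun r hr => h.norm_closedLoop_le hr.1 (hQc r hr))
    (IsPerturbedEvolution.mono hQ.closedLoop hsub) (IsPerturbedEvolution.mono hcl hsub) hs hst
    le_rfl x]
  exact hV' s t hs hst x

theorem tendstoUniformly_closedLoop (h : IsDetectableRegulator Y B W R b w ρ δ κ α)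
    (hP₀ : P₀.IsPositive)
    (hP : ∀ T, 0 < T → IsFiniteHorizonRiccati Y B W R P₀ T (P T) (Z T))
    (hopt : ∀ s x, 0 ≤ s → ∃ u v, IsOptimalControl Y B W R s x u v) (hV : IsLimitLoop Z V)
    (x : H) {S ε : ℝ} (hS : 0 ≤ S) (hε : 0 < ε) :
    ∃ T₀, ∀ T, T₀ ≤ T → ∀ s ∈ Icc 0 S, ∀ t, s ≤ t → t ≤ T → ‖Z T t s x - V t s x‖ < ε := by
  obtain ⟨c, hc0, hc⟩ := exists_uniform_bounds h hP₀ hP hopt hS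
  obtain ⟨hVc, hVY⟩ := hV.bounds hc hc0
  have hVe := isEvolutionOperator_limit h hP₀ hP hopt hV
  suffices key : ∃ T₀, ∀ T, T₀ ≤ T → ∀ s ∈ Icc 0 S ∩ Icc 0 S, ∀ t, s ≤ t → t ≤ T →
      ‖Z T t s x - V t s x‖ < ε by simpa only [inter_self] using key
  -- Compactness reduces the claim to a neighbourhood of each `s₀`. The property is intersected with
  -- `[0, S]` because the neighbourhoods produced below may leave that interval.
  refine (isCompact_Icc (a := (0 : ℝ)) (b := S)).induction_on (p := fun A => ∃ T₀, ∀ T, T₀ ≤ T → ∀ s ∈ A ∩ Icc 0 S, ∀ t,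
    s ≤ t → t ≤ T → ‖Z T t s x - V t s x‖ < ε) ⟨0, by simp⟩ ?_ ?_ ?_
  · rintro A A' hA ⟨T₀, hT₀⟩
    exact ⟨T₀, fun T hT s hs => hT₀ T hT s ⟨hA hs.1, hs.2⟩⟩
  · rintro A A' ⟨T₀, hT₀⟩ ⟨T₁, hT₁⟩
    refine ⟨max T₀ T₁, fun T hT s hs => ?_⟩
    rcases hs.1 with hs1 | hs1
    · exact hT₀ T ((le_max_left _ _).trans hT) s ⟨hs1, hs.2⟩
    · exact hT₁ T ((le_max_right _ _).trans hT) s ⟨hs1, hs.2⟩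
  · intro s₀ hs₀
    have hm := (tendsto_gap_bound h.evolution hs₀.1 c x).mono_left
      (nhdsWithin_mono s₀ (fun r hr => hr.1 : Icc 0 S ⊆ Ici 0))
    have hl : Tendsto (fun s => 2 * c * |s - s₀| * ‖x‖) (𝓝[Icc 0 S] s₀) (𝓝 0) := by
      have : Continuous fun s => 2 * c * |s - s₀| * ‖x‖ := by fun_prop
      simpa using (this.tendsto s₀).mono_left nhdsWithin_le_nhds
    refine ⟨{s | c * (c * |s - s₀| * ‖x‖ + ‖Y (max s s₀) (min s s₀) x - x‖) < ε / 4 ∧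
      2 * c * |s - s₀| * ‖x‖ < ε}, (hm.eventually_lt_const (by positivity)).and
        (hl.eventually_lt_const hε), ?_⟩
    obtain ⟨u, v, ho⟩ := hopt s₀ x hs₀.1
    obtain ⟨T₀, hT₀⟩ := ho.exists_forall_norm_sub_lt h hP₀ hP hs₀.1
      (show 0 < ε / 4 by positivity)
    -- `S + 1` forces `T > 0`, which the finite-horizon data require.
    refine ⟨max T₀ (S + 1), fun T hT s hs t hst htT => ?_⟩
    obtain ⟨⟨hs1, hs2⟩, hs0, hsS⟩ := hs
    have hTS : S + 1 ≤ T := (le_max_right _ _).trans hT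
    have hT0 : 0 < T := by linarith
    -- If `t ≥ s₀`, compare through the initial time `s₀`, with three errors below `ε/4`. If `s ≤ t
    -- < s₀`, no trajectory from `s₀` reaches `t`, but then `t - s ≤ |s - s₀|` and both operators
    -- are close to `Y t s`.
    rcases le_or_gt s₀ t with hst0 | hst0
    · have h1 := norm_sub_le_of_gap hc0 (hP T hT0).closedLoop.evolution
        (fun s t' hs hst hst' htT => (hc T hT0 s hs hst (hst'.trans htT)).2.1 t' hst' htT)
        (fun s t' hs hst' htt htT => (hc T hT0 s hs (hst'.trans htt) (hst'.trans htT)).2.2 t'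
          hst' htt htT) hs0 hsS hs₀.1 hs₀.2 hst hst0 htT x
      have h2 := hT₀ T ((le_max_left _ _).trans hT) t hst0 htT
      rw [← eq_mildState h hP₀ hP hV hs₀.1 hst0 ho] at h2
      have h3 := norm_sub_le_of_gap hc0 (hVe.mono (fun r hr => hr.1 : Icc 0 T ⊆ Ici 0))
        (fun s t' hs hst hst' _ => hVc s t' hs hst hst')
        (fun s t' hs hst' htt _ => hVY s t' hs hst' htt) hs0 hsS hs₀.1 hs₀.2 hst hst0 htT x
      have e : Z T t s x - V t s x = (Z T t s x - Z T t s₀ x) + (Z T t s₀ x - V t s₀ x)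
          - (V t s x - V t s₀ x) := by abel
      rw [e]
      have h4 := norm_sub_le ((Z T t s x - Z T t s₀ x) + (Z T t s₀ x - V t s₀ x))
        (V t s x - V t s₀ x)
      have h5 := norm_add_le (Z T t s x - Z T t s₀ x) (Z T t s₀ x - V t s₀ x)
      linarith
    · have htS : t ≤ S := hst0.le.trans hs₀.2
      have h1 := (hc T hT0 s hs0 hsS (hst.trans htT)).2.2 t hst htS htT x
      have h2 := hVY s t hs0 hst htS x
      have h3 : t - s ≤ |s - s₀| := by
        rw [abs_sub_comm]
        exact (sub_le_sub_right hst0.le s).trans (le_abs_self _)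
      have h4 : c * (t - s) * ‖x‖ ≤ c * |s - s₀| * ‖x‖ := by gcongr
      have e : Z T t s x - V t s x = (Z T t s x - Y t s x) - (V t s x - Y t s x) := by abel
      rw [e]
      have h5 := norm_sub_le (Z T t s x - Y t s x) (V t s x - Y t s x)
      linarith

end IsOptimalControl

end LimitingClosedLoop

theorem mainTheorem8
    {H XB : Type*}
    [NormedAddCommGroup H] [InnerProductSpace ℝ H] [CompleteSpace H]
    [NormedAddCommGroup XB] [InnerProductSpace ℝ XB] [CompleteSpace XB]
    -- the evolution operator generated by `A_c(t)`, and the data of the control problem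
    (Y : ℝ → ℝ → H →L[ℝ] H) (hY : IsEvolutionOperator (Set.Ici 0) Y)
    (B : ℝ → XB →L[ℝ] H) (hB : IsBoundedContinuousInTime B)
    (W : ℝ → H →L[ℝ] H) (hW : IsBoundedContinuousInTime W)
    (hWpos : ∀ t : ℝ, 0 ≤ t → (W t).IsPositive)
    (R : ℝ → XB →L[ℝ] XB) (hR : IsBoundedContinuousInTime R) (hRcoer : IsUniformlyCoercive R)
    (P₀ : H →L[ℝ] H) (hP₀ : P₀.IsPositive)
    -- every initial condition admits a control of finite cost
    (hfin : ∀ s : ℝ, 0 ≤ s → ∀ x : H, ∃ u : ℝ → XB,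
      MeasureTheory.AEStronglyMeasurable u
        (MeasureTheory.volume.restrict (Set.Ioi s)) ∧
      infiniteHorizonCost Y B W R s x u < ⊤)
    -- `(A_c, W^{1/2})` is uniformly detectable, `W^{1/2}` being the nonnegative square root
    (Wsqrt : ℝ → H →L[ℝ] H)
    (hWsqrt : ∀ t : ℝ, 0 ≤ t → (Wsqrt t).IsPositive ∧ (Wsqrt t).comp (Wsqrt t) = W t)
    (hdet : IsUniformlyDetectable Y Wsqrt)
    -- the finite-horizon Riccati solutions and their closed-loop evolution operators
    (P : ℝ → ℝ → H →L[ℝ] H) (Yfin : ℝ → ℝ → ℝ → H →L[ℝ] H)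
    (hP : ∀ tf : ℝ, 0 < tf → IsFiniteHorizonRiccati Y B W R P₀ tf (P tf) (Yfin tf)) :
    (∃ (Pinf : ℝ → H →L[ℝ] H) (Yinf : ℝ → ℝ → H →L[ℝ] H),
      IsInfiniteHorizonOptimal Y B W R Pinf Yinf) ∧
    ∀ (Pinf : ℝ → H →L[ℝ] H) (Yinf : ℝ → ℝ → H →L[ℝ] H),
      IsInfiniteHorizonOptimal Y B W R Pinf Yinf →
      ∀ (z : H) (S : ℝ), 0 ≤ S → ∀ ε : ℝ, 0 < ε → ∃ T : ℝ, ∀ tf : ℝ, T ≤ tf →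
        ∀ s t : ℝ, 0 ≤ s → s ≤ S → s ≤ t → t ≤ tf →
          ‖Yfin tf t s z - Yinf t s z‖ < ε := by
  obtain ⟨b, w, ρ, δ, κ, α, h⟩ :=
    exists_isDetectableRegulator hY hB hW hWpos hR hRcoer hWsqrt hdet
  have hopt : ∀ s x, 0 ≤ s → ∃ u v, IsOptimalControl Y B W R s x u v := fun s x hs => by
    obtain ⟨u, v, h1, h2, h3, h4, h5⟩ := h.exists_optimal_control hs (hfin s hs x)
    exact ⟨u, v, h1, h2, h3, h4, h5⟩
  refine ⟨?_, fun Pinf Yinf hinf z S hS ε hε => ?_⟩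
  -- A separate choice at each time suffices, with 0 at negative times: `isClosedLoop_limit`
  -- requires no regularity of `Q` in time.
  · have hQ : ∀ s : ℝ, ∃ Q : H →L[ℝ] H, 0 ≤ s → Q.IsPositive ∧
        ∀ x, ENNReal.ofReal ⟪Q x, x⟫_ℝ = optimalCost Y B W R s x := fun s => by
      by_cases hs : 0 ≤ s
      · obtain ⟨Q, hQ⟩ := IsOptimalControl.exists_isPositive h hP₀ hP hopt hs
        exact ⟨Q, fun _ => hQ⟩
      · exact ⟨0, fun h => absurd h hs⟩
    choose Q hQ using hQ
    obtain ⟨V, hV⟩ := IsOptimalControl.exists_isLimitLoop h hP₀ hP hopt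
    exact ⟨Q, V, fun s hs => (hQ s hs).1, fun s hs => (hQ s hs).2,
      IsOptimalControl.isClosedLoop_limit h hP₀ hP hopt hV (fun s hs => (hQ s hs).1)
        fun s hs => (hQ s hs).2⟩
  · obtain ⟨T₀, hT₀⟩ := IsOptimalControl.tendstoUniformly_closedLoop h hP₀ hP hopt
      (IsOptimalControl.isLimitLoop_of_isInfiniteHorizonOptimal h hP₀ hP hopt hinf) z hS hε
    exact ⟨T₀, fun tf htf s t hs hsS hst httf => hT₀ tf htf s ⟨hs, hsS⟩ t hst httf⟩
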